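/- Let $\nu,a>0$, let $\alpha,\beta,\gamma\in\mathbb R$ with $\beta\gamma>0$, and let $\sigma\in(-\tfrac32,\tfrac12)$, $\sigma\neq-\tfrac12$. **Spaces.** Let $e_k(z)=\sqrt{2/a}\,\sin(k\pi z/a)$, $k\ge1$. For $\zeta=(\xi,\eta)\in\mathbb Z^2$ and $s\in\mathbb R$ let $H^s_\zeta$ be the Hilbert space of the sine series $f=\sum_{k\ge1}f_ke_k$ on $(0,a)$ with $\|f\|_{s,\zeta}^2=\sum_{k\ge 1}(1+\nu k^2+\nu|\zeta|^2)^s|f_k|^2<\infty$; the same symbol denotes the norms of pairs and triples. Let $(H^{s}_\zeta)^2_{\rm div}=\{(u,v)\in (H^s_\zeta)^2:\int_0^a(\xi u+\eta v)\,dz=0\}$ for $s>\frac12$. **Spectral set.** Let $\Omega=(\mathbb R/2\pi\mathbb Z)^2\times(0,a)$, and let $\mathcal V$ be the space of $X=(u,v,\theta)\in H^1(\Omega)^3$ such that $u,v,\theta$ vanish at $z=0$ and $z=a$ and $\int_0^a(\partial_xu+\partial_yv)\,dz=0$. Put $w=-\int_0^z(\partial_xu+\partial_yv)\,dz'$, and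 likewise $w'$ for $X'=(u',v',\theta')$. Let $\mathbb V_P$ be the set of the $\lambda\in\mathbb C$ for which there is a nonzero $X\in\mathcal V$ such that for all $X'\in\mathcal V$ $$\lambda\int_\Omega\Big(u\overline{u'}+v\overline{v'}+\tfrac\beta\gamma\theta\overline{\theta'}\Big)+\nu\int_\Omega\Big(\nabla u\cdot\nabla\overline{u'}+\nabla v\cdot\nabla\overline{v'}+\tfrac\beta\gamma\nabla\theta\cdot\nabla\overline{\theta'}\Big)+\beta\int_\Omega(-\theta\overline{w'}+w\overline{\theta'})+\alpha\int_\Omega(-v\overline{u'}+u\overline{v'})=0 .$$ Let $\delta_1>0$ and $\delta_2<\min\big(\frac{\nu\pi^2}{2a^2},\frac\nu2\big)$ be such that the set $$\mathbb S=\{-\delta_2-\mu_1+i\mu_2:\ \mu_1,\mu_2\in\mathbb R,\ |\mu_2|\ge\mu_1/\delta_1\}$$ satisfies $\mathbb S\cap\mathbb V_P=\emptyset$. **Notation.** For $\lambda\in\mathbb S$ and $\zeta\in\mathbb Z^2\setminus\{0\}$ let $\omega^2=\lambda+\nu|\zeta|^2$, $\langle\zeta\rangle=1+|\zeta|$, $\langle\omega\rangle^2=|\lambda|+\langle\zeta\rangle^2$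 and $$M_s=M_s(\lambda,\zeta)=\Big(\sum_{k\ge1}\frac1{k^2(k^4+\langle\omega\rangle^4)(k^2+\langle\zeta\rangle^2)^s}\Big)^{1/2}\qquad(s>-\tfrac52).$$ Let $\mathcal L=\mathcal L_0+\mathcal L_1:\ (H^{\sigma+2}_\zeta)^2_{\rm div}\times\mathbb C\times H^{\sigma+2}_\zeta\to(H^\sigma_\zeta)^3$, where $$\mathcal L_0(u,v,p_0,\theta)=\begin{pmatrix}(\omega^2-\nu\partial_{zz})u+i\xi p_0\\(\omega^2-\nu\partial_{zz})v+i\eta p_0\\(\omega^2-\nu\partial_{zz})\theta\end{pmatrix},\qquad \mathcal L_1(u,v,p_0,\theta)=\begin{pmatrix}-\alpha v+i\xi\beta\int_0^z\theta\\ \alpha u+i\eta\beta\int_0^z\theta\\-\gamma\int_0^z(i\xi u+i\eta v)\end{pmatrix}.$$ **Theorem.** There is a constant $C>0$, independent of $(\lambda,\zeta)$, such that for all $\lambda\in\mathbb S$ and $\zeta\in\mathbb Z^2\setminus\{0\}$ the operator $\mathcal L$ is well defined between these spaces, continuous and bijective, and such that, whenever $\mathcal L(u,v,p_0,\theta)=F$,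 one can write $(u,v)=Y_1+Y_2$ with $Y_1,Y_2\in (H^{\sigma+2}_\zeta)^2$ and the following estimates hold: (a) $|\zeta|\,|p_0|\le C\langle\omega\rangle^2M_\sigma\|F\|_{\sigma,\zeta}$; (b) $M_{-\sigma-2}M_{-\sigma}^{-1}\|Y_1\|_{\sigma,\zeta}+\|Y_1\|_{\sigma+2,\zeta}\le C\langle\omega\rangle^2M_\sigma M_{-\sigma-2}\|F\|_{\sigma,\zeta}$; (c) $\langle\omega\rangle^2\|Y_2\|_{\sigma,\zeta}+\|Y_2\|_{\sigma+2,\zeta}\le C\|F\|_{\sigma,\zeta}$; (d) $\langle\omega\rangle^2\|\theta\|_{\sigma,\zeta}+\|\theta\|_{\sigma+2,\zeta}\le C\|F\|_{\sigma,\zeta}$. -/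

import Mathlib

open scoped ComplexConjugate

noncomputable section

namespace PrimEq

/-! ## Sine series on `(0,a)` -/

/-- `|ζ|² = ξ² + η²` for `ζ = (ξ,η) ∈ ℤ²`. -/
def zsq (ζ : ℤ × ℤ) : ℝ := (ζ.1 : ℝ) ^ 2 + (ζ.2 : ℝ) ^ 2

/-- The orthonormal sine functions `e_k(z) = √(2/a) sin(kπz/a)`, `k ≥ 1`. -/
def sineFun (a : ℝ) (k : ℕ+) (z : ℝ) : ℝ :=
  Real.sqrt (2 / a) * Real.sin ((k : ℝ) * Real.pi * z / a)

/-- The function `z ↦ ∑_k f_k e_k(z)` with sine coefficients `f`. It is only used for coefficients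
in `H^s_ζ` with `s > 1/2`, for which the series converges absolutely and uniformly. -/
def toFunction (a : ℝ) (f : ℕ+ → ℂ) (z : ℝ) : ℂ := ∑' k : ℕ+, f k * (sineFun a k z : ℂ)

/-- The sine coefficients `∫_0^a g(z) e_k(z) dz` of a function on `(0,a)`. It is only used for
continuous functions on `[0,a]`. -/
def sineCoeff (a : ℝ) (g : ℝ → ℂ) (k : ℕ+) : ℂ := ∫ z in (0 : ℝ)..a, g z * (sineFun a k z : ℂ)

/-! ## The spaces `H^s_ζ` -/

/-- The weight `1 + ν k² + ν |ζ|²`. -/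
def weight (ν : ℝ) (ζ : ℤ × ℤ) (k : ℕ+) : ℝ := 1 + ν * (k : ℝ) ^ 2 + ν * zsq ζ

/-- `‖f‖_{s,ζ} = (∑_k (1 + ν k² + ν |ζ|²)^s |f_k|²)^{1/2}`. -/
def sobNorm (ν s : ℝ) (ζ : ℤ × ℤ) (f : ℕ+ → ℂ) : ℝ :=
  Real.sqrt (∑' k : ℕ+, weight ν ζ k ^ s * ‖f k‖ ^ 2)

/-- The norm `‖·‖_{s,ζ}` of a pair. -/
def sobNorm₂ (ν s : ℝ) (ζ : ℤ × ℤ) (f g : ℕ+ → ℂ) : ℝ :=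
  Real.sqrt (sobNorm ν s ζ f ^ 2 + sobNorm ν s ζ g ^ 2)

/-- The norm `‖·‖_{s,ζ}` of a triple. -/
def sobNorm₃ (ν s : ℝ) (ζ : ℤ × ℤ) (f g h : ℕ+ → ℂ) : ℝ :=
  Real.sqrt (sobNorm ν s ζ f ^ 2 + sobNorm ν s ζ g ^ 2 + sobNorm ν s ζ h ^ 2)

theorem zsq_nonneg (ζ : ℤ × ℤ) : 0 ≤ zsq ζ := by unfold zsq; positivity

theorem weight_pos {ν : ℝ} (hν : 0 < ν) (ζ : ℤ × ℤ) (k : ℕ+) : 0 < weight ν ζ k := by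
  have := zsq_nonneg ζ
  unfold weight; positivity

theorem norm_sq_weighted {ν : ℝ} (hν : 0 < ν) (s : ℝ) (ζ : ℤ × ℤ) (f : ℕ+ → ℂ) (k : ℕ+) :
    ‖((weight ν ζ k ^ (s / 2) : ℝ) : ℂ) * f k‖ ^ (2 : ENNReal).toReal
      = weight ν ζ k ^ s * ‖f k‖ ^ 2 := by
  have hw := weight_pos hν ζ k
  have h2 : (2 : ENNReal).toReal = 2 := by simp
  rw [h2, Real.rpow_two, norm_mul, mul_pow, Complex.norm_real, Real.norm_of_nonneg
    (Real.rpow_nonneg hw.le _), ← Real.rpow_natCast, ← Real.rpow_mul hw.le]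
  norm_num

theorem memℓp_weighted_iff {ν : ℝ} (hν : 0 < ν) (s : ℝ) (ζ : ℤ × ℤ) (f : ℕ+ → ℂ) :
    Memℓp (fun k : ℕ+ => ((weight ν ζ k ^ (s / 2) : ℝ) : ℂ) * f k) 2 ↔
      Summable fun k : ℕ+ => weight ν ζ k ^ s * ‖f k‖ ^ 2 := by
  rw [memℓp_gen_iff (by simp)]
  simp only [norm_sq_weighted hν]

/-- The sequences of sine coefficients `f` with `‖f‖_{s,ζ} < ∞`, as a vector space. -/
def sobSubmodule (ν s : ℝ) [hν : Fact (0 < ν)] (ζ : ℤ × ℤ) : Submodule ℂ (ℕ+ → ℂ) where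
  carrier := {f | Summable fun k : ℕ+ => weight ν ζ k ^ s * ‖f k‖ ^ 2}
  zero_mem' := by simp [summable_zero]
  add_mem' := by
    intro f g hf hg
    rw [Set.mem_ofPred_eq, ← memℓp_weighted_iff hν.out] at hf hg ⊢
    convert hf.add hg using 1
    ext k
    simp [mul_add]
  smul_mem' := by
    intro c f hf
    rw [Set.mem_ofPred_eq, ← memℓp_weighted_iff hν.out] at hf ⊢
    convert hf.const_smul c using 1
    ext k
    simp [mul_left_comm]

/-- The space `H^s_ζ` of sine series `f = ∑_k f_k e_k` on `(0,a)` with `‖f‖_{s,ζ} < ∞`. An element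
is given by its coefficients `f_k`. -/
def HSob (ν s : ℝ) [Fact (0 < ν)] (ζ : ℤ × ℤ) : Type := ↥(sobSubmodule ν s ζ)

namespace HSob

variable {ν s : ℝ} [Fact (0 < ν)] {ζ : ℤ × ℤ}

instance : AddCommGroup (HSob ν s ζ) := inferInstanceAs (AddCommGroup ↥(sobSubmodule ν s ζ))

instance : Module ℂ (HSob ν s ζ) := inferInstanceAs (Module ℂ ↥(sobSubmodule ν s ζ))

/-- The coefficients `f_k` of an element of `H^s_ζ`. -/
def coeff (f : HSob ν s ζ) : ℕ+ → ℂ := f.1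

theorem summable (f : HSob ν s ζ) : Summable fun k : ℕ+ => weight ν ζ k ^ s * ‖f.coeff k‖ ^ 2 :=
  f.2

/-- The weighted coefficients `(1 + ν k² + ν |ζ|²)^{s/2} f_k`, an element of `ℓ²`. -/
def toLp : HSob ν s ζ →ₗ[ℂ] lp (fun _ : ℕ+ => ℂ) 2 where
  toFun f := ⟨fun k => ((weight ν ζ k ^ (s / 2) : ℝ) : ℂ) * f.coeff k,
    (memℓp_weighted_iff (Fact.out : 0 < ν) s ζ f.coeff).2 f.summable⟩
  map_add' f g := by
    ext k
    exact mul_add _ _ _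
  map_smul' c f := by
    ext k
    exact mul_left_comm _ _ _

theorem toLp_injective : Function.Injective (toLp : HSob ν s ζ → lp (fun _ : ℕ+ => ℂ) 2) := by
  intro f g h
  apply Subtype.ext
  funext k
  have hk : ((weight ν ζ k ^ (s / 2) : ℝ) : ℂ) * f.coeff k
      = ((weight ν ζ k ^ (s / 2) : ℝ) : ℂ) * g.coeff k := congrFun (congrArg Subtype.val h) k
  have hw : ((weight ν ζ k ^ (s / 2) : ℝ) : ℂ) ≠ 0 :=
    Complex.ofReal_ne_zero.2 (Real.rpow_pos_of_pos (weight_pos Fact.out ζ k) _).ne'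
  exact mul_left_cancel₀ hw hk

/-- `H^s_ζ` carries the norm `‖·‖_{s,ζ}`, see `HSob.norm_eq`. -/
instance : NormedAddCommGroup (HSob ν s ζ) :=
  NormedAddCommGroup.induced (HSob ν s ζ) (lp (fun _ : ℕ+ => ℂ) 2) toLp toLp_injective

instance : NormedSpace ℂ (HSob ν s ζ) :=
  NormedSpace.induced ℂ (HSob ν s ζ) (lp (fun _ : ℕ+ => ℂ) 2) toLp

theorem norm_eq (f : HSob ν s ζ) : ‖f‖ = sobNorm ν s ζ f.coeff := by
  have h : ‖f‖ = ‖toLp f‖ := rfl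
  rw [h, lp.norm_eq_tsum_rpow (by simp), sobNorm, Real.sqrt_eq_rpow]
  congr 1
  exact tsum_congr fun k => norm_sq_weighted (Fact.out : 0 < ν) s ζ f.coeff k

end HSob

/-! ## The operators -/

/-- The domain `(H^s_ζ)²_div × ℂ × H^s_ζ`: the `(u,v,p₀,θ)` with `∫_0^a (ξ u + η v) dz = 0`. -/
def Dom (ν a s : ℝ) [Fact (0 < ν)] (ζ : ℤ × ℤ) :
    Set (HSob ν s ζ × HSob ν s ζ × ℂ × HSob ν s ζ) :=
  {x | ∫ z in (0 : ℝ)..a, ((ζ.1 : ℂ) * toFunction a x.1.coeff z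
      + (ζ.2 : ℂ) * toFunction a x.2.1.coeff z) = 0}

/-- `(ω² - ν ∂_zz) f` for `f = ∑_k f_k e_k`; the series is differentiated term by term, as it may
be in the sense of distributions on `(0,a)`, and `-∂_zz e_k = (kπ/a)² e_k`. -/
def helmholtz (ν a : ℝ) (ω2 : ℂ) (f : ℕ+ → ℂ) (k : ℕ+) : ℂ :=
  (ω2 + ((ν * (k : ℝ) ^ 2 * Real.pi ^ 2 / a ^ 2 : ℝ) : ℂ)) * f k

/-- The primitive `z ↦ ∫_0^z f(z') dz'` of `f = ∑_k f_k e_k`. -/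
def primitive (a : ℝ) (f : ℕ+ → ℂ) (z : ℝ) : ℂ := ∫ t in (0 : ℝ)..z, toFunction a f t

/-- `w(z) = -∫_0^z (i ξ u + i η v) dz'`. -/
def vertVel (a : ℝ) (ζ : ℤ × ℤ) (u v : ℕ+ → ℂ) (z : ℝ) : ℂ :=
  -∫ t in (0 : ℝ)..z, (Complex.I * (ζ.1 : ℂ) * toFunction a u t
      + Complex.I * (ζ.2 : ℂ) * toFunction a v t)

/-- The sine coefficients of the uncoupled operator
`𝓛₀(u,v,p₀,θ) = ((ω²-ν∂_zz)u + iξp₀, (ω²-ν∂_zz)v + iηp₀, (ω²-ν∂_zz)θ)`, `ω² = lam + ν|ζ|²`. -/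
def opL0 (ν a : ℝ) (lam : ℂ) (ζ : ℤ × ℤ) (u v : ℕ+ → ℂ) (p₀ : ℂ) (θ : ℕ+ → ℂ) :
    (ℕ+ → ℂ) × (ℕ+ → ℂ) × (ℕ+ → ℂ) :=
  let ω2 : ℂ := lam + ((ν * zsq ζ : ℝ) : ℂ)
  (helmholtz ν a ω2 u + sineCoeff a (fun _ => Complex.I * (ζ.1 : ℂ) * p₀),
    helmholtz ν a ω2 v + sineCoeff a (fun _ => Complex.I * (ζ.2 : ℂ) * p₀),
    helmholtz ν a ω2 θ)

/-- The sine coefficients of the coupling operator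
`𝓛₁(u,v,p₀,θ) = (-αv + iξβ∫_0^z θ, αu + iηβ∫_0^z θ, -γ∫_0^z (iξu + iηv))`. -/
def opL1 (a α β γ : ℝ) (ζ : ℤ × ℤ) (u v : ℕ+ → ℂ) (_p₀ : ℂ) (θ : ℕ+ → ℂ) :
    (ℕ+ → ℂ) × (ℕ+ → ℂ) × (ℕ+ → ℂ) :=
  (-(α : ℂ) • v + sineCoeff a (fun z => Complex.I * (ζ.1 : ℂ) * (β : ℂ) * primitive a θ z),
    (α : ℂ) • u + sineCoeff a (fun z => Complex.I * (ζ.2 : ℂ) * (β : ℂ) * primitive a θ z),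
    sineCoeff a (fun z => (γ : ℂ) * vertVel a ζ u v z))

/-- `T` is the operator `𝓛 = 𝓛₀ + 𝓛₁ : (H^{σ+2}_ζ)²_div × ℂ × H^{σ+2}_ζ → (H^σ_ζ)³`. -/
def IsCoupledOperator (ν a α β γ σ : ℝ) [Fact (0 < ν)] (lam : ℂ) (ζ : ℤ × ℤ)
    (T : Dom ν a (σ + 2) ζ → HSob ν σ ζ × HSob ν σ ζ × HSob ν σ ζ) : Prop :=
  ∀ (u v : HSob ν (σ + 2) ζ) (p₀ : ℂ) (θ : HSob ν (σ + 2) ζ)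
    (h : (u, v, p₀, θ) ∈ Dom ν a (σ + 2) ζ),
    ((T ⟨(u, v, p₀, θ), h⟩).1.coeff, (T ⟨(u, v, p₀, θ), h⟩).2.1.coeff,
        (T ⟨(u, v, p₀, θ), h⟩).2.2.coeff)
      = opL0 ν a lam ζ u.coeff v.coeff p₀ θ.coeff + opL1 a α β γ ζ u.coeff v.coeff p₀ θ.coeff

/-! ## The functions `⟨ζ⟩`, `⟨ω⟩`, `M_σ` -/

/-- `⟨ζ⟩ = 1 + |ζ|`. -/
def japZ (ζ : ℤ × ℤ) : ℝ := 1 + Real.sqrt (zsq ζ)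

/-- `⟨ω⟩² = |lam| + ⟨ζ⟩²`. -/
def japOmegaSq (lam : ℂ) (ζ : ℤ × ℤ) : ℝ := ‖lam‖ + japZ ζ ^ 2

/-- `M_σ(lam,ζ) = (∑_k 1 / (k² (k⁴ + ⟨ω⟩⁴) (k² + ⟨ζ⟩²)^σ))^{1/2}`. -/
def bigM (σ : ℝ) (lam : ℂ) (ζ : ℤ × ℤ) : ℝ :=
  Real.sqrt (∑' k : ℕ+, 1 / ((k : ℝ) ^ 2 * ((k : ℝ) ^ 4 + japOmegaSq lam ζ ^ 2)
    * ((k : ℝ) ^ 2 + japZ ζ ^ 2) ^ σ))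

/-! ## Eigenvalues of the Primitive Equations operator on `Ω = 𝕋² × (0,a)`

A function on `Ω` is given by its coefficients `f_{k,ζ}` in the orthonormal basis
`e_k(z) (2π)⁻¹ e^{i(ξx+ηy)}` of `L²(Ω)`. -/

/-- Coefficients `(ζ,k) ↦ f_{k,ζ}`. -/
abbrev Coeffs : Type := ℤ × ℤ → ℕ+ → ℂ

/-- `f ∈ 𝓗¹(Ω)`, that is, `f ∈ H¹(Ω)` and `f` vanishes at `z = 0` and at `z = a`. -/
def MemH1 (ν : ℝ) (f : Coeffs) : Prop :=
  Summable fun p : (ℤ × ℤ) × ℕ+ => weight ν p.1 p.2 * ‖f p.1 p.2‖ ^ 2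

/-- `X = (u,v,θ) ∈ 𝓥`: `u`, `v`, `θ` lie in `𝓗¹(Ω)` and `∫_0^a (∂_x u + ∂_y v) dz = 0` on `𝕋²`,
which is a condition on each horizontal Fourier coefficient. -/
def MemV (ν a : ℝ) (X : Coeffs × Coeffs × Coeffs) : Prop :=
  MemH1 ν X.1 ∧ MemH1 ν X.2.1 ∧ MemH1 ν X.2.2 ∧
    ∀ ζ : ℤ × ℤ, ∫ z in (0 : ℝ)..a, (Complex.I * (ζ.1 : ℂ) * toFunction a (X.1 ζ) z
      + Complex.I * (ζ.2 : ℂ) * toFunction a (X.2.1 ζ) z) = 0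

/-- `u ū' + v v̄' + (β/γ) θ θ̄'` for the coefficients with index `(ζ,k)`. -/
def density (β γ : ℝ) (X X' : Coeffs × Coeffs × Coeffs) (p : (ℤ × ℤ) × ℕ+) : ℂ :=
  X.1 p.1 p.2 * conj (X'.1 p.1 p.2) + X.2.1 p.1 p.2 * conj (X'.2.1 p.1 p.2)
    + ((β / γ : ℝ) : ℂ) * (X.2.2 p.1 p.2 * conj (X'.2.2 p.1 p.2))

/-- `(X,X')_𝓗 = ∫_Ω (u ū' + v v̄' + (β/γ) θ θ̄')`. -/
def innerH (β γ : ℝ) (X X' : Coeffs × Coeffs × Coeffs) : ℂ :=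
  ∑' p : (ℤ × ℤ) × ℕ+, density β γ X X' p

/-- `(X,X')_𝓥 = ∫_Ω (∇u·∇ū' + ∇v·∇v̄' + (β/γ) ∇θ·∇θ̄')`. -/
def innerV (a β γ : ℝ) (X X' : Coeffs × Coeffs × Coeffs) : ℂ :=
  ∑' p : (ℤ × ℤ) × ℕ+,
    ((zsq p.1 + (p.2 : ℝ) ^ 2 * Real.pi ^ 2 / a ^ 2 : ℝ) : ℂ) * density β γ X X' p

/-- `B(X,X') = ∫_Ω (-θ w̄' + w θ̄')`, where `w = -∫_0^z (∂_x u + ∂_y v)`. -/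
def formB (a : ℝ) (X X' : Coeffs × Coeffs × Coeffs) : ℂ :=
  ∑' ζ : ℤ × ℤ, ∫ z in (0 : ℝ)..a,
    (-(toFunction a (X.2.2 ζ) z * conj (vertVel a ζ (X'.1 ζ) (X'.2.1 ζ) z))
      + vertVel a ζ (X.1 ζ) (X.2.1 ζ) z * conj (toFunction a (X'.2.2 ζ) z))

/-- `C(X,X') = ∫_Ω (-v ū' + u v̄')`. -/
def formC (X X' : Coeffs × Coeffs × Coeffs) : ℂ :=
  ∑' p : (ℤ × ℤ) × ℕ+,
    (-(X.2.1 p.1 p.2 * conj (X'.1 p.1 p.2)) + X.1 p.1 p.2 * conj (X'.2.1 p.1 p.2))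

/-- The eigenvalues of `-P : 𝓥 → 𝓥'`, where `P = νA + βB + αC` is the Primitive Equations
operator: the `lam` such that `⟨(lam + P) X, X'⟩ = 0` for all `X' ∈ 𝓥`, for some nonzero
`X ∈ 𝓥`. -/
def eigenvaluesP (ν a α β γ : ℝ) : Set ℂ :=
  {lam | ∃ X : Coeffs × Coeffs × Coeffs, MemV ν a X ∧ X ≠ 0 ∧
    ∀ X' : Coeffs × Coeffs × Coeffs, MemV ν a X' →
      lam * innerH β γ X X' + (ν : ℂ) * innerV a β γ X X' + (β : ℂ) * formB a X X'
        + (α : ℂ) * formC X X' = 0}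

/-- The set `𝕊 = {-δ₂ - μ₁ + iμ₂ : |μ₂| ≥ μ₁/δ₁}`. -/
def setS (δ₁ δ₂ : ℝ) : Set ℂ :=
  {lam | ∃ μ₁ μ₂ : ℝ, 1 / δ₁ * μ₁ ≤ |μ₂| ∧
    lam = -(δ₂ : ℂ) - (μ₁ : ℂ) + Complex.I * (μ₂ : ℂ)}

end PrimEq

end

open PrimEq

/-! ### Weights, weighted `ℓ²` spaces and the embedding into `ℓ¹`. -/

noncomputable section

namespace PrimEq

/-! In sine coefficients `ω² - ν∂_zz` is multiplication by the symbol `s_k = ω² + νk²π²/a²`, so the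
uncoupled problem `𝓛₀ x = F` is explicit: the velocity is `(F - iζp₀)/s_k` (with `p₀` multiplying
the coefficients `c_k = ∫ e_k` of the constant function), and the constraint `∫ (ξu + ηv) = 0`
becomes one scalar equation for `p₀` with determinant `D = ∑ c_k²/s_k`. For `λ ∈ 𝕊`, `ζ ≠ 0` all the
`s_k` lie in one rotated half plane, at a distance from its boundary comparable with `k² + ⟨ω⟩²`. As
`c_k` is real, the terms of `D` cannot cancel, and `|D| ≥ c⟨ω⟩⁻²` (`exists_symbol_bounds`).
Cauchy-Schwarz with `c_k = O(1/k)` then produces the factor `M_σ` in the bound for `p₀`. The part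
`-iζp₀c_k/s_k` of the velocity is `Y₁`, with norms governed by `M_{-σ}` and `M_{-σ-2}`; the rest is
`Y₂`.

The coupling `𝓛₁` is compact: a primitive need not vanish at `z = a`, but its sine coefficients are
`O(1/k)`, which puts it in `H^s` for every `s < 1/2`. Since `𝓛 = (1 + 𝓛₁𝓛₀⁻¹)𝓛₀`, the Fredholm
alternative reduces bijectivity to injectivity. A nonzero kernel element, placed in the single
horizontal mode `ζ`, would be an eigenfunction, which `𝕊 ∩ 𝕍_P = ∅` excludes (`eq_zero_of_kernel`).

Uniformity in `(λ,ζ)` rests on the estimate `‖𝓛₀x‖ ≤ C‖𝓛x‖` (`exists_apriori`). For large `⟨ω⟩` the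
coupling is absorbed, because `‖𝓛₁x‖ ≤ C⟨ω⟩^{-2ε}‖𝓛₀x‖` with `ε > 0` (`exists_coupling_le`). What
remains is finitely many `ζ` and a compact set of `λ`, and on it a bound at one `λ₀` persists nearby
(`exists_apriori_nhds`). Then (a)-(d) follow from the uncoupled formulas applied to the datum `𝓛₀x`
in place of `F`. -/

theorem tsum_mul_le_sqrt_mul_sqrt {ι : Type*} {f g : ι → ℝ} (hf : ∀ i, 0 ≤ f i) (hg : ∀ i, 0 ≤ g i)
    (hf2 : Summable fun i => f i ^ 2) (hg2 : Summable fun i => g i ^ 2) :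
    (Summable fun i => f i * g i) ∧
      ∑' i, f i * g i ≤ Real.sqrt (∑' i, f i ^ 2) * Real.sqrt (∑' i, g i ^ 2) := by
  have h := Real.summable_and_inner_le_Lp_mul_Lq_tsum_of_nonneg (p := 2) (q := 2)
    Real.HolderConjugate.two_two hf hg (by simpa using hf2) (by simpa using hg2)
  simpa [Real.sqrt_eq_rpow] using h

theorem summable_pnat_rpow_neg {p : ℝ} (hp : 1 < p) : Summable fun k : ℕ+ => (k : ℝ) ^ (-p) := by
  have h : Summable fun n : ℕ => (n : ℝ) ^ (-p) := Real.summable_nat_rpow.2 (by linarith)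
  exact h.comp_injective PNat.coe_injective

theorem one_le_pnat_cast (k : ℕ+) : (1 : ℝ) ≤ (k : ℝ) := by exact_mod_cast k.pos

theorem pnat_cast_pos (k : ℕ+) : (0 : ℝ) < (k : ℝ) := by exact_mod_cast k.pos

theorem summable_inv_pnat_sq : Summable fun k : ℕ+ => ((k : ℝ) ^ 2)⁻¹ := by
  refine (summable_pnat_rpow_neg (p := 2) (by norm_num)).congr fun k => ?_
  rw [Real.rpow_neg (pnat_cast_pos k).le, Real.rpow_two]

theorem one_le_zsq {ζ : ℤ × ℤ} (hζ : ζ ≠ 0) : 1 ≤ zsq ζ := by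
  have h : (1 : ℤ) ≤ ζ.1 ^ 2 + ζ.2 ^ 2 := by
    by_contra h
    have h1 : ζ.1 ^ 2 = 0 := by nlinarith [sq_nonneg ζ.1, sq_nonneg ζ.2]
    have h2 : ζ.2 ^ 2 = 0 := by nlinarith [sq_nonneg ζ.1, sq_nonneg ζ.2]
    exact hζ (Prod.ext (by simpa using h1) (by simpa using h2))
  unfold zsq
  exact_mod_cast h

/-- The weight `k² + ⟨ζ⟩²`, comparable with `weight ν ζ k`. -/
def japWeight (ζ : ℤ × ℤ) (k : ℕ+) : ℝ := (k : ℝ) ^ 2 + japZ ζ ^ 2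

theorem one_le_japZ (ζ : ℤ × ℤ) : 1 ≤ japZ ζ := by
  unfold japZ; linarith [Real.sqrt_nonneg (zsq ζ)]

theorem japZ_sq_le (ζ : ℤ × ℤ) : japZ ζ ^ 2 ≤ 2 + 2 * zsq ζ := by
  have h := Real.sq_sqrt (zsq_nonneg ζ)
  unfold japZ
  nlinarith [sq_nonneg (1 - Real.sqrt (zsq ζ))]

theorem zsq_le_japZ_sq (ζ : ℤ × ℤ) : 1 + zsq ζ ≤ japZ ζ ^ 2 := by
  have h := Real.sq_sqrt (zsq_nonneg ζ)
  unfold japZ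
  nlinarith [Real.sqrt_nonneg (zsq ζ)]

theorem japWeight_pos (ζ : ℤ × ℤ) (k : ℕ+) : 0 < japWeight ζ k := by
  have := pnat_cast_pos k
  unfold japWeight; positivity

theorem one_le_japWeight (ζ : ℤ × ℤ) (k : ℕ+) : 1 ≤ japWeight ζ k := by
  have := one_le_pnat_cast k
  unfold japWeight; nlinarith [sq_nonneg (japZ ζ)]

theorem abs_fst_le_japZ (ζ : ℤ × ℤ) : |(ζ.1 : ℝ)| ≤ japZ ζ := by
  have : |(ζ.1 : ℝ)| ≤ Real.sqrt (zsq ζ) := Real.abs_le_sqrt (by unfold zsq; nlinarith [sq_nonneg (ζ.2 : ℝ)])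
  unfold japZ; linarith

theorem abs_snd_le_japZ (ζ : ℤ × ℤ) : |(ζ.2 : ℝ)| ≤ japZ ζ := by
  have : |(ζ.2 : ℝ)| ≤ Real.sqrt (zsq ζ) := Real.abs_le_sqrt (by unfold zsq; nlinarith [sq_nonneg (ζ.1 : ℝ)])
  unfold japZ; linarith

/-- Positive quantities that are comparable with uniform constants have comparable powers. -/
theorem exists_rpow_comparison {ι : Type*} {x y : ι → ℝ} (hx : ∀ i, 0 < x i) (hy : ∀ i, 0 < y i)
    {A B : ℝ} (hA : 0 < A) (hB : 0 < B) (h1 : ∀ i, x i ≤ A * y i) (h2 : ∀ i, y i ≤ B * x i)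
    (s : ℝ) : ∃ C : ℝ, 0 < C ∧ ∀ i, x i ^ s ≤ C * y i ^ s := by
  -- A negative power reverses inequalities, so each sign of `s` uses a different one of the two
  -- bounds.
  rcases le_total 0 s with hs | hs
  · refine ⟨A ^ s, Real.rpow_pos_of_pos hA s, fun i => ?_⟩
    rw [← Real.mul_rpow hA.le (hy i).le]
    exact Real.rpow_le_rpow (hx i).le (h1 i) hs
  · refine ⟨B⁻¹ ^ s, Real.rpow_pos_of_pos (inv_pos.2 hB) s, fun i => ?_⟩
    rw [← Real.mul_rpow (inv_pos.2 hB).le (hy i).le]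
    refine Real.rpow_le_rpow_of_nonpos (mul_pos (inv_pos.2 hB) (hy i)) ?_ hs
    rw [inv_mul_le_iff₀ hB]
    exact h2 i

theorem sobNorm_nonneg {ν : ℝ} (s : ℝ) (ζ : ℤ × ℤ) (f : ℕ+ → ℂ) : 0 ≤ sobNorm ν s ζ f := Real.sqrt_nonneg _

variable {ν : ℝ} [hν : Fact (0 < ν)]

theorem weight_le_japWeight (ζ : ℤ × ℤ) (k : ℕ+) : weight ν ζ k ≤ (1 + ν) * japWeight ζ k := by
  have h1 := zsq_le_japZ_sq ζ
  have h2 := zsq_nonneg ζ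
  have h3 := hν.out
  have h4 := one_le_pnat_cast k
  unfold weight japWeight
  nlinarith [mul_le_mul_of_nonneg_left h1 h3.le]

theorem japWeight_le_weight (ζ : ℤ × ℤ) (k : ℕ+) :
    japWeight ζ k ≤ (2 * (1 + ν⁻¹)) * weight ν ζ k := by
  have h1 := japZ_sq_le ζ
  have h2 := zsq_nonneg ζ
  have h3 := hν.out
  have h5 : 0 ≤ ν⁻¹ := (inv_pos.2 h3).le
  have h6 : ν⁻¹ * weight ν ζ k = ν⁻¹ + (k : ℝ) ^ 2 + zsq ζ := by
    unfold weight; field_simp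
  have h7 : 1 ≤ weight ν ζ k := by unfold weight; nlinarith [mul_nonneg h3.le (sq_nonneg (k : ℝ)), mul_nonneg h3.le h2]
  have : 2 * (1 + ν⁻¹) * weight ν ζ k = 2 * weight ν ζ k + 2 * (ν⁻¹ * weight ν ζ k) := by ring
  rw [this, h6]
  unfold japWeight
  nlinarith [sq_nonneg (k : ℝ)]

/-- Together with its converse below, this passes between the `ν`-dependent weight of the norms and
the weight `k² + ⟨ζ⟩²` that occurs in `M_s`. The constants depend on `ν` and `s` only. -/
theorem exists_weight_rpow_le (ν : ℝ) [Fact (0 < ν)] (s : ℝ) : ∃ C : ℝ, 0 < C ∧ ∀ (ζ : ℤ × ℤ) (k : ℕ+),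
    weight ν ζ k ^ s ≤ C * japWeight ζ k ^ s := by
  have h3 : 0 < ν := Fact.out
  obtain ⟨C, hC, h⟩ := exists_rpow_comparison (ι := (ℤ × ℤ) × ℕ+)
    (x := fun p => weight ν p.1 p.2) (y := fun p => japWeight p.1 p.2)
    (fun p => weight_pos h3 _ _) (fun p => japWeight_pos _ _) (A := 1 + ν)
    (B := 2 * (1 + ν⁻¹)) (by positivity) (by positivity)
    (fun p => weight_le_japWeight _ _) (fun p => japWeight_le_weight _ _) s
  exact ⟨C, hC, fun ζ k => h (ζ, k)⟩

theorem exists_japWeight_rpow_le (ν : ℝ) [Fact (0 < ν)] (s : ℝ) : ∃ C : ℝ, 0 < C ∧ ∀ (ζ : ℤ × ℤ) (k : ℕ+),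
    japWeight ζ k ^ s ≤ C * weight ν ζ k ^ s := by
  have h3 : 0 < ν := Fact.out
  obtain ⟨C, hC, h⟩ := exists_rpow_comparison (ι := (ℤ × ℤ) × ℕ+)
    (x := fun p => japWeight p.1 p.2) (y := fun p => weight ν p.1 p.2)
    (fun p => japWeight_pos _ _) (fun p => weight_pos h3 _ _) (A := 2 * (1 + ν⁻¹))
    (B := 1 + ν) (by positivity) (by positivity)
    (fun p => japWeight_le_weight _ _) (fun p => weight_le_japWeight _ _) s
  exact ⟨C, hC, fun ζ k => h (ζ, k)⟩

theorem one_le_weight (ζ : ℤ × ℤ) (k : ℕ+) : 1 ≤ weight ν ζ k := by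
  have h2 := zsq_nonneg ζ
  have h3 := hν.out
  unfold weight
  nlinarith [mul_nonneg h3.le (sq_nonneg (k : ℝ)), mul_nonneg h3.le h2]

theorem weighted_nonneg (s : ℝ) (ζ : ℤ × ℤ) (f : ℕ+ → ℂ) (k : ℕ+) :
    0 ≤ weight ν ζ k ^ s * ‖f k‖ ^ 2 :=
  mul_nonneg (Real.rpow_nonneg (weight_pos hν.out ζ k).le s) (sq_nonneg _)

theorem sobNorm_sq (s : ℝ) (ζ : ℤ × ℤ) (f : ℕ+ → ℂ) :
    sobNorm ν s ζ f ^ 2 = ∑' k : ℕ+, weight ν ζ k ^ s * ‖f k‖ ^ 2 :=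
  Real.sq_sqrt (tsum_nonneg fun k => weighted_nonneg s ζ f k)

theorem mem_sob_iff {s : ℝ} {ζ : ℤ × ℤ} {f : ℕ+ → ℂ} :
    f ∈ sobSubmodule ν s ζ ↔ Summable fun k : ℕ+ => weight ν ζ k ^ s * ‖f k‖ ^ 2 := Iff.rfl

theorem mem_sob_of_le {s C : ℝ} {ζ : ℤ × ℤ} {f : ℕ+ → ℂ} {b : ℕ+ → ℝ} (hb : Summable b)
    (h : ∀ k, weight ν ζ k ^ s * ‖f k‖ ^ 2 ≤ C * b k) : f ∈ sobSubmodule ν s ζ :=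
  mem_sob_iff.2 (Summable.of_nonneg_of_le (weighted_nonneg s ζ f) h (hb.mul_left C))

theorem sobNorm_le_of_le {s C : ℝ} {ζ : ℤ × ℤ} {f : ℕ+ → ℂ} {b : ℕ+ → ℝ} (hC : 0 ≤ C)
    (hb : Summable b) (h : ∀ k, weight ν ζ k ^ s * ‖f k‖ ^ 2 ≤ C ^ 2 * b k) :
    sobNorm ν s ζ f ≤ C * Real.sqrt (∑' k, b k) := by
  have h1 : ∑' k : ℕ+, weight ν ζ k ^ s * ‖f k‖ ^ 2 ≤ C ^ 2 * ∑' k, b k := by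
    rw [← tsum_mul_left]
    exact Summable.tsum_le_tsum h (mem_sob_of_le hb h) (hb.mul_left _)
  calc sobNorm ν s ζ f ≤ Real.sqrt (C ^ 2 * ∑' k, b k) := Real.sqrt_le_sqrt h1
    _ = C * Real.sqrt (∑' k, b k) := by
      rw [Real.sqrt_mul (sq_nonneg C), Real.sqrt_sq hC]

theorem sobNorm_le_mul_sobNorm {s t C : ℝ} {ζ : ℤ × ℤ} {f g : ℕ+ → ℂ} (hC : 0 ≤ C)
    (hg : g ∈ sobSubmodule ν t ζ)
    (h : ∀ k, weight ν ζ k ^ s * ‖f k‖ ^ 2 ≤ C ^ 2 * (weight ν ζ k ^ t * ‖g k‖ ^ 2)) :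
    sobNorm ν s ζ f ≤ C * sobNorm ν t ζ g := sobNorm_le_of_le hC hg h

theorem weighted_mono {s t : ℝ} (hst : s ≤ t) (ζ : ℤ × ℤ) (f : ℕ+ → ℂ) (k : ℕ+) :
    weight ν ζ k ^ s * ‖f k‖ ^ 2 ≤ weight ν ζ k ^ t * ‖f k‖ ^ 2 :=
  mul_le_mul_of_nonneg_right (Real.rpow_le_rpow_of_exponent_le (one_le_weight ζ k) hst) (sq_nonneg _)

theorem mem_sob_mono {s t : ℝ} (hst : s ≤ t) {ζ : ℤ × ℤ} {f : ℕ+ → ℂ}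
    (hf : f ∈ sobSubmodule ν t ζ) : f ∈ sobSubmodule ν s ζ :=
  mem_sob_of_le (C := 1) hf fun k => by rw [one_mul]; exact weighted_mono hst ζ f k

theorem rpow_mul_sq_eq {x s y : ℝ} (hx : 0 < x) : x ^ s * y ^ 2 = (x ^ (s / 2) * y) ^ 2 := by
  rw [mul_pow, ← Real.rpow_natCast (x ^ (s / 2)), ← Real.rpow_mul hx.le]
  norm_num

/-- The power `k^{-p}` bounds the inverse power of the weight. -/
theorem exists_weight_rpow_neg_le (ν : ℝ) [Fact (0 < ν)] {p : ℝ} (hp : 0 ≤ p) : ∃ C : ℝ, 0 < C ∧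
    ∀ (ζ : ℤ × ℤ) (k : ℕ+), weight ν ζ k ^ (-p) ≤ C * (k : ℝ) ^ (-(2 * p)) := by
  obtain ⟨C, hC, h⟩ := exists_weight_rpow_le ν (-p)
  refine ⟨C, hC, fun ζ k => (h ζ k).trans ?_⟩
  have hk := pnat_cast_pos k
  have : (k : ℝ) ^ (-(2 * p)) = ((k : ℝ) ^ 2) ^ (-p) := by
    rw [← Real.rpow_natCast, ← Real.rpow_mul hk.le]; norm_num
  rw [this]
  refine mul_le_mul_of_nonneg_left ?_ hC.le
  refine Real.rpow_le_rpow_of_nonpos (by positivity) ?_ (by linarith)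
  unfold japWeight; nlinarith [sq_nonneg (japZ ζ)]

/-- `H^s ⊂ ℓ¹` for `s > 1/2`. -/
theorem exists_l1_le (ν : ℝ) [Fact (0 < ν)] {s : ℝ} (hs : 1 / 2 < s) : ∃ C : ℝ, 0 < C ∧
    ∀ (ζ : ℤ × ℤ) (f : ℕ+ → ℂ), f ∈ sobSubmodule ν s ζ →
      (Summable fun k => ‖f k‖) ∧ ∑' k, ‖f k‖ ≤ C * sobNorm ν s ζ f := by
  have h3 : 0 < ν := Fact.out
  obtain ⟨C, hC, h⟩ := exists_weight_rpow_neg_le ν (p := s) (by linarith)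
  have hS : Summable fun k : ℕ+ => C * (k : ℝ) ^ (-(2 * s)) :=
    (summable_pnat_rpow_neg (by linarith)).mul_left C
  -- The `+ 1` only makes the constant visibly positive; the same device recurs below.
  refine ⟨Real.sqrt (∑' k : ℕ+, C * (k : ℝ) ^ (-(2 * s))) + 1, by positivity, fun ζ f hf => ?_⟩
  have hw : ∀ k, (weight ν ζ k ^ (-s / 2)) ^ 2 = weight ν ζ k ^ (-s) := fun k => by
    rw [← Real.rpow_natCast, ← Real.rpow_mul (weight_pos h3 ζ k).le]; norm_num
  have hS1 : Summable fun k => weight ν ζ k ^ (-s) :=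
    Summable.of_nonneg_of_le (fun k => Real.rpow_nonneg (weight_pos h3 ζ k).le _) (h ζ) hS
  -- Cauchy-Schwarz after splitting `‖f k‖` as `w^{-s/2}` times `w^{s/2}‖f k‖`. The first factor is
  -- square summable, uniformly in `ζ`, because `w^{-s} ≤ C k^{-2s}` and `2s > 1`.
  have hcs := tsum_mul_le_sqrt_mul_sqrt (f := fun k => weight ν ζ k ^ (-s / 2))
    (g := fun k => weight ν ζ k ^ (s / 2) * ‖f k‖)
    (fun k => Real.rpow_nonneg (weight_pos h3 ζ k).le _)
    (fun k => mul_nonneg (Real.rpow_nonneg (weight_pos h3 ζ k).le _) (norm_nonneg _))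
    (by simpa only [hw] using hS1)
    (by simpa only [← rpow_mul_sq_eq (weight_pos h3 ζ _)] using mem_sob_iff.1 hf)
  have he : ∀ k, weight ν ζ k ^ (-s / 2) * (weight ν ζ k ^ (s / 2) * ‖f k‖) = ‖f k‖ := fun k => by
    rw [← mul_assoc, ← Real.rpow_add (weight_pos h3 ζ k)]
    ring_nf; simp
  simp only [he, hw, ← rpow_mul_sq_eq (weight_pos h3 ζ _)] at hcs
  refine ⟨hcs.1, hcs.2.trans ?_⟩
  refine mul_le_mul_of_nonneg_right ?_ (sobNorm_nonneg s ζ f)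
  have := Real.sqrt_le_sqrt (Summable.tsum_le_tsum (h ζ) hS1 hS)
  linarith

namespace HSob

variable {s t : ℝ} {ζ : ℤ × ℤ}

/-- The element of `H^s_ζ` with given coefficients. -/
def ofCoeff (f : ℕ+ → ℂ) (hf : f ∈ sobSubmodule ν s ζ) : HSob ν s ζ :=
  (⟨f, hf⟩ : ↥(sobSubmodule ν s ζ))

@[simp] theorem coeff_ofCoeff (f : ℕ+ → ℂ) (hf : f ∈ sobSubmodule ν s ζ) :
    (ofCoeff f hf).coeff = f := rfl

theorem coeff_mem (f : HSob ν s ζ) : f.coeff ∈ sobSubmodule ν s ζ := f.2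

theorem ext_coeff {f g : HSob ν s ζ} (h : f.coeff = g.coeff) : f = g := Subtype.ext h

@[simp] theorem coeff_zero : (0 : HSob ν s ζ).coeff = 0 := rfl
@[simp] theorem coeff_add (f g : HSob ν s ζ) : (f + g).coeff = f.coeff + g.coeff := rfl
@[simp] theorem coeff_sub (f g : HSob ν s ζ) : (f - g).coeff = f.coeff - g.coeff := rfl
@[simp] theorem coeff_neg (f : HSob ν s ζ) : (-f).coeff = -f.coeff := rfl
@[simp] theorem coeff_smul (c : ℂ) (f : HSob ν s ζ) : (c • f).coeff = c • f.coeff := rfl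

/-- Identifies `H^s_ζ` isometrically with `ℓ²`, hence completeness, which the Fredholm alternative
needs. -/
theorem toLp_surjective : Function.Surjective (toLp : HSob ν s ζ → lp (fun _ : ℕ+ => ℂ) 2) := by
  intro x
  have hw : ∀ k, ((weight ν ζ k ^ (s / 2) : ℝ) : ℂ) ≠ 0 := fun k =>
    Complex.ofReal_ne_zero.2 (Real.rpow_pos_of_pos (weight_pos hν.out ζ k) _).ne'
  have he : (fun k => ((weight ν ζ k ^ (s / 2) : ℝ) : ℂ) *
      (((weight ν ζ k ^ (s / 2) : ℝ) : ℂ)⁻¹ * x.1 k)) = x.1 := by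
    funext k; rw [mul_inv_cancel_left₀ (hw k)]
  refine ⟨ofCoeff (fun k => (((weight ν ζ k ^ (s / 2) : ℝ) : ℂ))⁻¹ * x.1 k) ?_, Subtype.ext he⟩
  refine (memℓp_weighted_iff hν.out s ζ _).1 ?_
  rw [he]
  exact x.2

instance : CompleteSpace (HSob ν s ζ) := by
  have hi : Isometry (toLp : HSob ν s ζ → lp (fun _ : ℕ+ => ℂ) 2) :=
    AddMonoidHomClass.isometry_of_norm toLp fun f => rfl
  exact (IsometryEquiv.mk (Equiv.ofBijective _ ⟨toLp_injective, toLp_surjective⟩) hi).completeSpace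

theorem norm_coeff_le (f : HSob ν s ζ) (k : ℕ+) : weight ν ζ k ^ s * ‖f.coeff k‖ ^ 2 ≤ ‖f‖ ^ 2 := by
  rw [norm_eq, sobNorm_sq]
  exact f.summable.le_tsum k fun j _ => weighted_nonneg s ζ _ j

end HSob

end PrimEq

end

noncomputable section

namespace PrimEq

/-! ### Sine series with summable coefficients -/

theorem continuous_sineFun (a : ℝ) (k : ℕ+) : Continuous (sineFun a k) := by
  unfold sineFun; fun_prop

theorem abs_sineFun_le (a : ℝ) (k : ℕ+) (z : ℝ) : |sineFun a k z| ≤ Real.sqrt (2 / a) := by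
  unfold sineFun
  rw [abs_mul, abs_of_nonneg (Real.sqrt_nonneg _)]
  exact mul_le_of_le_one_right (Real.sqrt_nonneg _) (Real.abs_sin_le_one _)

theorem norm_mul_sineFun_le (a : ℝ) (k : ℕ+) (z : ℝ) (c : ℂ) :
    ‖c * (sineFun a k z : ℂ)‖ ≤ ‖c‖ * Real.sqrt (2 / a) := by
  rw [norm_mul, Complex.norm_real, Real.norm_eq_abs]
  exact mul_le_mul_of_nonneg_left (abs_sineFun_le a k z) (norm_nonneg _)

variable {f g : ℕ+ → ℂ}

theorem summable_mul_sineFun (a : ℝ) (hf : Summable fun k => ‖f k‖) (z : ℝ) :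
    Summable fun k => f k * (sineFun a k z : ℂ) :=
  Summable.of_norm_bounded (hf.mul_right _) fun k => norm_mul_sineFun_le a k z (f k)

theorem continuous_toFunction (a : ℝ) (hf : Summable fun k => ‖f k‖) :
    Continuous (toFunction a f) :=
  continuous_tsum (fun k => continuous_const.mul
    (Complex.continuous_ofReal.comp (continuous_sineFun a k))) (hf.mul_right _)
    fun k z => norm_mul_sineFun_le a k z (f k)

theorem norm_toFunction_le (a : ℝ) (hf : Summable fun k => ‖f k‖) (z : ℝ) :
    ‖toFunction a f z‖ ≤ Real.sqrt (2 / a) * ∑' k, ‖f k‖ := by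
  rw [mul_comm, ← tsum_mul_right]
  exact tsum_of_norm_bounded (hf.mul_right _).hasSum fun k => norm_mul_sineFun_le a k z (f k)

theorem toFunction_add (a : ℝ) (hf : Summable fun k => ‖f k‖) (hg : Summable fun k => ‖g k‖)
    (z : ℝ) : toFunction a (f + g) z = toFunction a f z + toFunction a g z := by
  unfold toFunction
  rw [← (summable_mul_sineFun a hf z).tsum_add (summable_mul_sineFun a hg z)]
  simp only [Pi.add_apply, add_mul]

theorem toFunction_smul (a : ℝ) (c : ℂ) (f : ℕ+ → ℂ) (z : ℝ) :
    toFunction a (c • f) z = c * toFunction a f z := by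
  unfold toFunction
  rw [← tsum_mul_left]
  simp only [Pi.smul_apply, smul_eq_mul, mul_assoc]

@[simp] theorem toFunction_zero (a : ℝ) (z : ℝ) : toFunction a 0 z = 0 := by
  simp [toFunction]

theorem conj_toFunction (a : ℝ) (f : ℕ+ → ℂ) (z : ℝ) :
    conj (toFunction a f z) = toFunction a (fun k => conj (f k)) z := by
  unfold toFunction
  rw [Complex.conj_tsum]
  simp

/-- Dominated convergence. Only one factor is expanded in a sine series, so neither orthogonality
nor completeness of the `e_k` enters; every pairing with a test function goes through this identity.
-/
theorem hasSum_mul_sineCoeff (a : ℝ) {G : ℝ → ℂ} (hG : Continuous G)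
    (hf : Summable fun k => ‖f k‖) :
    HasSum (fun k => sineCoeff a G k * f k) (∫ z in (0 : ℝ)..a, G z * toFunction a f z) := by
  have h := intervalIntegral.hasSum_integral_of_dominated_convergence
    (μ := MeasureTheory.volume) (a := 0) (b := a)
    (F := fun (k : ℕ+) z => G z * (f k * (sineFun a k z : ℂ)))
    (f := fun z => G z * toFunction a f z)
    (fun k z => ‖G z‖ * (‖f k‖ * Real.sqrt (2 / a)))
    (fun k => by
      have := continuous_sineFun a k
      exact (by fun_prop : Continuous fun z => G z * (f k * (sineFun a k z : ℂ))).aestronglyMeasurable)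
    (fun k => Filter.Eventually.of_forall fun z _ => by
      rw [norm_mul]
      exact mul_le_mul_of_nonneg_left (norm_mul_sineFun_le a k z (f k)) (norm_nonneg _))
    (Filter.Eventually.of_forall fun z _ => (hf.mul_right _).mul_left _)
    (by
      simp only [tsum_mul_left]
      exact (hG.norm.mul continuous_const).intervalIntegrable _ _)
    (Filter.Eventually.of_forall fun z _ => (summable_mul_sineFun a hf z).hasSum.mul_left _)
  have he : (fun k => sineCoeff a G k * f k)
      = fun k => ∫ z in (0 : ℝ)..a, G z * (f k * (sineFun a k z : ℂ)) := by
    funext k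
    unfold sineCoeff
    rw [← intervalIntegral.integral_mul_const]
    congr 1
    ext z
    ring
  rw [he]
  exact h

theorem sineCoeff_const_mul (a : ℝ) (c : ℂ) (G : ℝ → ℂ) (k : ℕ+) :
    sineCoeff a (fun z => c * G z) k = c * sineCoeff a G k := by
  unfold sineCoeff
  rw [← intervalIntegral.integral_const_mul]
  simp only [mul_assoc]

theorem sineCoeff_add (a : ℝ) {G H : ℝ → ℂ} (hG : Continuous G) (hH : Continuous H) (k : ℕ+) :
    sineCoeff a (fun z => G z + H z) k = sineCoeff a G k + sineCoeff a H k := by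
  have := continuous_sineFun a k
  unfold sineCoeff
  rw [← intervalIntegral.integral_add]
  · simp only [add_mul]
  · exact (by fun_prop : Continuous fun z => G z * (sineFun a k z : ℂ)).intervalIntegrable _ _
  · exact (by fun_prop : Continuous fun z => H z * (sineFun a k z : ℂ)).intervalIntegrable _ _

/-- The coefficient `∫_0^a e_k dz`. -/
def sineMean (a : ℝ) (k : ℕ+) : ℂ := sineCoeff a (fun _ => 1) k

theorem sineCoeff_const (a : ℝ) (c : ℂ) : sineCoeff a (fun _ => c) = c • sineMean a := by
  funext k
  have := sineCoeff_const_mul a c (fun _ => 1) k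
  simpa [sineMean] using this

theorem hasSum_sineMean_mul (a : ℝ) (hf : Summable fun k => ‖f k‖) :
    HasSum (fun k => sineMean a k * f k) (∫ z in (0 : ℝ)..a, toFunction a f z) := by
  simpa [sineMean] using hasSum_mul_sineCoeff a (G := fun _ => 1) continuous_const hf

/-- An antiderivative of `e_k`. -/
def sineAnti (a : ℝ) (k : ℕ+) (z : ℝ) : ℝ :=
  -(Real.sqrt (2 / a) * (a / ((k : ℝ) * Real.pi)) * Real.cos ((k : ℝ) * Real.pi * z / a))

theorem hasDerivAt_sineAnti {a : ℝ} (ha : 0 < a) (k : ℕ+) (z : ℝ) :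
    HasDerivAt (sineAnti a k) (sineFun a k z) z := by
  have hk := pnat_cast_pos k
  have h1 : HasDerivAt (fun z : ℝ => (k : ℝ) * Real.pi * z / a) ((k : ℝ) * Real.pi / a) z := by
    simpa using ((hasDerivAt_id z).const_mul ((k : ℝ) * Real.pi)).div_const a
  have h2 := ((h1.cos).const_mul (Real.sqrt (2 / a) * (a / ((k : ℝ) * Real.pi)))).neg
  unfold sineAnti
  refine h2.congr_deriv ?_
  unfold sineFun
  have := Real.pi_pos
  field_simp

theorem abs_sineAnti_le {a : ℝ} (ha : 0 < a) (k : ℕ+) (z : ℝ) :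
    |sineAnti a k z| ≤ Real.sqrt (2 / a) * a * (k : ℝ)⁻¹ := by
  have hk := pnat_cast_pos k
  have hpi : (1 : ℝ) ≤ Real.pi := by linarith [Real.pi_gt_three]
  unfold sineAnti
  rw [abs_neg, abs_mul, abs_of_nonneg (by positivity : 0 ≤ Real.sqrt (2 / a) * (a / ((k : ℝ) * Real.pi)))]
  calc _ ≤ Real.sqrt (2 / a) * (a / ((k : ℝ) * Real.pi)) * 1 :=
        mul_le_mul_of_nonneg_left (Real.abs_cos_le_one _) (by positivity)
    _ = Real.sqrt (2 / a) * (a / ((k : ℝ) * Real.pi)) := mul_one _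
    _ ≤ Real.sqrt (2 / a) * (a / (k : ℝ)) := by
        gcongr
        nlinarith
    _ = _ := by rw [div_eq_mul_inv a, mul_assoc]

theorem continuous_sineAnti (a : ℝ) (k : ℕ+) : Continuous (sineAnti a k) := by
  unfold sineAnti; fun_prop

/-- If `G' = φ`, `G(0) = 0` and `|φ| ≤ M`, the sine coefficients of `G` are `O(M/k)`. -/
theorem norm_sineCoeff_le_of_deriv {a : ℝ} (ha : 0 < a) {G φ : ℝ → ℂ} {M : ℝ}
    (hG : ∀ z, HasDerivAt G (φ z) z) (hφ : Continuous φ) (hG0 : ‖G 0‖ ≤ M)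
    (hM : ∀ z, ‖φ z‖ ≤ M) (k : ℕ+) :
    ‖sineCoeff a G k‖ ≤ Real.sqrt (2 / a) * a * (2 + 2 * a) * M * (k : ℝ)⁻¹ := by
  set A := Real.sqrt (2 / a) * a * (k : ℝ)⁻¹ with hA
  have hA0 : 0 ≤ A := by have := pnat_cast_pos k; positivity
  have hM0 : 0 ≤ M := (norm_nonneg _).trans (hM 0)
  have hv : ∀ z, ‖((sineAnti a k z : ℝ) : ℂ)‖ ≤ A := fun z => by
    rw [Complex.norm_real]; exact abs_sineAnti_le ha k z
  have hs := continuous_sineFun a k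
  have hsa := continuous_sineAnti a k
  -- Integration by parts against the antiderivative of `e_k`, which is `O(1/k)`. `G` need not
  -- vanish at the endpoints, so the boundary terms survive and the rate is only `1/k`.
  have hibp := intervalIntegral.integral_mul_deriv_eq_deriv_mul (a := 0) (b := a)
    (u := G) (u' := φ) (v := fun z => ((sineAnti a k z : ℝ) : ℂ))
    (v' := fun z => ((sineFun a k z : ℝ) : ℂ)) (fun z _ => hG z)
    (fun z _ => (hasDerivAt_sineAnti ha k z).ofReal_comp)
    (hφ.intervalIntegrable _ _)
    ((Complex.continuous_ofReal.comp hs).intervalIntegrable _ _)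
  have hGa : ‖G a‖ ≤ M + M * a := by
    have h1 : ∫ z in (0 : ℝ)..a, φ z = G a - G 0 :=
      intervalIntegral.integral_eq_sub_of_hasDerivAt (fun z _ => hG z) (hφ.intervalIntegrable _ _)
    have h2 : ‖∫ z in (0 : ℝ)..a, φ z‖ ≤ M * |a - 0| :=
      intervalIntegral.norm_integral_le_of_norm_le_const fun z _ => hM z
    rw [h1, sub_zero, abs_of_pos ha] at h2
    have := norm_sub_norm_le (G a) (G 0)
    linarith
  have hi : ‖∫ z in (0 : ℝ)..a, φ z * ((sineAnti a k z : ℝ) : ℂ)‖ ≤ M * A * |a - 0| := by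
    refine intervalIntegral.norm_integral_le_of_norm_le_const fun z _ => ?_
    rw [norm_mul]
    exact mul_le_mul (hM z) (hv z) (norm_nonneg _) hM0
  rw [sub_zero, abs_of_pos ha] at hi
  unfold sineCoeff
  rw [hibp]
  calc _ ≤ ‖G a * ((sineAnti a k a : ℝ) : ℂ)‖ + ‖G 0 * ((sineAnti a k 0 : ℝ) : ℂ)‖
        + ‖∫ z in (0 : ℝ)..a, φ z * ((sineAnti a k z : ℝ) : ℂ)‖ :=
        (norm_sub_le _ _).trans (add_le_add_left (norm_sub_le _ _) _)
    _ ≤ (M + M * a) * A + M * A + M * A * a := by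
        rw [norm_mul, norm_mul]
        gcongr
        · exact hv a
        · exact hv 0
    _ = _ := by rw [hA]; ring

theorem norm_sineMean_le {a : ℝ} (ha : 0 < a) (k : ℕ+) :
    ‖sineMean a k‖ ≤ Real.sqrt (2 / a) * a * (2 + 2 * a) * 1 * (k : ℝ)⁻¹ :=
  norm_sineCoeff_le_of_deriv ha (fun z => hasDerivAt_const z 1) continuous_const (by simp)
    (by simp) k

/-- Between `z = 0` and `z = a` the cosine runs from `1` to `-1`. This non-vanishing bounds the
pressure determinant from below, and it forces `p₀ = 0` once velocity and temperature vanish. -/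
theorem sineMean_one_ne_zero {a : ℝ} (ha : 0 < a) : sineMean a 1 ≠ 0 := by
  have h : ∫ z in (0 : ℝ)..a, sineFun a 1 z = sineAnti a 1 a - sineAnti a 1 0 :=
    intervalIntegral.integral_eq_sub_of_hasDerivAt (fun z _ => hasDerivAt_sineAnti ha 1 z)
      ((continuous_sineFun a 1).intervalIntegrable _ _)
  have h2 : sineMean a 1 = ((∫ z in (0 : ℝ)..a, sineFun a 1 z : ℝ) : ℂ) := by
    unfold sineMean sineCoeff
    rw [← intervalIntegral.integral_ofReal]
    simp
  rw [h2, h, Complex.ofReal_ne_zero]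
  have h3 : (1 : ℝ) * Real.pi * a / a = Real.pi := by field_simp
  have : 0 < Real.sqrt (2 / a) * (a / (1 * Real.pi)) := by
    have := Real.pi_pos; positivity
  unfold sineAnti
  simp only [PNat.one_coe, Nat.cast_one, h3, Real.cos_pi, mul_zero, zero_div, Real.cos_zero]
  linarith

/-! ### Primitives -/

theorem hasDerivAt_primitive (a : ℝ) (hf : Summable fun k => ‖f k‖) (z : ℝ) :
    HasDerivAt (primitive a f) (toFunction a f z) z :=
  intervalIntegral.integral_hasDerivAt_right
    ((continuous_toFunction a hf).intervalIntegrable _ _)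
    ((continuous_toFunction a hf).stronglyMeasurableAtFilter _ _)
    (continuous_toFunction a hf).continuousAt

theorem continuous_primitive (a : ℝ) (hf : Summable fun k => ‖f k‖) :
    Continuous (primitive a f) :=
  continuous_iff_continuousAt.2 fun z => (hasDerivAt_primitive a hf z).continuousAt

@[simp] theorem primitive_at_zero (a : ℝ) (f : ℕ+ → ℂ) : primitive a f 0 = 0 := by
  simp [primitive]

theorem primitive_add (a : ℝ) (hf : Summable fun k => ‖f k‖) (hg : Summable fun k => ‖g k‖)
    (z : ℝ) : primitive a (f + g) z = primitive a f z + primitive a g z := by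
  unfold primitive
  rw [← intervalIntegral.integral_add ((continuous_toFunction a hf).intervalIntegrable _ _)
    ((continuous_toFunction a hg).intervalIntegrable _ _)]
  simp only [toFunction_add a hf hg]

theorem primitive_smul (a : ℝ) (c : ℂ) (f : ℕ+ → ℂ) (z : ℝ) :
    primitive a (c • f) z = c * primitive a f z := by
  unfold primitive
  rw [← intervalIntegral.integral_const_mul]
  simp only [toFunction_smul]

/-- The sine coefficients of the primitive of a sine series. -/
def primCoeff (a : ℝ) (f : ℕ+ → ℂ) (k : ℕ+) : ℂ := sineCoeff a (primitive a f) k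

theorem primCoeff_add (a : ℝ) (hf : Summable fun k => ‖f k‖) (hg : Summable fun k => ‖g k‖) :
    primCoeff a (f + g) = primCoeff a f + primCoeff a g := by
  funext k
  have h : primitive a (f + g) = fun z => primitive a f z + primitive a g z :=
    funext (primitive_add a hf hg)
  unfold primCoeff
  rw [h, sineCoeff_add a (continuous_primitive a hf) (continuous_primitive a hg)]
  rfl

theorem primCoeff_smul (a : ℝ) (c : ℂ) (f : ℕ+ → ℂ) : primCoeff a (c • f) = c • primCoeff a f := by
  funext k
  have h : primitive a (c • f) = fun z => c * primitive a f z := funext (primitive_smul a c f)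
  unfold primCoeff
  rw [h, sineCoeff_const_mul]
  rfl

/-- The constant in the bounds `O(1/k)` of the sine coefficients. -/
def decayConst (a : ℝ) : ℝ :=
  Real.sqrt (2 / a) * a * (2 + 2 * a) * (1 + Real.sqrt (2 / a))

theorem decayConst_pos {a : ℝ} (ha : 0 < a) : 0 < decayConst a := by
  unfold decayConst; positivity

theorem norm_sineMean_le_decayConst {a : ℝ} (ha : 0 < a) (k : ℕ+) :
    ‖sineMean a k‖ ≤ decayConst a * (k : ℝ)⁻¹ := by
  refine (norm_sineMean_le ha k).trans ?_
  have := pnat_cast_pos k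
  unfold decayConst
  gcongr
  linarith [Real.sqrt_nonneg (2 / a)]

/-- The primitive starts at `0` and has derivative bounded by `√(2/a) ∑ ‖f k‖`. Its value at `a` is
arbitrary, whence the rate `1/k` and the condition `s < 1/2` on the target spaces below. The factor
`1 + √(2/a)` in `decayConst` lets one constant serve primitives and the constant function alike. -/
theorem norm_primCoeff_le {a : ℝ} (ha : 0 < a) (hf : Summable fun k => ‖f k‖) (k : ℕ+) :
    ‖primCoeff a f k‖ ≤ decayConst a * (∑' k, ‖f k‖) * (k : ℝ)⁻¹ := by
  have h0 : 0 ≤ ∑' k, ‖f k‖ := tsum_nonneg fun k => norm_nonneg _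
  refine (norm_sineCoeff_le_of_deriv ha (hasDerivAt_primitive a hf) (continuous_toFunction a hf)
    (M := Real.sqrt (2 / a) * ∑' k, ‖f k‖) (by simpa using by positivity)
    (norm_toFunction_le a hf) k).trans ?_
  have := pnat_cast_pos k
  unfold decayConst
  have e : Real.sqrt (2 / a) * a * (2 + 2 * a) * (1 + Real.sqrt (2 / a)) * (∑' k, ‖f k‖) * (k : ℝ)⁻¹
    = Real.sqrt (2 / a) * a * (2 + 2 * a) * ((1 + Real.sqrt (2 / a)) * (∑' k, ‖f k‖)) * (k : ℝ)⁻¹ := by ring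
  rw [e]
  gcongr
  linarith

theorem vertVel_eq (a : ℝ) (ζ : ℤ × ℤ) (hf : Summable fun k => ‖f k‖)
    (hg : Summable fun k => ‖g k‖) (z : ℝ) :
    vertVel a ζ f g z = -(Complex.I * (ζ.1 : ℂ) * primitive a f z
      + Complex.I * (ζ.2 : ℂ) * primitive a g z) := by
  unfold vertVel primitive
  rw [intervalIntegral.integral_add, intervalIntegral.integral_const_mul,
    intervalIntegral.integral_const_mul]
  · exact (continuous_const.mul (continuous_toFunction a hf)).intervalIntegrable _ _
  · exact (continuous_const.mul (continuous_toFunction a hg)).intervalIntegrable _ _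

theorem sineCoeff_vertVel (a : ℝ) (c : ℂ) (ζ : ℤ × ℤ) (hf : Summable fun k => ‖f k‖)
    (hg : Summable fun k => ‖g k‖) :
    sineCoeff a (fun z => c * vertVel a ζ f g z) =
      -(c * Complex.I * (ζ.1 : ℂ)) • primCoeff a f - (c * Complex.I * (ζ.2 : ℂ)) • primCoeff a g := by
  funext k
  have h : (fun z => c * vertVel a ζ f g z) = fun z => -(c * Complex.I * (ζ.1 : ℂ)) * primitive a f z
      + -(c * Complex.I * (ζ.2 : ℂ)) * primitive a g z := by
    funext z; rw [vertVel_eq a ζ hf hg]; ring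
  rw [h, sineCoeff_add a (G := fun z => -(c * Complex.I * (ζ.1 : ℂ)) * primitive a f z)
    (H := fun z => -(c * Complex.I * (ζ.2 : ℂ)) * primitive a g z)
    (continuous_const.mul (continuous_primitive a hf))
    (continuous_const.mul (continuous_primitive a hg)), sineCoeff_const_mul, sineCoeff_const_mul]
  simp [primCoeff, sub_eq_add_neg]

/-- The condition `∫_0^a (ξ u + η v) dz = 0` in terms of the coefficients. -/
theorem integral_div_eq (a : ℝ) (c d : ℂ) (hf : Summable fun k => ‖f k‖)
    (hg : Summable fun k => ‖g k‖) :
    ∫ z in (0 : ℝ)..a, (c * toFunction a f z + d * toFunction a g z)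
      = ∑' k, sineMean a k * (c * f k + d * g k) := by
  have h := hasSum_sineMean_mul a (f := c • f + d • g) (by
    refine Summable.of_nonneg_of_le (fun _ => norm_nonneg _) (fun k => norm_add_le _ _) ?_
    simp only [Pi.smul_apply, norm_smul]
    exact (hf.mul_left _).add (hg.mul_left _))
  have he : toFunction a (c • f + d • g) = fun z => c * toFunction a f z + d * toFunction a g z := by
    funext z
    rw [toFunction_add, toFunction_smul, toFunction_smul]
    · simp only [Pi.smul_apply, norm_smul]; exact hf.mul_left _
    · simp only [Pi.smul_apply, norm_smul]; exact hg.mul_left _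
  rw [he] at h
  exact h.tsum_eq.symm

/-- Integration by parts: `∫ (∫_0^z f) H' = -∫ f H` if `H(0) = H(a) = 0`. -/
theorem integral_primitive_mul (a : ℝ) (hf : Summable fun k => ‖f k‖)
    (hg : Summable fun k => ‖g k‖) (hg0 : primitive a g a = 0) :
    ∫ z in (0 : ℝ)..a, primitive a f z * toFunction a g z
      = -∫ z in (0 : ℝ)..a, toFunction a f z * primitive a g z := by
  rw [intervalIntegral.integral_mul_deriv_eq_deriv_mul (fun z _ => hasDerivAt_primitive a hf z)
    (fun z _ => hasDerivAt_primitive a hg z) ((continuous_toFunction a hf).intervalIntegrable _ _)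
    ((continuous_toFunction a hg).intervalIntegrable _ _), hg0]
  simp

end PrimEq

end

/-! ### Fredholm alternative, compact inclusions, primitive and mean as bounded operators. -/

noncomputable section

namespace PrimEq

open Filter Topology

/-- The Fredholm alternative for `1 + K`, in the injective case. -/
theorem exists_bound_and_surjective_one_add {E : Type*} [NormedAddCommGroup E] [NormedSpace ℂ E]
    [CompleteSpace E] {K : E →L[ℂ] E} (hK : IsCompactOperator K) (hinj : ∀ x, x + K x = 0 → x = 0) :
    (∀ y, ∃ x, x + K x = y) ∧ ∃ C : ℝ, 0 < C ∧ ∀ x, ‖x‖ ≤ C * ‖x + K x‖ := by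
  have hne : (-1 : ℂ) ≠ 0 := by norm_num
  have hev : ¬ Module.End.HasEigenvalue (K : Module.End ℂ E) (-1) := by
    intro h
    obtain ⟨x, hx⟩ := h.exists_hasEigenvector
    refine hx.2 (hinj x ?_)
    have h1 : K x = (-1 : ℂ) • x := hx.apply_eq_smul
    rw [h1]; simp
  constructor
  · have hr := (hK.hasEigenvalue_or_mem_resolventSet hne).resolve_left hev
    rw [spectrum.mem_resolventSet_iff] at hr
    obtain ⟨T, hT⟩ := hr
    intro y
    -- The invertible element is `-1 - K`, which accounts for the minus sign.
    refine ⟨-((↑T⁻¹ : E →L[ℂ] E) y), ?_⟩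
    have h2 : (T : E →L[ℂ] E) ((↑T⁻¹ : E →L[ℂ] E) y) = y := by
      rw [← mul_apply_eq_comp, Units.mul_inv]; rfl
    rw [hT] at h2
    have h3 : ∀ x, (algebraMap ℂ (E →L[ℂ] E) (-1) - K) x = -x - K x := fun x => by
      rw [Algebra.algebraMap_eq_smul_one]; simp
    rw [h3] at h2
    rw [map_neg, ← sub_eq_add_neg]
    exact h2
  · obtain ⟨C, hC⟩ := hK.antilipschitz_of_not_hasEigenvalue hne hev
    refine ⟨C + 1, by positivity, fun x => ?_⟩
    have h := hC.le_mul_dist x 0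
    rw [dist_zero_right, map_zero, dist_zero_right] at h
    have h3 : (K - (-1 : ℂ) • (1 : E →L[ℂ] E)) x = x + K x := by simp [add_comm]
    rw [h3] at h
    nlinarith [norm_nonneg (x + K x)]

variable {ν : ℝ} [hν : Fact (0 < ν)]

namespace HSob

variable {s t : ℝ} {ζ : ℤ × ℤ}

/-- The inclusion `H^t_ζ → H^s_ζ` for `s ≤ t`, as a function. -/
def inclFun (hst : s ≤ t) (f : HSob ν t ζ) : HSob ν s ζ :=
  ofCoeff f.coeff (mem_sob_mono hst f.coeff_mem)

theorem coeff_inclFun (hst : s ≤ t) (f : HSob ν t ζ) : (inclFun hst f).coeff = f.coeff :=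
  coeff_ofCoeff _ _

theorem inclFun_add (hst : s ≤ t) (f g : HSob ν t ζ) :
    inclFun hst (f + g) = inclFun hst f + inclFun hst g := by
  apply ext_coeff
  rw [coeff_add, coeff_inclFun, coeff_inclFun, coeff_inclFun, coeff_add]

theorem inclFun_smul (hst : s ≤ t) (c : ℂ) (f : HSob ν t ζ) :
    inclFun hst (c • f) = c • inclFun hst f := by
  apply ext_coeff
  rw [coeff_smul, coeff_inclFun, coeff_inclFun, coeff_smul]

theorem norm_inclFun_le (hst : s ≤ t) (f : HSob ν t ζ) : ‖inclFun hst f‖ ≤ 1 * ‖f‖ := by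
    rw [norm_eq, norm_eq, coeff_inclFun]
    refine sobNorm_le_mul_sobNorm zero_le_one f.coeff_mem fun k => ?_
    rw [one_pow, one_mul]
    exact weighted_mono hst ζ _ k

/-- The inclusion `H^t_ζ → H^s_ζ` for `s ≤ t`. -/
def incl (hst : s ≤ t) : HSob ν t ζ →L[ℂ] HSob ν s ζ :=
  LinearMap.mkContinuous
    { toFun := inclFun hst
      map_add' := inclFun_add hst
      map_smul' := inclFun_smul hst } 1 (norm_inclFun_le hst)

theorem coeff_incl (hst : s ≤ t) (f : HSob ν t ζ) : (incl hst f).coeff = f.coeff :=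
  coeff_inclFun hst f

/-- The functional `f ↦ f_k`. -/
def coeffCLM (t : ℝ) (ζ : ℤ × ℤ) (k : ℕ+) : HSob ν t ζ →L[ℂ] ℂ :=
  LinearMap.mkContinuous
    { toFun := fun f => f.coeff k
      map_add' := fun _ _ => rfl
      map_smul' := fun _ _ => rfl } ((weight ν ζ k ^ (t / 2))⁻¹) fun f => by
    have hw := weight_pos hν.out ζ k
    have h := norm_coeff_le f k
    rw [rpow_mul_sq_eq hw] at h
    have h2 := abs_le_of_sq_le_sq' h (norm_nonneg _)
    rw [le_inv_mul_iff₀ (Real.rpow_pos_of_pos hw _)]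
    exact h2.2

theorem single_mem (k : ℕ+) (c : ℂ) : Pi.single k c ∈ sobSubmodule ν s ζ := by
  refine mem_sob_iff.2 (summable_of_ne_finset_zero (s := {k}) fun j hj => ?_)
  have : j ≠ k := by simpa using hj
  simp [this]

/-- The element `c e_k`. -/
def singleCLM (s : ℝ) (ζ : ℤ × ℤ) (k : ℕ+) : ℂ →L[ℂ] HSob ν s ζ :=
  LinearMap.toContinuousLinearMap
    { toFun := fun c => ofCoeff (Pi.single k c) (single_mem k c)
      map_add' := fun c d => ext_coeff (by simp [Pi.single_add])
      map_smul' := fun c d => ext_coeff (by simp [← Pi.single_smul]) }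

@[simp] theorem coeffCLM_apply (k : ℕ+) (f : HSob ν t ζ) : coeffCLM t ζ k f = f.coeff k := rfl

@[simp] theorem coeff_singleCLM (k : ℕ+) (c : ℂ) :
    (singleCLM s ζ k c : HSob ν s ζ).coeff = Pi.single k c := by
  unfold singleCLM
  rw [LinearMap.coe_toContinuousLinearMap']
  rfl

/-- The truncation of a sine series to a finite set of modes. -/
def truncCLM (s t : ℝ) (ζ : ℤ × ℤ) (A : Finset ℕ+) : HSob ν t ζ →L[ℂ] HSob ν s ζ :=
  ∑ k ∈ A, (singleCLM s ζ k).comp (coeffCLM t ζ k)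

theorem coeff_truncCLM (A : Finset ℕ+) (f : HSob ν t ζ) (j : ℕ+) :
    (truncCLM s t ζ A f).coeff j = if j ∈ A then f.coeff j else 0 := by
  have h : (truncCLM s t ζ A f).coeff j
      = ∑ k ∈ A, (Pi.single k (f.coeff k) : ℕ+ → ℂ) j := by
    rw [← coeffCLM_apply, truncCLM, sum_apply, map_sum]
    refine Finset.sum_congr rfl fun k _ => ?_
    rw [ContinuousLinearMap.comp_apply, coeffCLM_apply, coeff_singleCLM, coeffCLM_apply]
  rw [h, Finset.sum_pi_single]

theorem isCompactOperator_truncCLM (A : Finset ℕ+) :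
    IsCompactOperator (truncCLM s t ζ A : HSob ν t ζ →L[ℂ] HSob ν s ζ) := by
  classical
  unfold truncCLM
  induction A using Finset.induction_on with
  | empty => simpa using isCompactOperator_zero
  | insert k A hk ih =>
    rw [Finset.sum_insert hk]
    refine IsCompactOperator.add ?_ ih
    exact (isCompactOperator_of_locallyCompactSpace_rng (M₂ := ℂ)
      (singleCLM (ν := ν) s ζ k : ℂ →L[ℂ] HSob ν s ζ)).comp_clm (coeffCLM t ζ k)

theorem tendsto_weight_rpow_neg {p : ℝ} (hp : 0 < p) (ζ : ℤ × ℤ) :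
    Tendsto (fun k : ℕ+ => weight ν ζ k ^ (-p)) cofinite (𝓝 0) := by
  obtain ⟨C, hC, h⟩ := exists_weight_rpow_neg_le ν hp.le
  have h1 : Tendsto (fun k : ℕ+ => (k : ℝ)) cofinite atTop :=
    tendsto_natCast_atTop_atTop.comp (Nat.cofinite_eq_atTop ▸ PNat.coe_injective.tendsto_cofinite)
  have h2 : Tendsto (fun k : ℕ+ => C * (k : ℝ) ^ (-(2 * p))) cofinite (𝓝 0) := by
    simpa using ((tendsto_rpow_neg_atTop (y := 2 * p) (by linarith)).comp h1).const_mul C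
  exact squeeze_zero (fun k => Real.rpow_nonneg (weight_pos hν.out ζ k).le _) (h ζ) h2

/-- The inclusion is the norm limit of its finite rank truncations: outside a finite set of modes
`w_k^{-(t-s)}` is at most `(ε/2)²`, which bounds the operator norm of the tail by `ε/2`. -/
theorem isCompactOperator_incl (hst : s < t) :
    IsCompactOperator (incl hst.le : HSob ν t ζ →L[ℂ] HSob ν s ζ) := by
  refine isCompactOperator_of_tendsto (l := atTop) (F := truncCLM s t ζ) ?_
    (Eventually.of_forall fun A => isCompactOperator_truncCLM A)
  rw [Metric.tendsto_nhds]
  intro ε hε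
  have hev := (tendsto_weight_rpow_neg (ν := ν) (sub_pos.2 hst) ζ).eventually
    (eventually_le_nhds (show (0 : ℝ) < (ε / 2) ^ 2 by positivity))
  rw [eventually_cofinite] at hev
  filter_upwards [eventually_ge_atTop hev.toFinset] with A hA
  rw [dist_eq_norm]
  refine lt_of_le_of_lt (ContinuousLinearMap.opNorm_le_bound _ (half_pos hε).le fun f => ?_)
    (half_lt_self hε)
  rw [norm_eq, norm_eq]
  refine sobNorm_le_mul_sobNorm (half_pos hε).le f.coeff_mem fun k => ?_
  have hc : ((truncCLM s t ζ A - incl hst.le : HSob ν t ζ →L[ℂ] HSob ν s ζ) f).coeff k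
      = (if k ∈ A then f.coeff k else 0) - f.coeff k := by
    rw [← coeff_truncCLM (s := s), sub_apply, coeff_sub, coeff_incl]; rfl
  rw [hc]
  split_ifs with hk
  · simpa using mul_nonneg (sq_nonneg (ε / 2)) (weighted_nonneg t ζ f.coeff k)
  · have hk' : weight ν ζ k ^ (-(t - s)) ≤ (ε / 2) ^ 2 := by
      by_contra hcon
      exact hk (hA (by simpa using hcon))
    have he : weight ν ζ k ^ s = weight ν ζ k ^ (-(t - s)) * weight ν ζ k ^ t := by
      rw [← Real.rpow_add (weight_pos hν.out ζ k)]; ring_nf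
    rw [he, zero_sub, norm_neg, mul_assoc]
    exact mul_le_mul_of_nonneg_right hk' (weighted_nonneg t ζ f.coeff k)

end HSob

/-- `∑_k w_k^s / k² ≤ C ⟨ζ⟩^{2s}` for `s < 1/2`. -/
theorem exists_sum_weight_div_sq_le (ν : ℝ) [Fact (0 < ν)] {s : ℝ} (hs : s < 1 / 2) :
    ∃ C : ℝ, 0 < C ∧ ∀ ζ : ℤ × ℤ,
      (Summable fun k : ℕ+ => weight ν ζ k ^ s * ((k : ℝ)⁻¹) ^ 2) ∧
        Real.sqrt (∑' k : ℕ+, weight ν ζ k ^ s * ((k : ℝ)⁻¹) ^ 2) ≤ C * japZ ζ ^ s := by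
  have h3 : 0 < ν := Fact.out
  obtain ⟨C, hC, h⟩ := exists_weight_rpow_le ν s
  -- For `s ≥ 0` one uses `k² + ⟨ζ⟩² ≤ 2k²⟨ζ⟩²`, which costs `k^{2s}`; for `s ≤ 0` the term `k²` is
  -- simply dropped. In both cases `k^{q-2}` remains, summable since `q < 1`.
  set q : ℝ := 2 * max s 0 with hq
  have hq1 : q < 1 := by rw [hq]; rcases max_cases s 0 with h | h <;> linarith
  have hS : Summable fun k : ℕ+ => (k : ℝ) ^ (-(2 - q)) := summable_pnat_rpow_neg (by linarith)
  have hS0 : 0 ≤ ∑' k : ℕ+, (k : ℝ) ^ (-(2 - q)) :=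
    tsum_nonneg fun k => Real.rpow_nonneg (pnat_cast_pos k).le _
  set B : ℝ := C * 2 ^ max s 0 with hB
  have hB0 : 0 < B := by positivity
  have key : ∀ (ζ : ℤ × ℤ) (k : ℕ+), weight ν ζ k ^ s * ((k : ℝ)⁻¹) ^ 2
      ≤ (B * (japZ ζ ^ s) ^ 2) * (k : ℝ) ^ (-(2 - q)) := by
    intro ζ k
    have hk := pnat_cast_pos k
    have hk1 := one_le_pnat_cast k
    have hz := one_le_japZ ζ
    have hz0 : 0 < japZ ζ := by linarith
    have hzs : (japZ ζ ^ s) ^ 2 = (japZ ζ ^ 2) ^ s := by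
      rw [← Real.rpow_natCast, ← Real.rpow_natCast, ← Real.rpow_mul hz0.le, ← Real.rpow_mul hz0.le,
        mul_comm]
    have hks : (k : ℝ) ^ (-(2 - q)) = ((k : ℝ) ^ 2) ^ max s 0 * ((k : ℝ)⁻¹) ^ 2 := by
      rw [← Real.rpow_natCast (k : ℝ) 2, ← Real.rpow_mul hk.le, inv_pow, ← Real.rpow_natCast (k : ℝ) 2,
        ← Real.rpow_neg hk.le, ← Real.rpow_add hk]
      congr 1
      rw [hq]; push_cast; ring
    have hW : japWeight ζ k ^ s ≤ 2 ^ max s 0 * (japZ ζ ^ 2) ^ s * ((k : ℝ) ^ 2) ^ max s 0 := by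
      have hJ : japWeight ζ k = (k : ℝ) ^ 2 + japZ ζ ^ 2 := rfl
      rcases le_total 0 s with h0 | h0
      · rw [max_eq_left h0, ← Real.mul_rpow (by norm_num) (by positivity),
          ← Real.mul_rpow (by positivity) (by positivity)]
        refine Real.rpow_le_rpow (japWeight_pos ζ k).le ?_ h0
        rw [hJ]
        nlinarith [mul_nonneg (sub_nonneg.2 (one_le_pow₀ hk1 (n := 2)))
          (sub_nonneg.2 (one_le_pow₀ hz (n := 2))), one_le_pow₀ hk1 (n := 2), one_le_pow₀ hz (n := 2)]
      · rw [max_eq_right h0, Real.rpow_zero, Real.rpow_zero, one_mul, mul_one]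
        refine Real.rpow_le_rpow_of_nonpos (by positivity) ?_ h0
        rw [hJ]
        nlinarith
    rw [hks, hzs]
    calc _ ≤ C * (2 ^ max s 0 * (japZ ζ ^ 2) ^ s * ((k : ℝ) ^ 2) ^ max s 0) * ((k : ℝ)⁻¹) ^ 2 := by
          refine mul_le_mul_of_nonneg_right ((h ζ k).trans ?_) (sq_nonneg _)
          exact mul_le_mul_of_nonneg_left hW hC.le
      _ = _ := by rw [hB]; ring
  refine ⟨Real.sqrt (B * (∑' k : ℕ+, (k : ℝ) ^ (-(2 - q)))) + 1, by positivity, fun ζ => ?_⟩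
  have hsum : Summable fun k : ℕ+ => weight ν ζ k ^ s * ((k : ℝ)⁻¹) ^ 2 :=
    Summable.of_nonneg_of_le (fun k => mul_nonneg (Real.rpow_nonneg (weight_pos h3 ζ k).le _)
      (sq_nonneg _)) (key ζ) (hS.mul_left _)
  refine ⟨hsum, ?_⟩
  have hzp : 0 ≤ japZ ζ ^ s := Real.rpow_nonneg (by linarith [one_le_japZ ζ]) _
  have h1 := Summable.tsum_le_tsum (key ζ) hsum (hS.mul_left _)
  rw [tsum_mul_left] at h1
  calc _ ≤ Real.sqrt ((B * ∑' k : ℕ+, (k : ℝ) ^ (-(2 - q))) * (japZ ζ ^ s) ^ 2) := by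
        refine Real.sqrt_le_sqrt (h1.trans (le_of_eq ?_)); ring
    _ = Real.sqrt (B * ∑' k : ℕ+, (k : ℝ) ^ (-(2 - q))) * japZ ζ ^ s := by
        rw [Real.sqrt_mul (by positivity), Real.sqrt_sq hzp]
    _ ≤ _ := mul_le_mul_of_nonneg_right (by linarith) hzp

/-- Sequences that are `O(1/k)` lie in `H^s_ζ` for `s < 1/2`. -/
theorem exists_sobNorm_le_of_decay (ν : ℝ) [Fact (0 < ν)] {s : ℝ} (hs : s < 1 / 2) :
    ∃ C : ℝ, 0 < C ∧ ∀ (ζ : ℤ × ℤ) (f : ℕ+ → ℂ) (M : ℝ), 0 ≤ M → (∀ k, ‖f k‖ ≤ M * (k : ℝ)⁻¹) →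
      f ∈ sobSubmodule ν s ζ ∧ sobNorm ν s ζ f ≤ C * japZ ζ ^ s * M := by
  have h3 : 0 < ν := Fact.out
  obtain ⟨C, hC, h⟩ := exists_sum_weight_div_sq_le ν hs
  refine ⟨C, hC, fun ζ f M hM hf => ?_⟩
  have key : ∀ k, weight ν ζ k ^ s * ‖f k‖ ^ 2 ≤ M ^ 2 * (weight ν ζ k ^ s * ((k : ℝ)⁻¹) ^ 2) := by
    intro k
    have := pow_le_pow_left₀ (norm_nonneg _) (hf k) 2
    calc _ ≤ weight ν ζ k ^ s * (M * (k : ℝ)⁻¹) ^ 2 :=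
          mul_le_mul_of_nonneg_left this (Real.rpow_nonneg (weight_pos h3 ζ k).le _)
      _ = _ := by ring
  refine ⟨mem_sob_of_le (h ζ).1 key, (sobNorm_le_of_le hM (h ζ).1 key).trans ?_⟩
  calc _ ≤ M * (C * japZ ζ ^ s) := mul_le_mul_of_nonneg_left (h ζ).2 hM
    _ = _ := by ring

theorem primCoeff_mem {a : ℝ} (ha : 0 < a) {s : ℝ} (hs : s < 1 / 2) {ζ : ℤ × ℤ} {f : ℕ+ → ℂ}
    (hf : Summable fun k => ‖f k‖) : primCoeff a f ∈ sobSubmodule ν s ζ := by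
  obtain ⟨C, -, h⟩ := exists_sobNorm_le_of_decay ν hs
  exact (h ζ _ (decayConst a * ∑' k, ‖f k‖)
    (mul_nonneg (decayConst_pos ha).le (tsum_nonneg fun _ => norm_nonneg _))
    (norm_primCoeff_le ha hf)).1

theorem sineMean_mem {a : ℝ} (ha : 0 < a) {s : ℝ} (hs : s < 1 / 2) {ζ : ℤ × ℤ} :
    sineMean a ∈ sobSubmodule ν s ζ := by
  obtain ⟨C, -, h⟩ := exists_sobNorm_le_of_decay ν hs
  exact (h ζ _ (decayConst a) (decayConst_pos ha).le (norm_sineMean_le_decayConst ha)).1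

/-- `‖∫_0^z f‖_{s,ζ} ≤ C ⟨ζ⟩^s ‖f‖_{ℓ¹}` for `s < 1/2`. -/
theorem exists_sobNorm_primCoeff_le (ν : ℝ) [Fact (0 < ν)] {a : ℝ} (ha : 0 < a) {s : ℝ}
    (hs : s < 1 / 2) : ∃ C : ℝ, 0 < C ∧ ∀ (ζ : ℤ × ℤ) (f : ℕ+ → ℂ), (Summable fun k => ‖f k‖) →
      sobNorm ν s ζ (primCoeff a f) ≤ C * japZ ζ ^ s * ∑' k, ‖f k‖ := by
  obtain ⟨C, hC, h⟩ := exists_sobNorm_le_of_decay ν hs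
  refine ⟨C * decayConst a, mul_pos hC (decayConst_pos ha), fun ζ f hf => ?_⟩
  refine ((h ζ _ (decayConst a * ∑' k, ‖f k‖)
    (mul_nonneg (decayConst_pos ha).le (tsum_nonneg fun _ => norm_nonneg _))
    (norm_primCoeff_le ha hf)).2).trans (le_of_eq ?_)
  ring

namespace HSob

variable {a s t : ℝ} {ζ : ℤ × ℤ}

theorem summable_norm_coeff (ht : 1 / 2 < t) (f : HSob ν t ζ) : Summable fun k => ‖f.coeff k‖ := by
  obtain ⟨C, -, h⟩ := exists_l1_le ν ht
  exact (h ζ f.coeff f.coeff_mem).1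

/-- The operator `f ↦ ∫_0^z f` from `H^t_ζ`, `t > 1/2`, to `H^s_ζ`, `s < 1/2`. -/
def primCLM (ζ : ℤ × ℤ) (ha : 0 < a) (hs : s < 1 / 2) (ht : 1 / 2 < t) :
    HSob ν t ζ →L[ℂ] HSob ν s ζ :=
  LinearMap.mkContinuousOfExistsBound
    { toFun := fun f => ofCoeff (primCoeff a f.coeff) (primCoeff_mem ha hs (summable_norm_coeff ht f))
      map_add' := fun f g => ext_coeff
        (primCoeff_add a (summable_norm_coeff ht f) (summable_norm_coeff ht g))
      map_smul' := fun c f => ext_coeff (primCoeff_smul a c f.coeff) } (by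
    obtain ⟨C, hC, h⟩ := exists_l1_le ν ht
    obtain ⟨C', hC', h'⟩ := exists_sobNorm_primCoeff_le ν ha hs
    refine ⟨C' * japZ ζ ^ s * C, fun f => ?_⟩
    rw [norm_eq, norm_eq]
    refine (h' ζ f.coeff (summable_norm_coeff ht f)).trans ?_
    rw [mul_assoc _ C]
    exact mul_le_mul_of_nonneg_left (h ζ f.coeff f.coeff_mem).2
      (mul_nonneg hC'.le (Real.rpow_nonneg (by linarith [one_le_japZ ζ]) _)))

@[simp] theorem coeff_primCLM (ha : 0 < a) (hs : s < 1 / 2) (ht : 1 / 2 < t) (f : HSob ν t ζ) :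
    (primCLM ζ ha hs ht f : HSob ν s ζ).coeff = primCoeff a f.coeff := rfl

theorem isCompactOperator_primCLM (ha : 0 < a) (hs : s < 1 / 2) (ht : 1 / 2 < t) :
    IsCompactOperator (primCLM ζ ha hs ht : HSob ν t ζ →L[ℂ] HSob ν s ζ) := by
  -- There is room below `1/2`: the primitive is bounded into `H^r` with `s < r < 1/2`, and `H^r →
  -- H^s` is compact.
  obtain ⟨r, hsr, hr⟩ := exists_between hs
  exact (isCompactOperator_incl (ν := ν) (ζ := ζ) hsr).comp_clm (primCLM ζ ha hr ht)

/-- The functional `f ↦ ∫_0^a f dz`. -/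
def meanCLM (ζ : ℤ × ℤ) (ha : 0 < a) (ht : 1 / 2 < t) : HSob ν t ζ →L[ℂ] ℂ :=
  LinearMap.mkContinuousOfExistsBound
    { toFun := fun f => ∑' k, sineMean a k * f.coeff k
      map_add' := fun f g => by
        rw [← (hasSum_sineMean_mul a (summable_norm_coeff ht f)).summable.tsum_add
          (hasSum_sineMean_mul a (summable_norm_coeff ht g)).summable]
        simp [mul_add]
      map_smul' := fun c f => by
        rw [RingHom.id_apply, smul_eq_mul, ← tsum_mul_left]
        simp [mul_left_comm] } (by
    obtain ⟨C, hC, h⟩ := exists_l1_le ν ht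
    refine ⟨decayConst a * C, fun f => ?_⟩
    have hb : ∀ k, ‖sineMean a k * f.coeff k‖ ≤ decayConst a * ‖f.coeff k‖ := fun k => by
      rw [norm_mul]
      refine mul_le_mul_of_nonneg_right ((norm_sineMean_le_decayConst ha k).trans ?_) (norm_nonneg _)
      exact mul_le_of_le_one_right (decayConst_pos ha).le (inv_le_one_of_one_le₀ (one_le_pnat_cast k))
    refine (tsum_of_norm_bounded ((summable_norm_coeff ht f).mul_left _).hasSum hb).trans ?_
    rw [tsum_mul_left, norm_eq, mul_assoc]
    exact mul_le_mul_of_nonneg_left (h ζ f.coeff f.coeff_mem).2 (decayConst_pos ha).le)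

theorem meanCLM_apply (ha : 0 < a) (ht : 1 / 2 < t) (f : HSob ν t ζ) :
    meanCLM ζ ha ht f = ∑' k, sineMean a k * f.coeff k := rfl

end HSob

end PrimEq

end

/-! ### The uncoupled problem, its explicit solution, and the Fredholm reduction. -/

noncomputable section

namespace PrimEq

/-- The symbol `ω² + ν k² π² / a²` of the operator `ω² - ν ∂_zz`. -/
def symb (ν a : ℝ) (lam : ℂ) (ζ : ℤ × ℤ) (k : ℕ+) : ℂ :=
  lam + ((ν * zsq ζ : ℝ) : ℂ) + ((ν * (k : ℝ) ^ 2 * Real.pi ^ 2 / a ^ 2 : ℝ) : ℂ)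

theorem helmholtz_eq (ν a : ℝ) (lam : ℂ) (ζ : ℤ × ℤ) (f : ℕ+ → ℂ) :
    helmholtz ν a (lam + ((ν * zsq ζ : ℝ) : ℂ)) f = fun k => symb ν a lam ζ k * f k := rfl

variable {ν : ℝ} [hν : Fact (0 < ν)]

theorem norm_symb_le (a : ℝ) (lam : ℂ) (ζ : ℤ × ℤ) (k : ℕ+) :
    ‖symb ν a lam ζ k‖ ≤ (‖lam‖ + 1 + Real.pi ^ 2 / a ^ 2) * weight ν ζ k := by
  have h3 := hν.out
  have hz := mul_nonneg h3.le (zsq_nonneg ζ)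
  have hk := mul_nonneg h3.le (sq_nonneg (k : ℝ))
  have h1 : ‖((ν * zsq ζ : ℝ) : ℂ)‖ = ν * zsq ζ := by
    rw [Complex.norm_real, Real.norm_of_nonneg hz]
  have h2 : ‖((ν * (k : ℝ) ^ 2 * Real.pi ^ 2 / a ^ 2 : ℝ) : ℂ)‖
      = (Real.pi ^ 2 / a ^ 2) * (ν * (k : ℝ) ^ 2) := by
    rw [Complex.norm_real, Real.norm_of_nonneg (by positivity)]; ring
  unfold symb
  refine (norm_add₃_le).trans ?_
  rw [h1, h2]
  unfold weight
  have := norm_nonneg lam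
  have hp : 0 ≤ Real.pi ^ 2 / a ^ 2 := by positivity
  nlinarith [mul_nonneg this hz, mul_nonneg this hk, mul_nonneg hp hz]

namespace HSob

variable {a s t : ℝ} {ζ : ℤ × ℤ}

theorem helmholtz_weighted_le (a s : ℝ) (lam : ℂ) (ζ : ℤ × ℤ) (f : ℕ+ → ℂ) (k : ℕ+) :
    weight ν ζ k ^ s * ‖symb ν a lam ζ k * f k‖ ^ 2 ≤
      (‖lam‖ + 1 + Real.pi ^ 2 / a ^ 2) ^ 2 * (weight ν ζ k ^ (s + 2) * ‖f k‖ ^ 2) := by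
  have hw := weight_pos hν.out ζ k
  have h := pow_le_pow_left₀ (norm_nonneg _) (norm_symb_le (ν := ν) a lam ζ k) 2
  rw [norm_mul, mul_pow, Real.rpow_add hw, Real.rpow_two]
  calc _ = (weight ν ζ k ^ s * ‖f k‖ ^ 2) * ‖symb ν a lam ζ k‖ ^ 2 := by ring
    _ ≤ (weight ν ζ k ^ s * ‖f k‖ ^ 2) * ((‖lam‖ + 1 + Real.pi ^ 2 / a ^ 2) * weight ν ζ k) ^ 2 :=
      mul_le_mul_of_nonneg_left h (weighted_nonneg s ζ f k)
    _ = _ := by ring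

/-- The operator `ω² - ν ∂_zz : H^{s+2}_ζ → H^s_ζ`, as a function. -/
def helmFun (a : ℝ) (lam : ℂ) (f : HSob ν (s + 2) ζ) : HSob ν s ζ :=
  ofCoeff (fun k => symb ν a lam ζ k * f.coeff k)
    (mem_sob_of_le f.coeff_mem (helmholtz_weighted_le a s lam ζ f.coeff))

theorem coeff_helmFun (a : ℝ) (lam : ℂ) (f : HSob ν (s + 2) ζ) :
    (helmFun a lam f).coeff = fun k => symb ν a lam ζ k * f.coeff k := coeff_ofCoeff _ _

theorem helmFun_add (a : ℝ) (lam : ℂ) (f g : HSob ν (s + 2) ζ) :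
    helmFun a lam (f + g) = helmFun a lam f + helmFun a lam g := by
  apply ext_coeff
  rw [coeff_add, coeff_helmFun, coeff_helmFun, coeff_helmFun, coeff_add]
  funext k; simp [mul_add]

theorem helmFun_smul (a : ℝ) (lam : ℂ) (c : ℂ) (f : HSob ν (s + 2) ζ) :
    helmFun a lam (c • f) = c • helmFun a lam f := by
  apply ext_coeff
  rw [coeff_smul, coeff_helmFun, coeff_helmFun, coeff_smul]
  funext k; simp [mul_left_comm]

theorem norm_helmFun_le (a : ℝ) (lam : ℂ) (f : HSob ν (s + 2) ζ) :
    ‖helmFun a lam f‖ ≤ (‖lam‖ + 1 + Real.pi ^ 2 / a ^ 2) * ‖f‖ := by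
  rw [norm_eq, norm_eq, coeff_helmFun]
  exact sobNorm_le_mul_sobNorm (by positivity) f.coeff_mem
    (helmholtz_weighted_le a s lam ζ f.coeff)

/-- The operator `ω² - ν ∂_zz : H^{s+2}_ζ → H^s_ζ`. -/
def helmCLM (a s : ℝ) (lam : ℂ) (ζ : ℤ × ℤ) : HSob ν (s + 2) ζ →L[ℂ] HSob ν s ζ :=
  LinearMap.mkContinuous
    { toFun := helmFun a lam
      map_add' := helmFun_add a lam
      map_smul' := helmFun_smul a lam } _ (norm_helmFun_le a lam)

theorem coeff_helmCLM (lam : ℂ) (f : HSob ν (s + 2) ζ) :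
    (helmCLM a s lam ζ f).coeff = fun k => symb ν a lam ζ k * f.coeff k := coeff_helmFun a lam f

/-- The inverse of the symbol gains two derivatives. -/
theorem inv_symb_weighted_le {a c s : ℝ} {lam : ℂ} (hc : 0 < c)
    (h : ∀ k, c * weight ν ζ k ≤ ‖symb ν a lam ζ k‖) (f : ℕ+ → ℂ) (k : ℕ+) :
    weight ν ζ k ^ (s + 2) * ‖(symb ν a lam ζ k)⁻¹ * f k‖ ^ 2 ≤
      (c⁻¹) ^ 2 * (weight ν ζ k ^ s * ‖f k‖ ^ 2) := by
  have hw := weight_pos hν.out ζ k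
  have h1 : ‖(symb ν a lam ζ k)⁻¹‖ ≤ (c * weight ν ζ k)⁻¹ := by
    rw [norm_inv]; exact inv_anti₀ (by positivity) (h k)
  have h2 := pow_le_pow_left₀ (norm_nonneg _) h1 2
  rw [norm_mul, mul_pow, Real.rpow_add hw, Real.rpow_two]
  calc _ = (weight ν ζ k ^ s * ‖f k‖ ^ 2) * weight ν ζ k ^ 2 * ‖(symb ν a lam ζ k)⁻¹‖ ^ 2 := by ring
    _ ≤ (weight ν ζ k ^ s * ‖f k‖ ^ 2) * weight ν ζ k ^ 2 * ((c * weight ν ζ k)⁻¹) ^ 2 :=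
      mul_le_mul_of_nonneg_left h2 (mul_nonneg (weighted_nonneg s ζ f k) (sq_nonneg _))
    _ = _ := by field_simp

/-- The operator `(ω² - ν ∂_zz)⁻¹ : H^s_ζ → H^{s+2}_ζ`, as a function. -/
def solveFun {c : ℝ} (lam : ℂ) (hc : 0 < c)
    (h : ∀ k, c * weight ν ζ k ≤ ‖symb ν a lam ζ k‖) (f : HSob ν s ζ) : HSob ν (s + 2) ζ :=
  ofCoeff (fun k => (symb ν a lam ζ k)⁻¹ * f.coeff k)
    (mem_sob_of_le f.coeff_mem (inv_symb_weighted_le hc h f.coeff))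

section

variable {c : ℝ} {lam : ℂ} (hc : 0 < c) (h : ∀ k, c * weight ν ζ k ≤ ‖symb ν a lam ζ k‖)

theorem coeff_solveFun (f : HSob ν s ζ) :
    (solveFun lam hc h f).coeff = fun k => (symb ν a lam ζ k)⁻¹ * f.coeff k := coeff_ofCoeff _ _

theorem solveFun_add (f g : HSob ν s ζ) :
    solveFun lam hc h (f + g) = solveFun lam hc h f + solveFun lam hc h g := by
  apply ext_coeff
  rw [coeff_add, coeff_solveFun, coeff_solveFun, coeff_solveFun, coeff_add]
  funext k; simp [mul_add]

theorem solveFun_smul (d : ℂ) (f : HSob ν s ζ) :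
    solveFun lam hc h (d • f) = d • solveFun lam hc h f := by
  apply ext_coeff
  rw [coeff_smul, coeff_solveFun, coeff_solveFun, coeff_smul]
  funext k; simp [mul_left_comm]

theorem norm_solveFun_le (f : HSob ν s ζ) : ‖solveFun lam hc h f‖ ≤ c⁻¹ * ‖f‖ := by
  rw [norm_eq, norm_eq, coeff_solveFun]
  exact sobNorm_le_mul_sobNorm (by positivity) f.coeff_mem (inv_symb_weighted_le hc h f.coeff)

/-- The operator `(ω² - ν ∂_zz)⁻¹ : H^s_ζ → H^{s+2}_ζ`. -/
def solveCLM : HSob ν s ζ →L[ℂ] HSob ν (s + 2) ζ :=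
  LinearMap.mkContinuous
    { toFun := solveFun lam hc h
      map_add' := solveFun_add hc h
      map_smul' := solveFun_smul hc h } _ (norm_solveFun_le hc h)

theorem coeff_solveCLM (f : HSob ν s ζ) :
    (solveCLM hc h f).coeff = fun k => (symb ν a lam ζ k)⁻¹ * f.coeff k := coeff_solveFun hc h f

theorem symb_ne_zero {c : ℝ} {lam : ℂ} (hc : 0 < c)
    (h : ∀ k, c * weight ν ζ k ≤ ‖symb ν a lam ζ k‖) (k : ℕ+) : symb ν a lam ζ k ≠ 0 := by
  have := (mul_pos hc (weight_pos hν.out ζ k)).trans_le (h k)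
  exact norm_pos_iff.1 this

theorem helmCLM_solveCLM (f : HSob ν s ζ) : helmCLM a s lam ζ (solveCLM hc h f) = f := by
  apply ext_coeff
  rw [coeff_helmCLM, coeff_solveCLM]
  funext k
  exact mul_inv_cancel_left₀ (symb_ne_zero hc h k) _

theorem solveCLM_helmCLM (f : HSob ν (s + 2) ζ) : solveCLM hc h (helmCLM a s lam ζ f) = f := by
  apply ext_coeff
  rw [coeff_solveCLM, coeff_helmCLM]
  funext k
  exact inv_mul_cancel_left₀ (symb_ne_zero hc h k) _

end

/-- The constant function `1` as an element of `H^s_ζ`, `s < 1/2`. -/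
def oneElt (ζ : ℤ × ℤ) (ha : 0 < a) (hs : s < 1 / 2) : HSob ν s ζ :=
  ofCoeff (sineMean a) (sineMean_mem ha hs)

theorem coeff_oneElt (ha : 0 < a) (hs : s < 1 / 2) :
    (oneElt ζ ha hs : HSob ν s ζ).coeff = sineMean a := coeff_ofCoeff _ _

end HSob

/-- The space `H^{σ+2}_ζ × H^{σ+2}_ζ × ℂ × H^{σ+2}_ζ`. -/
abbrev DomSpace (ν σ : ℝ) [Fact (0 < ν)] (ζ : ℤ × ℤ) : Type :=
  HSob ν (σ + 2) ζ × HSob ν (σ + 2) ζ × ℂ × HSob ν (σ + 2) ζ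

/-- The space `(H^σ_ζ)³`. -/
abbrev RanSpace (ν σ : ℝ) [Fact (0 < ν)] (ζ : ℤ × ℤ) : Type :=
  HSob ν σ ζ × HSob ν σ ζ × HSob ν σ ζ

open HSob

section operators

variable {a σ : ℝ} {ζ : ℤ × ℤ}

def projU (ν σ : ℝ) [Fact (0 < ν)] (ζ : ℤ × ℤ) : DomSpace ν σ ζ →L[ℂ] HSob ν (σ + 2) ζ :=
  ContinuousLinearMap.fst ℂ _ _

def projV (ν σ : ℝ) [Fact (0 < ν)] (ζ : ℤ × ℤ) : DomSpace ν σ ζ →L[ℂ] HSob ν (σ + 2) ζ :=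
  (ContinuousLinearMap.fst ℂ _ _).comp (ContinuousLinearMap.snd ℂ _ _)

def projP (ν σ : ℝ) [Fact (0 < ν)] (ζ : ℤ × ℤ) : DomSpace ν σ ζ →L[ℂ] ℂ :=
  (ContinuousLinearMap.fst ℂ _ _).comp
    ((ContinuousLinearMap.snd ℂ _ _).comp (ContinuousLinearMap.snd ℂ _ _))

def projT (ν σ : ℝ) [Fact (0 < ν)] (ζ : ℤ × ℤ) : DomSpace ν σ ζ →L[ℂ] HSob ν (σ + 2) ζ :=
  (ContinuousLinearMap.snd ℂ _ _).comp
    ((ContinuousLinearMap.snd ℂ _ _).comp (ContinuousLinearMap.snd ℂ _ _))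

/-- The operator `𝓛₀`. -/
def L0 (lam : ℂ) (ζ : ℤ × ℤ) (ha : 0 < a) (hσ : σ < 1 / 2) : DomSpace ν σ ζ →L[ℂ] RanSpace ν σ ζ :=
  ((helmCLM a σ lam ζ).comp (projU ν σ ζ) +
      (projP ν σ ζ).smulRight ((Complex.I * (ζ.1 : ℂ)) • oneElt ζ ha hσ)).prod
    (((helmCLM a σ lam ζ).comp (projV ν σ ζ) +
      (projP ν σ ζ).smulRight ((Complex.I * (ζ.2 : ℂ)) • oneElt ζ ha hσ)).prod
    ((helmCLM a σ lam ζ).comp (projT ν σ ζ)))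

theorem L0_apply (lam : ℂ) (ha : 0 < a) (hσ : σ < 1 / 2) (u v : HSob ν (σ + 2) ζ) (p : ℂ)
    (θ : HSob ν (σ + 2) ζ) : L0 lam ζ ha hσ (u, v, p, θ) =
      (helmCLM a σ lam ζ u + p • ((Complex.I * (ζ.1 : ℂ)) • oneElt ζ ha hσ),
        helmCLM a σ lam ζ v + p • ((Complex.I * (ζ.2 : ℂ)) • oneElt ζ ha hσ),
        helmCLM a σ lam ζ θ) := rfl

/-- The coupling operator `𝓛₁`. -/
def L1 (α β γ : ℝ) (ζ : ℤ × ℤ) (ha : 0 < a) (hσ : σ < 1 / 2) (hσ' : 1 / 2 < σ + 2) :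
    DomSpace ν σ ζ →L[ℂ] RanSpace ν σ ζ :=
  (-(α : ℂ) • (incl (by linarith)).comp (projV ν σ ζ) +
      (Complex.I * (ζ.1 : ℂ) * (β : ℂ)) • (primCLM ζ ha hσ hσ').comp (projT ν σ ζ)).prod
    (((α : ℂ) • (incl (by linarith)).comp (projU ν σ ζ) +
      (Complex.I * (ζ.2 : ℂ) * (β : ℂ)) • (primCLM ζ ha hσ hσ').comp (projT ν σ ζ)).prod
    (-((γ : ℂ) * Complex.I * (ζ.1 : ℂ)) • (primCLM ζ ha hσ hσ').comp (projU ν σ ζ)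
      - ((γ : ℂ) * Complex.I * (ζ.2 : ℂ)) • (primCLM ζ ha hσ hσ').comp (projV ν σ ζ)))

theorem L1_apply (α β γ : ℝ) (ha : 0 < a) (hσ : σ < 1 / 2) (hσ' : 1 / 2 < σ + 2)
    (u v : HSob ν (σ + 2) ζ) (p : ℂ) (θ : HSob ν (σ + 2) ζ) :
    L1 α β γ ζ ha hσ hσ' (u, v, p, θ) =
      (-(α : ℂ) • incl (by linarith) v + (Complex.I * (ζ.1 : ℂ) * (β : ℂ)) • primCLM ζ ha hσ hσ' θ,
        (α : ℂ) • incl (by linarith) u + (Complex.I * (ζ.2 : ℂ) * (β : ℂ)) • primCLM ζ ha hσ hσ' θ,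
        -((γ : ℂ) * Complex.I * (ζ.1 : ℂ)) • primCLM ζ ha hσ hσ' u
          - ((γ : ℂ) * Complex.I * (ζ.2 : ℂ)) • primCLM ζ ha hσ hσ' v) := rfl

theorem isCompactOperator_L1 (α β γ : ℝ) (ha : 0 < a) (hσ : σ < 1 / 2) (hσ' : 1 / 2 < σ + 2) :
    IsCompactOperator (L1 α β γ ζ ha hσ hσ' : DomSpace ν σ ζ →L[ℂ] RanSpace ν σ ζ) := by
  have hi : IsCompactOperator (incl (by linarith) : HSob ν (σ + 2) ζ →L[ℂ] HSob ν σ ζ) :=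
    isCompactOperator_incl (by linarith)
  have hp : IsCompactOperator (primCLM ζ ha hσ hσ' : HSob ν (σ + 2) ζ →L[ℂ] HSob ν σ ζ) :=
    isCompactOperator_primCLM ha hσ hσ'
  have h1 : IsCompactOperator (-(α : ℂ) • (incl (by linarith)).comp (projV ν σ ζ) +
      (Complex.I * (ζ.1 : ℂ) * (β : ℂ)) • (primCLM ζ ha hσ hσ').comp (projT ν σ ζ) :
      DomSpace ν σ ζ →L[ℂ] HSob ν σ ζ) :=
    ((hi.comp_clm (projV ν σ ζ)).smul _).add ((hp.comp_clm (projT ν σ ζ)).smul _)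
  have h2 : IsCompactOperator ((α : ℂ) • (incl (by linarith)).comp (projU ν σ ζ) +
      (Complex.I * (ζ.2 : ℂ) * (β : ℂ)) • (primCLM ζ ha hσ hσ').comp (projT ν σ ζ) :
      DomSpace ν σ ζ →L[ℂ] HSob ν σ ζ) :=
    ((hi.comp_clm (projU ν σ ζ)).smul _).add ((hp.comp_clm (projT ν σ ζ)).smul _)
  have h3 : IsCompactOperator (-((γ : ℂ) * Complex.I * (ζ.1 : ℂ)) •
        (primCLM ζ ha hσ hσ').comp (projU ν σ ζ)
      - ((γ : ℂ) * Complex.I * (ζ.2 : ℂ)) • (primCLM ζ ha hσ hσ').comp (projV ν σ ζ) :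
      DomSpace ν σ ζ →L[ℂ] HSob ν σ ζ) :=
    ((hp.comp_clm (projU ν σ ζ)).smul _).sub ((hp.comp_clm (projV ν σ ζ)).smul _)
  -- A map into a product is the sum of its components followed by the coordinate injections, so
  -- compactness of the three rows suffices.
  have e1 := h1.clm_comp (ContinuousLinearMap.inl ℂ (HSob ν σ ζ) (HSob ν σ ζ × HSob ν σ ζ))
  have e2 := (h2.clm_comp (ContinuousLinearMap.inl ℂ (HSob ν σ ζ) (HSob ν σ ζ))).clm_comp
    (ContinuousLinearMap.inr ℂ (HSob ν σ ζ) (HSob ν σ ζ × HSob ν σ ζ))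
  have e3 := (h3.clm_comp (ContinuousLinearMap.inr ℂ (HSob ν σ ζ) (HSob ν σ ζ))).clm_comp
    (ContinuousLinearMap.inr ℂ (HSob ν σ ζ) (HSob ν σ ζ × HSob ν σ ζ))
  have e := (e1.add e2).add e3
  refine (congrArg IsCompactOperator (funext fun x => ?_)).mpr e
  unfold L1
  simp only [ContinuousLinearMap.prod_apply, Pi.add_apply, Function.comp_apply,
    ContinuousLinearMap.inl_apply, ContinuousLinearMap.inr_apply, Prod.mk_add_mk, add_zero, zero_add]

/-- Expresses the constraint through continuous linear functionals, so that membership in the domain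
becomes a matter of algebra. -/
theorem mem_Dom_iff (ha : 0 < a) (hσ' : 1 / 2 < σ + 2) (x : DomSpace ν σ ζ) :
    x ∈ Dom ν a (σ + 2) ζ ↔
      (ζ.1 : ℂ) * meanCLM ζ ha hσ' x.1 + (ζ.2 : ℂ) * meanCLM ζ ha hσ' x.2.1 = 0 := by
  have h1 := summable_norm_coeff hσ' x.1
  have h2 := summable_norm_coeff hσ' x.2.1
  have e : (ζ.1 : ℂ) * meanCLM ζ ha hσ' x.1 + (ζ.2 : ℂ) * meanCLM ζ ha hσ' x.2.1
      = ∫ z in (0 : ℝ)..a, ((ζ.1 : ℂ) * toFunction a x.1.coeff z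
      + (ζ.2 : ℂ) * toFunction a x.2.1.coeff z) := by
    rw [integral_div_eq a _ _ h1 h2, meanCLM_apply, meanCLM_apply, ← tsum_mul_left, ← tsum_mul_left,
      ← ((hasSum_sineMean_mul a h1).summable.mul_left _).tsum_add
        ((hasSum_sineMean_mul a h2).summable.mul_left _)]
    refine tsum_congr fun k => ?_
    ring
  rw [e]
  rfl

section

variable {c : ℝ} {lam : ℂ} (ha : 0 < a) (hσ : σ < 1 / 2) (hσ' : 1 / 2 < σ + 2) (hc : 0 < c)
  (h : ∀ k, c * weight ν ζ k ≤ ‖symb ν a lam ζ k‖)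

/-- The determinant `∑_k c_k² / (ω² + ν k² π² / a²)` of the pressure problem, `c_k = ∫_0^a e_k`. -/
def presDet : ℂ := meanCLM ζ ha hσ' (solveCLM hc h (oneElt ζ ha hσ))

/-- In this form the determinant no longer refers to `c` and `h`, and bounds uniform in `(λ,ζ)` can
be stated for it. -/
theorem presDet_eq : presDet ha hσ hσ' hc h
    = ∑' k, sineMean a k * ((symb ν a lam ζ k)⁻¹ * sineMean a k) := by
  unfold presDet
  rw [meanCLM_apply, coeff_solveCLM, coeff_oneElt]

/-- The pressure in the uncoupled problem. -/
def solveP : RanSpace ν σ ζ →L[ℂ] ℂ :=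
  (Complex.I * (zsq ζ : ℂ) * presDet ha hσ hσ' hc h)⁻¹ •
    ((ζ.1 : ℂ) • ((meanCLM ζ ha hσ').comp (solveCLM hc h)).comp (ContinuousLinearMap.fst ℂ _ _) +
      (ζ.2 : ℂ) • ((meanCLM ζ ha hσ').comp (solveCLM hc h)).comp
        ((ContinuousLinearMap.fst ℂ _ _).comp (ContinuousLinearMap.snd ℂ _ _)))

theorem solveP_apply (F : RanSpace ν σ ζ) : solveP ha hσ hσ' hc h F =
    (Complex.I * (zsq ζ : ℂ) * presDet ha hσ hσ' hc h)⁻¹ *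
      ((ζ.1 : ℂ) * meanCLM ζ ha hσ' (solveCLM hc h F.1)
        + (ζ.2 : ℂ) * meanCLM ζ ha hσ' (solveCLM hc h F.2.1)) := rfl

/-- The solution operator of the uncoupled problem. -/
def solveL0 : RanSpace ν σ ζ →L[ℂ] DomSpace ν σ ζ :=
  ((solveCLM hc h).comp (ContinuousLinearMap.fst ℂ _ _) - (solveP ha hσ hσ' hc h).smulRight
      (solveCLM hc h ((Complex.I * (ζ.1 : ℂ)) • oneElt ζ ha hσ))).prod
    (((solveCLM hc h).comp ((ContinuousLinearMap.fst ℂ _ _).comp (ContinuousLinearMap.snd ℂ _ _))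
      - (solveP ha hσ hσ' hc h).smulRight
        (solveCLM hc h ((Complex.I * (ζ.2 : ℂ)) • oneElt ζ ha hσ))).prod
    ((solveP ha hσ hσ' hc h).prod
      ((solveCLM hc h).comp ((ContinuousLinearMap.snd ℂ _ _).comp (ContinuousLinearMap.snd ℂ _ _)))))

theorem solveL0_apply (F : RanSpace ν σ ζ) : solveL0 ha hσ hσ' hc h F =
    (solveCLM hc h F.1 - solveP ha hσ hσ' hc h F •
        solveCLM hc h ((Complex.I * (ζ.1 : ℂ)) • oneElt ζ ha hσ),
      solveCLM hc h F.2.1 - solveP ha hσ hσ' hc h F •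
        solveCLM hc h ((Complex.I * (ζ.2 : ℂ)) • oneElt ζ ha hσ),
      solveP ha hσ hσ' hc h F, solveCLM hc h F.2.2) := rfl

theorem zsq_cast (ζ : ℤ × ℤ) : (zsq ζ : ℂ) = (ζ.1 : ℂ) ^ 2 + (ζ.2 : ℂ) ^ 2 := by
  unfold zsq; push_cast; rfl

/-- The pressure in `solveP` is the one for which the two contributions to `∫ (ξu + ηv)` cancel.
Solving for it divides by `i|ζ|²D`, hence the conditions on `ζ` and `presDet`. -/
theorem solveL0_mem (hζ : ζ ≠ 0) (hD : presDet ha hσ hσ' hc h ≠ 0) (F : RanSpace ν σ ζ) :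
    solveL0 ha hσ hσ' hc h F ∈ Dom ν a (σ + 2) ζ := by
  have hz : (zsq ζ : ℂ) ≠ 0 := Complex.ofReal_ne_zero.2 (by linarith [one_le_zsq hζ])
  rw [mem_Dom_iff ha hσ', solveL0_apply]
  dsimp only
  rw [map_sub, map_sub, map_smul, map_smul, map_smul, map_smul, map_smul, map_smul]
  have e : meanCLM ζ ha hσ' (solveCLM hc h (oneElt ζ ha hσ)) = presDet ha hσ hσ' hc h := rfl
  rw [e, solveP_apply]
  simp only [smul_eq_mul]
  have hI := Complex.I_ne_zero
  field_simp
  rw [zsq_cast]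
  ring

/-- This holds whatever value the pressure takes: its contribution is subtracted before solving and
added back by `𝓛₀`. The choice of pressure matters only for the constraint. -/
theorem L0_solveL0 (F : RanSpace ν σ ζ) : L0 lam ζ ha hσ (solveL0 ha hσ hσ' hc h F) = F := by
  rw [solveL0_apply, L0_apply, map_sub, map_sub]
  simp only [map_smul, helmCLM_solveCLM, sub_add_cancel]

/-- The scalar equation for the pressure. Applying `(ω² - ν∂_zz)⁻¹` to the two velocity rows and
pairing with `ζ` leaves `∫ (ξu + ηv)`, which is zero on the domain, plus `i|ζ|²D p₀`. It yields both
uniqueness and the pressure estimate. -/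
theorem mean_div_L0 (x : DomSpace ν σ ζ) (hx : x ∈ Dom ν a (σ + 2) ζ) :
    (ζ.1 : ℂ) * meanCLM ζ ha hσ' (solveCLM hc h (L0 lam ζ ha hσ x).1)
        + (ζ.2 : ℂ) * meanCLM ζ ha hσ' (solveCLM hc h (L0 lam ζ ha hσ x).2.1)
      = (Complex.I * (zsq ζ : ℂ) * presDet ha hσ hσ' hc h) * x.2.2.1 := by
  obtain ⟨u, v, p, θ⟩ := x
  rw [mem_Dom_iff ha hσ'] at hx
  rw [L0_apply]
  dsimp only at hx ⊢
  rw [map_add, map_add, map_add, map_add, map_smul, map_smul, map_smul, map_smul, map_smul, map_smul,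
    map_smul, map_smul, solveCLM_helmCLM, solveCLM_helmCLM]
  have e : meanCLM ζ ha hσ' (solveCLM hc h (oneElt ζ ha hσ)) = presDet ha hσ hσ' hc h := rfl
  rw [e, zsq_cast]
  simp only [smul_eq_mul]
  linear_combination hx

theorem solveL0_L0 (hζ : ζ ≠ 0) (hD : presDet ha hσ hσ' hc h ≠ 0) (x : DomSpace ν σ ζ)
    (hx : x ∈ Dom ν a (σ + 2) ζ) : solveL0 ha hσ hσ' hc h (L0 lam ζ ha hσ x) = x := by
  have hz : (zsq ζ : ℂ) ≠ 0 := Complex.ofReal_ne_zero.2 (by linarith [one_le_zsq hζ])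
  have hp : solveP ha hσ hσ' hc h (L0 lam ζ ha hσ x) = x.2.2.1 := by
    rw [solveP_apply, mean_div_L0 ha hσ hσ' hc h x hx, inv_mul_cancel_left₀]
    exact mul_ne_zero (mul_ne_zero Complex.I_ne_zero hz) hD
  rw [solveL0_apply, hp]
  obtain ⟨u, v, p, θ⟩ := x
  rw [L0_apply]
  dsimp only
  rw [map_add, map_add, solveCLM_helmCLM, solveCLM_helmCLM, solveCLM_helmCLM]
  simp only [map_smul, add_sub_cancel_right]

/-- If `𝓛` is injective, it is bijective and `𝓛₀` is bounded by `𝓛`. -/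
theorem surjective_and_bound_of_injective (α β γ : ℝ) (hζ : ζ ≠ 0)
    (hD : presDet ha hσ hσ' hc h ≠ 0)
    (hinj : ∀ x ∈ Dom ν a (σ + 2) ζ,
      L0 lam ζ ha hσ x + L1 α β γ ζ ha hσ hσ' x = (0 : RanSpace ν σ ζ) → x = 0) :
    (∀ F : RanSpace ν σ ζ, ∃ x ∈ Dom ν a (σ + 2) ζ, L0 lam ζ ha hσ x + L1 α β γ ζ ha hσ hσ' x = F) ∧
    ∃ C : ℝ, 0 < C ∧ ∀ x ∈ Dom ν a (σ + 2) ζ, ‖(L0 lam ζ ha hσ x : RanSpace ν σ ζ)‖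
      ≤ C * ‖(L0 lam ζ ha hσ x + L1 α β γ ζ ha hσ hσ' x : RanSpace ν σ ζ)‖ := by
  set G := solveL0 ha hσ hσ' hc h with hG
  -- With `K = 𝓛₁𝓛₀⁻¹` one has `𝓛 = (1 + K)𝓛₀` on the domain. The Fredholm argument thus takes place
  -- in `(H^σ_ζ)³`, where no constraint has to be carried along.
  set K : RanSpace ν σ ζ →L[ℂ] RanSpace ν σ ζ := (L1 α β γ ζ ha hσ hσ').comp G with hKdef
  have hKa : ∀ F, K F = L1 α β γ ζ ha hσ hσ' (G F) := fun F => rfl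
  have hK : IsCompactOperator K := (isCompactOperator_L1 α β γ ha hσ hσ').comp_clm G
  have hF := exists_bound_and_surjective_one_add hK (fun F hF => by
    have h0 := hinj (G F) (solveL0_mem ha hσ hσ' hc h hζ hD F)
    rw [hG, L0_solveL0, ← hG, ← hKa] at h0
    have h1 := L0_solveL0 ha hσ hσ' hc h F
    rw [← hG, h0 hF, map_zero] at h1
    exact h1.symm)
  refine ⟨fun F => ?_, ?_⟩
  · obtain ⟨F', hF'⟩ := hF.1 F
    refine ⟨G F', solveL0_mem ha hσ hσ' hc h hζ hD F', ?_⟩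
    rw [hG, L0_solveL0, ← hG, ← hKa]
    exact hF'
  · obtain ⟨C, hC, hb⟩ := hF.2
    refine ⟨C, hC, fun x hx => ?_⟩
    have := hb (L0 lam ζ ha hσ x)
    rw [hKa, hG, solveL0_L0 ha hσ hσ' hc h hζ hD x hx] at this
    exact this

end

end operators

end PrimEq

end

/-! ### The kernel of `𝓛` and the eigenvalues of the Primitive Equations operator. -/

noncomputable section

namespace PrimEq

open HSob

theorem conj_primitive (a : ℝ) (f : ℕ+ → ℂ) (z : ℝ) :
    conj (primitive a f z) = primitive a (fun k => conj (f k)) z := by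
  unfold primitive
  simp only [← conj_toFunction]
  rw [intervalIntegral.intervalIntegral_conj]

theorem conj_vertVel (a : ℝ) (ζ : ℤ × ℤ) {f g : ℕ+ → ℂ} (hf : Summable fun k => ‖f k‖)
    (hg : Summable fun k => ‖g k‖) (z : ℝ) : conj (vertVel a ζ f g z) = Complex.I *
      primitive a ((ζ.1 : ℂ) • (fun k => conj (f k)) + (ζ.2 : ℂ) • fun k => conj (g k)) z := by
  rw [vertVel_eq a ζ hf hg, primitive_add, primitive_smul, primitive_smul, ← conj_primitive,
    ← conj_primitive]
  · simp only [map_neg, map_add, map_mul, Complex.conj_I, map_intCast]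
    ring
  · simp only [Pi.smul_apply, norm_smul, RCLike.norm_conj]; exact hf.mul_left _
  · simp only [Pi.smul_apply, norm_smul, RCLike.norm_conj]; exact hg.mul_left _

/-- The mode `ζ` of a sum over all modes. -/
theorem tsum_eq_tsum_mode {ζ : ℤ × ℤ} {F : (ℤ × ℤ) × ℕ+ → ℂ} (hF : ∀ p, p.1 ≠ ζ → F p = 0) :
    ∑' p, F p = ∑' k, F (ζ, k) := by
  have hi : Function.Injective fun k : ℕ+ => (ζ, k) := Prod.mk_right_injective ζ
  refine (hi.tsum_eq fun p hp => ?_).symm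
  have : p.1 = ζ := by
    by_contra h
    exact hp (hF p h)
  exact ⟨p.2, by rw [← this]⟩

variable {ν : ℝ} [hν : Fact (0 < ν)] {ζ : ℤ × ℤ}

theorem memH1_single {f : ℕ+ → ℂ} (hf : f ∈ sobSubmodule ν 1 ζ) :
    MemH1 ν (Pi.single ζ f : Coeffs) := by
  have hi : Function.Injective fun k : ℕ+ => (ζ, k) := Prod.mk_right_injective ζ
  unfold MemH1
  refine (hi.summable_iff fun p hp => ?_).1 ?_
  · have : p.1 ≠ ζ := fun h => hp ⟨p.2, by rw [← h]⟩
    simp [this]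
  · simpa [Function.comp_def] using mem_sob_iff.1 hf

theorem mem_sob_one_of_memH1 {f : Coeffs} (hf : MemH1 ν f) (ζ : ℤ × ℤ) :
    f ζ ∈ sobSubmodule ν 1 ζ := by
  have hi : Function.Injective fun k : ℕ+ => (ζ, k) := Prod.mk_right_injective ζ
  refine mem_sob_iff.2 ?_
  simpa [Function.comp_def] using hf.comp_injective hi

/-- The multiplier may grow like the weight, so `q = 1` gives the terms of `innerH` and `formC`, and
`q_k = |ζ|² + k²π²/a²` those of `innerV`. -/
theorem summable_mul_conj {f g : ℕ+ → ℂ} {q : ℕ+ → ℂ} {C : ℝ} (hf : f ∈ sobSubmodule ν 1 ζ)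
    (hg : g ∈ sobSubmodule ν 1 ζ) (hq : ∀ k, ‖q k‖ ≤ C * weight ν ζ k) :
    Summable fun k => q k * (f k * conj (g k)) := by
  have hf' := mem_sob_iff.1 hf
  have hg' := mem_sob_iff.1 hg
  simp only [Real.rpow_one] at hf' hg'
  have hC : 0 ≤ C := by
    have := (norm_nonneg _).trans (hq 1)
    exact nonneg_of_mul_nonneg_left this (weight_pos hν.out ζ 1)
  refine Summable.of_norm_bounded ((hf'.add hg').mul_left C) fun k => ?_
  rw [norm_mul, norm_mul, RCLike.norm_conj]
  have hw := weight_pos hν.out ζ k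
  calc _ ≤ (C * weight ν ζ k) * (‖f k‖ * ‖g k‖) :=
        mul_le_mul_of_nonneg_right (hq k) (by positivity)
    _ ≤ (C * weight ν ζ k) * (‖f k‖ ^ 2 + ‖g k‖ ^ 2) := by
        refine mul_le_mul_of_nonneg_left ?_ (by positivity)
        nlinarith [sq_nonneg (‖f k‖ - ‖g k‖), sq_nonneg ‖f k‖, sq_nonneg ‖g k‖]
    _ = _ := by ring

theorem summable_norm_of_mem_one {f : ℕ+ → ℂ} (hf : f ∈ sobSubmodule ν 1 ζ) :
    Summable fun k => ‖f k‖ := by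
  obtain ⟨C, -, h⟩ := exists_l1_le ν (s := 1) (by norm_num)
  exact (h ζ f hf).1

/-- The equations `𝓛(u,v,p₀,θ) = 0`, tested with a triple in mode `ζ`. -/
theorem weak_form_of_kernel {a α β γ : ℝ} {lam p : ℂ} (hβγ : 0 < β * γ) {u v θ u' v' θ' : ℕ+ → ℂ}
    (hu : u ∈ sobSubmodule ν 1 ζ) (hv : v ∈ sobSubmodule ν 1 ζ) (hθ : θ ∈ sobSubmodule ν 1 ζ)
    (hu' : u' ∈ sobSubmodule ν 1 ζ) (hv' : v' ∈ sobSubmodule ν 1 ζ)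
    (hθ' : θ' ∈ sobSubmodule ν 1 ζ)
    (e1 : ∀ k, symb ν a lam ζ k * u k + p * (Complex.I * ζ.1 * sineMean a k)
      - α * v k + Complex.I * ζ.1 * β * primCoeff a θ k = 0)
    (e2 : ∀ k, symb ν a lam ζ k * v k + p * (Complex.I * ζ.2 * sineMean a k)
      + α * u k + Complex.I * ζ.2 * β * primCoeff a θ k = 0)
    (e3 : ∀ k, symb ν a lam ζ k * θ k - γ * Complex.I * ζ.1 * primCoeff a u k
      - γ * Complex.I * ζ.2 * primCoeff a v k = 0)
    (hdiv : vertVel a ζ u' v' a = 0) :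
    lam * (∑' k, (u k * conj (u' k) + v k * conj (v' k) + ((β / γ : ℝ) : ℂ) * (θ k * conj (θ' k))))
      + ν * (∑' k : ℕ+, ((zsq ζ + (k : ℝ) ^ 2 * Real.pi ^ 2 / a ^ 2 : ℝ) : ℂ) *
        (u k * conj (u' k) + v k * conj (v' k) + ((β / γ : ℝ) : ℂ) * (θ k * conj (θ' k))))
      + β * (∫ z in (0 : ℝ)..a, (-(toFunction a θ z * conj (vertVel a ζ u' v' z))
          + vertVel a ζ u v z * conj (toFunction a θ' z)))
      + α * (∑' k, (-(v k * conj (u' k)) + u k * conj (v' k))) = 0 := by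
  have h3 := hν.out
  have lu := summable_norm_of_mem_one hu
  have lv := summable_norm_of_mem_one hv
  have lθ := summable_norm_of_mem_one hθ
  have lu' := summable_norm_of_mem_one hu'
  have lv' := summable_norm_of_mem_one hv'
  have lθ' := summable_norm_of_mem_one hθ'
  have lcθ' : Summable fun k => ‖conj (θ' k)‖ := by simpa only [RCLike.norm_conj] using lθ'
  have hγ : (γ : ℂ) ≠ 0 := by
    rintro h
    have : γ = 0 := Complex.ofReal_eq_zero.1 h
    simp [this] at hβγ
  set hb : ℕ+ → ℂ := (ζ.1 : ℂ) • (fun k => conj (u' k)) + (ζ.2 : ℂ) • fun k => conj (v' k) with hbdef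
  have lhb : Summable fun k => ‖hb k‖ := by
    refine Summable.of_nonneg_of_le (fun _ => norm_nonneg _) (fun k => norm_add_le _ _) ?_
    simp only [Pi.smul_apply, norm_smul, RCLike.norm_conj]
    exact (lu'.mul_left _).add (lv'.mul_left _)
  have hcv : ∀ z, conj (vertVel a ζ u' v' z) = Complex.I * primitive a hb z :=
    fun z => conj_vertVel a ζ lu' lv' z
  -- The constraint on the test field, used twice: it makes the pressure drop out (`s1`), and it
  -- removes the boundary term when the coupling with `θ` is integrated by parts (`s2`).
  have hba : primitive a hb a = 0 := by
    have := hcv a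
    rw [hdiv, map_zero] at this
    exact (mul_eq_zero.1 this.symm).resolve_left Complex.I_ne_zero
  -- the three series that enter the equations
  have s1 : HasSum (fun k => sineMean a k * hb k) 0 := by
    have := hasSum_sineMean_mul a lhb
    rwa [show ∫ z in (0 : ℝ)..a, toFunction a hb z = 0 from hba] at this
  have s2 : HasSum (fun k => primCoeff a θ k * hb k)
      (-∫ z in (0 : ℝ)..a, toFunction a θ z * primitive a hb z) := by
    have := hasSum_mul_sineCoeff a (continuous_primitive a lθ) lhb
    rwa [integral_primitive_mul a lθ lhb hba] at this
  have s3 := hasSum_mul_sineCoeff a (continuous_primitive a lu) lcθ'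
  have s4 := hasSum_mul_sineCoeff a (continuous_primitive a lv) lcθ'
  have sB : ∫ z in (0 : ℝ)..a, (-(toFunction a θ z * conj (vertVel a ζ u' v' z))
          + vertVel a ζ u v z * conj (toFunction a θ' z))
      = -Complex.I * (∫ z in (0 : ℝ)..a, toFunction a θ z * primitive a hb z)
        - Complex.I * ζ.1 * (∫ z in (0 : ℝ)..a,
            primitive a u z * toFunction a (fun k => conj (θ' k)) z)
        - Complex.I * ζ.2 * (∫ z in (0 : ℝ)..a,
            primitive a v z * toFunction a (fun k => conj (θ' k)) z) := by
    have c1 := continuous_toFunction a lθ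
    have c2 := continuous_primitive a lhb
    have c3 := continuous_primitive a lu
    have c4 := continuous_primitive a lv
    have c5 := continuous_toFunction a lcθ'
    rw [← intervalIntegral.integral_const_mul, ← intervalIntegral.integral_const_mul,
      ← intervalIntegral.integral_const_mul, ← intervalIntegral.integral_sub,
      ← intervalIntegral.integral_sub]
    · refine intervalIntegral.integral_congr fun z _ => ?_
      rw [hcv, vertVel_eq a ζ lu lv, conj_toFunction]
      ring
    · exact (by fun_prop : Continuous fun z => -Complex.I * (toFunction a θ z * primitive a hb z) -
        Complex.I * ζ.1 * (primitive a u z * toFunction a (fun k => conj (θ' k)) z)).intervalIntegrable _ _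
    · exact (by fun_prop : Continuous fun z => Complex.I * ζ.2 *
        (primitive a v z * toFunction a (fun k => conj (θ' k)) z)).intervalIntegrable _ _
    · exact (by fun_prop : Continuous fun z =>
        -Complex.I * (toFunction a θ z * primitive a hb z)).intervalIntegrable _ _
    · exact (by fun_prop : Continuous fun z => Complex.I * ζ.1 *
        (primitive a u z * toFunction a (fun k => conj (θ' k)) z)).intervalIntegrable _ _
  have q1 : ∀ k : ℕ+, ‖(1 : ℂ)‖ ≤ 1 * weight ν ζ k := fun k => by
    rw [norm_one, one_mul]; exact one_le_weight ζ k
  have q2 : ∀ k : ℕ+, ‖((zsq ζ + (k : ℝ) ^ 2 * Real.pi ^ 2 / a ^ 2 : ℝ) : ℂ)‖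
      ≤ (ν⁻¹ * (1 + Real.pi ^ 2 / a ^ 2)) * weight ν ζ k := fun k => by
    have hz := zsq_nonneg ζ
    rw [Complex.norm_real, Real.norm_of_nonneg (by positivity), mul_assoc, le_inv_mul_iff₀ h3]
    unfold weight
    have hp : 0 ≤ Real.pi ^ 2 / a ^ 2 := by positivity
    have e : (k : ℝ) ^ 2 * Real.pi ^ 2 / a ^ 2 = Real.pi ^ 2 / a ^ 2 * (k : ℝ) ^ 2 := by ring
    rw [e]
    nlinarith [mul_nonneg h3.le hz, mul_nonneg h3.le (sq_nonneg (k : ℝ)),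
      mul_nonneg hp (mul_nonneg h3.le hz)]
  have hd : Summable fun k => u k * conj (u' k) + v k * conj (v' k)
      + ((β / γ : ℝ) : ℂ) * (θ k * conj (θ' k)) := by
    have := ((summable_mul_conj hu hu' q1).add (summable_mul_conj hv hv' q1)).add
      ((summable_mul_conj hθ hθ' q1).mul_left ((β / γ : ℝ) : ℂ))
    simpa only [one_mul] using this
  have hd2 : Summable fun k : ℕ+ => ((zsq ζ + (k : ℝ) ^ 2 * Real.pi ^ 2 / a ^ 2 : ℝ) : ℂ) *
      (u k * conj (u' k) + v k * conj (v' k) + ((β / γ : ℝ) : ℂ) * (θ k * conj (θ' k))) := by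
    refine (((summable_mul_conj hu hu' q2).add (summable_mul_conj hv hv' q2)).add
      ((summable_mul_conj hθ hθ' q2).mul_left ((β / γ : ℝ) : ℂ))).congr fun k => ?_
    ring
  have hd3 : Summable fun k => -(v k * conj (u' k)) + u k * conj (v' k) := by
    have := (summable_mul_conj hv hu' q1).neg.add (summable_mul_conj hu hv' q1)
    simpa only [one_mul] using this
  have total := ((hd.hasSum.mul_left lam).add (hd2.hasSum.mul_left (ν : ℂ))).add
    (hd3.hasSum.mul_left (α : ℂ))
  have total' := ((s1.mul_left (-Complex.I * p)).add (s2.mul_left (-Complex.I * β))).add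
    ((s3.mul_left (Complex.I * β * ζ.1)).add (s4.mul_left (Complex.I * β * ζ.2)))
  -- Mode by mode, the three equations are multiplied by `conj u'`, `conj v'` and `(β/γ) conj θ'`
  -- and added.
  have hsame : ∀ k : ℕ+, lam * (u k * conj (u' k) + v k * conj (v' k)
        + ((β / γ : ℝ) : ℂ) * (θ k * conj (θ' k)))
      + (ν : ℂ) * (((zsq ζ + (k : ℝ) ^ 2 * Real.pi ^ 2 / a ^ 2 : ℝ) : ℂ) *
        (u k * conj (u' k) + v k * conj (v' k) + ((β / γ : ℝ) : ℂ) * (θ k * conj (θ' k))))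
      + α * (-(v k * conj (u' k)) + u k * conj (v' k))
      = -Complex.I * p * (sineMean a k * hb k) + -Complex.I * β * (primCoeff a θ k * hb k)
        + (Complex.I * β * ζ.1 * (primCoeff a u k * conj (θ' k))
          + Complex.I * β * ζ.2 * (primCoeff a v k * conj (θ' k))) := by
    intro k
    have hs : symb ν a lam ζ k
        = lam + ν * ((zsq ζ + (k : ℝ) ^ 2 * Real.pi ^ 2 / a ^ 2 : ℝ) : ℂ) := by
      unfold symb; push_cast; ring
    have hbk : hb k = ζ.1 * conj (u' k) + ζ.2 * conj (v' k) := rfl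
    -- The weight `β/γ` of the temperature turns the factor `γ` of the third equation into `β`, so
    -- that both halves of the coupling carry the factor of `formB`.
    have e3' : ((β / γ : ℝ) : ℂ) * (symb ν a lam ζ k * θ k)
        = β * (Complex.I * ζ.1 * primCoeff a u k + Complex.I * ζ.2 * primCoeff a v k) := by
      push_cast
      field_simp
      linear_combination (β : ℂ) * e3 k
    rw [hs] at e3'
    have e1' := e1 k
    have e2' := e2 k
    rw [hs] at e1' e2'
    rw [hbk]
    linear_combination conj (u' k) * e1' + conj (v' k) * e2' + conj (θ' k) * e3'
  have heq := total.unique (total'.congr_fun hsame)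
  rw [sB]
  linear_combination heq

section

variable {a σ : ℝ} (lam : ℂ) (α β γ : ℝ) (ha : 0 < a) (hσ : σ < 1 / 2) (hσ' : 1 / 2 < σ + 2)
  (u v : HSob ν (σ + 2) ζ) (p : ℂ) (θ : HSob ν (σ + 2) ζ) (k : ℕ+)

/-- The coefficient formulas for the three rows serve twice: to read off the kernel equations, and
to identify the bounded operators with `opL0` and `opL1`. -/
theorem coeff_L_fst :
    ((L0 lam ζ ha hσ (u, v, p, θ) + L1 α β γ ζ ha hσ hσ' (u, v, p, θ) : RanSpace ν σ ζ).1).coeff k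
      = symb ν a lam ζ k * u.coeff k + p * (Complex.I * ζ.1 * sineMean a k)
      - α * v.coeff k + Complex.I * ζ.1 * β * primCoeff a θ.coeff k := by
  rw [L0_apply, L1_apply, Prod.fst_add]
  dsimp only
  rw [coeff_add, coeff_add, coeff_add, coeff_smul, coeff_smul, coeff_smul, coeff_smul,
    coeff_helmCLM, coeff_oneElt, coeff_incl, coeff_primCLM]
  simp only [Pi.add_apply, Pi.smul_apply, smul_eq_mul]
  ring

theorem coeff_L_snd :
    ((L0 lam ζ ha hσ (u, v, p, θ) + L1 α β γ ζ ha hσ hσ' (u, v, p, θ) : RanSpace ν σ ζ).2.1).coeff k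
      = symb ν a lam ζ k * v.coeff k + p * (Complex.I * ζ.2 * sineMean a k)
      + α * u.coeff k + Complex.I * ζ.2 * β * primCoeff a θ.coeff k := by
  rw [L0_apply, L1_apply, Prod.snd_add, Prod.fst_add]
  dsimp only
  rw [coeff_add, coeff_add, coeff_add, coeff_smul, coeff_smul, coeff_smul, coeff_smul,
    coeff_helmCLM, coeff_oneElt, coeff_incl, coeff_primCLM]
  simp only [Pi.add_apply, Pi.smul_apply, smul_eq_mul]
  ring

theorem coeff_L_trd :
    ((L0 lam ζ ha hσ (u, v, p, θ) + L1 α β γ ζ ha hσ hσ' (u, v, p, θ) : RanSpace ν σ ζ).2.2).coeff k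
      = symb ν a lam ζ k * θ.coeff k - γ * Complex.I * ζ.1 * primCoeff a u.coeff k
      - γ * Complex.I * ζ.2 * primCoeff a v.coeff k := by
  rw [L0_apply, L1_apply, Prod.snd_add, Prod.snd_add]
  simp only [coeff_add, coeff_sub, coeff_smul, coeff_helmCLM, coeff_primCLM, Pi.add_apply,
    Pi.sub_apply, Pi.smul_apply, smul_eq_mul]
  ring

end

/-- The kernel of `𝓛` is trivial if `lam` is not an eigenvalue. -/
theorem eq_zero_of_kernel {a α β γ σ c : ℝ} {lam : ℂ} (ha : 0 < a) (hσ : σ < 1 / 2)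
    (hσ' : 1 / 2 < σ + 2) (hc : 0 < c) (h : ∀ k, c * weight ν ζ k ≤ ‖symb ν a lam ζ k‖)
    (hβγ : 0 < β * γ) (hζ : ζ ≠ 0) (hlam : lam ∉ eigenvaluesP ν a α β γ) (x : DomSpace ν σ ζ)
    (hx : x ∈ Dom ν a (σ + 2) ζ)
    (h0 : L0 lam ζ ha hσ x + L1 α β γ ζ ha hσ hσ' x = (0 : RanSpace ν σ ζ)) : x = 0 := by
  obtain ⟨u, v, p, θ⟩ := x
  have hsy := symb_ne_zero hc h
  have e1 : ∀ k, symb ν a lam ζ k * u.coeff k + p * (Complex.I * ζ.1 * sineMean a k)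
      - α * v.coeff k + Complex.I * ζ.1 * β * primCoeff a θ.coeff k = 0 := fun k => by
    have e := coeff_L_fst lam α β γ ha hσ hσ' u v p θ k
    rw [h0, Prod.fst_zero, coeff_zero, Pi.zero_apply] at e
    exact e.symm
  have e2 : ∀ k, symb ν a lam ζ k * v.coeff k + p * (Complex.I * ζ.2 * sineMean a k)
      + α * u.coeff k + Complex.I * ζ.2 * β * primCoeff a θ.coeff k = 0 := fun k => by
    have e := coeff_L_snd lam α β γ ha hσ hσ' u v p θ k
    rw [h0, Prod.snd_zero, Prod.fst_zero, coeff_zero, Pi.zero_apply] at e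
    exact e.symm
  have e3 : ∀ k, symb ν a lam ζ k * θ.coeff k - γ * Complex.I * ζ.1 * primCoeff a u.coeff k
      - γ * Complex.I * ζ.2 * primCoeff a v.coeff k = 0 := fun k => by
    have e := coeff_L_trd lam α β γ ha hσ hσ' u v p θ k
    rw [h0, Prod.snd_zero, Prod.snd_zero, coeff_zero, Pi.zero_apply] at e
    exact e.symm
  have lu := summable_norm_coeff hσ' u
  have lv := summable_norm_coeff hσ' v
  have lθ := summable_norm_coeff hσ' θ
  have hm : sineMean a ∈ sobSubmodule ν 0 ζ := sineMean_mem ha (by norm_num)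
  have hPu : primCoeff a u.coeff ∈ sobSubmodule ν 0 ζ := primCoeff_mem ha (by norm_num) lu
  have hPv : primCoeff a v.coeff ∈ sobSubmodule ν 0 ζ := primCoeff_mem ha (by norm_num) lv
  have hPθ : primCoeff a θ.coeff ∈ sobSubmodule ν 0 ζ := primCoeff_mem ha (by norm_num) lθ
  have hu0 : u.coeff ∈ sobSubmodule ν 0 ζ := mem_sob_mono (by linarith) u.coeff_mem
  have hv0 : v.coeff ∈ sobSubmodule ν 0 ζ := mem_sob_mono (by linarith) v.coeff_mem
  -- Bootstrap: `H^{σ+2}` need not lie in `H¹`, as eigenfunctions must. But for a kernel element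
  -- `symb * f` is a combination of terms in `H⁰`, so `f` lies in `H² ⊂ H¹`.
  have reg : ∀ {f G : ℕ+ → ℂ}, G ∈ sobSubmodule ν 0 ζ → (∀ k, symb ν a lam ζ k * f k = G k) →
      f ∈ sobSubmodule ν 1 ζ := by
    intro f G hG hf
    have hf' : f = fun k => (symb ν a lam ζ k)⁻¹ * G k := funext fun k => by
      rw [← hf k, inv_mul_cancel_left₀ (hsy k)]
    rw [hf']
    exact mem_sob_mono (by norm_num) (mem_sob_of_le (s := 0 + 2) hG (inv_symb_weighted_le hc h G))
  have hu : u.coeff ∈ sobSubmodule ν 1 ζ :=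
    reg (Submodule.sub_mem _ (Submodule.sub_mem _ (Submodule.smul_mem _ (α : ℂ) hv0)
      (Submodule.smul_mem _ (p * (Complex.I * ζ.1)) hm))
      (Submodule.smul_mem _ (Complex.I * ζ.1 * β) hPθ)) fun k => by
        simp only [Pi.sub_apply, Pi.smul_apply, smul_eq_mul]
        linear_combination e1 k
  have hv : v.coeff ∈ sobSubmodule ν 1 ζ :=
    reg (Submodule.sub_mem _ (Submodule.sub_mem _ (Submodule.smul_mem _ (-α : ℂ) hu0)
      (Submodule.smul_mem _ (p * (Complex.I * ζ.2)) hm))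
      (Submodule.smul_mem _ (Complex.I * ζ.2 * β) hPθ)) fun k => by
        simp only [Pi.sub_apply, Pi.smul_apply, smul_eq_mul]
        linear_combination e2 k
  have hθ : θ.coeff ∈ sobSubmodule ν 1 ζ :=
    reg (Submodule.add_mem _ (Submodule.smul_mem _ (γ * Complex.I * ζ.1) hPu)
      (Submodule.smul_mem _ (γ * Complex.I * ζ.2) hPv)) fun k => by
        simp only [Pi.add_apply, Pi.smul_apply, smul_eq_mul]
        linear_combination e3 k
  have hzero : u.coeff = 0 ∧ v.coeff = 0 ∧ θ.coeff = 0 := by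
    by_contra hne
    -- The candidate eigenfunction has `ζ` as its only horizontal mode, so every form reduces to its
    -- `ζ`-part and the constraint is trivial in the other modes.
    refine hlam ⟨(Pi.single ζ u.coeff, Pi.single ζ v.coeff, Pi.single ζ θ.coeff),
      ⟨memH1_single hu, memH1_single hv, memH1_single hθ, fun ζ' => ?_⟩, fun hX => hne ?_,
      fun X' hX' => ?_⟩
    · by_cases hζ' : ζ' = ζ
      · subst hζ'
        simp only [Pi.single_eq_same, mul_assoc, ← mul_add]
        rw [intervalIntegral.integral_const_mul]
        exact mul_eq_zero_of_right _ hx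
      · simp [hζ']
    · simp only [Prod.mk_eq_zero, Pi.single_eq_zero_iff] at hX
      exact hX
    · have key := weak_form_of_kernel (α := α) hβγ hu hv hθ (mem_sob_one_of_memH1 hX'.1 ζ)
        (mem_sob_one_of_memH1 hX'.2.1 ζ) (mem_sob_one_of_memH1 hX'.2.2.1 ζ) e1 e2 e3 (by
          unfold vertVel; rw [hX'.2.2.2 ζ, neg_zero])
      have hH : innerH β γ (Pi.single ζ u.coeff, Pi.single ζ v.coeff, Pi.single ζ θ.coeff) X'
          = ∑' k, (u.coeff k * conj (X'.1 ζ k) + v.coeff k * conj (X'.2.1 ζ k)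
            + ((β / γ : ℝ) : ℂ) * (θ.coeff k * conj (X'.2.2 ζ k))) := by
        unfold innerH
        rw [tsum_eq_tsum_mode (ζ := ζ)]
        · simp [density]
        · intro q hq; simp [density, hq]
      have hV : innerV a β γ (Pi.single ζ u.coeff, Pi.single ζ v.coeff, Pi.single ζ θ.coeff) X'
          = ∑' k : ℕ+, ((zsq ζ + (k : ℝ) ^ 2 * Real.pi ^ 2 / a ^ 2 : ℝ) : ℂ) *
            (u.coeff k * conj (X'.1 ζ k) + v.coeff k * conj (X'.2.1 ζ k)
            + ((β / γ : ℝ) : ℂ) * (θ.coeff k * conj (X'.2.2 ζ k))) := by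
        unfold innerV
        rw [tsum_eq_tsum_mode (ζ := ζ)]
        · simp [density]
        · intro q hq; simp [density, hq]
      have hCc : formC (Pi.single ζ u.coeff, Pi.single ζ v.coeff, Pi.single ζ θ.coeff) X'
          = ∑' k, (-(v.coeff k * conj (X'.1 ζ k)) + u.coeff k * conj (X'.2.1 ζ k)) := by
        unfold formC
        rw [tsum_eq_tsum_mode (ζ := ζ)]
        · simp
        · intro q hq; simp [hq]
      have hB : formB a (Pi.single ζ u.coeff, Pi.single ζ v.coeff, Pi.single ζ θ.coeff) X'
          = ∫ z in (0 : ℝ)..a, (-(toFunction a θ.coeff z * conj (vertVel a ζ (X'.1 ζ) (X'.2.1 ζ) z))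
            + vertVel a ζ u.coeff v.coeff z * conj (toFunction a (X'.2.2 ζ) z)) := by
        unfold formB
        rw [tsum_eq_single ζ]
        · simp
        · intro ζ' hζ'
          simp [hζ', vertVel]
      rw [hH, hV, hCc, hB]
      exact key
  -- Only `p ζ_i c_1 = 0` is left of the first two equations at `k = 1`; some `ζ_i` is nonzero, and
  -- so is `c_1`.
  have hp : p = 0 := by
    have hm1 := sineMean_one_ne_zero ha
    have e1' := e1 1
    have e2' := e2 1
    have hP0 : primCoeff a 0 1 = 0 := by
      have := congrFun (primCoeff_smul a 0 0) 1
      simpa using this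
    rw [hzero.1, hzero.2.1, hzero.2.2, hP0] at e1' e2'
    simp only [Pi.zero_apply, mul_zero, zero_add, sub_zero, add_zero, mul_eq_zero,
      Complex.I_ne_zero, hm1, or_false, false_or, Int.cast_eq_zero] at e1' e2'
    by_contra hp
    exact hζ (Prod.ext (e1'.resolve_left hp) (e2'.resolve_left hp))
  rw [show u = 0 from ext_coeff hzero.1, show v = 0 from ext_coeff hzero.2.1,
    show θ = 0 from ext_coeff hzero.2.2, hp]
  rfl

end PrimEq

end

noncomputable section

namespace PrimEq

open HSob

/-! ### Uniform bounds for the symbol -/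

theorem japZ_sq_le_japOmegaSq (lam : ℂ) (ζ : ℤ × ℤ) : japZ ζ ^ 2 ≤ japOmegaSq lam ζ := by
  unfold japOmegaSq; linarith [norm_nonneg lam]

theorem one_le_japOmegaSq (lam : ℂ) (ζ : ℤ × ℤ) : 1 ≤ japOmegaSq lam ζ :=
  (one_le_pow₀ (one_le_japZ ζ)).trans (japZ_sq_le_japOmegaSq lam ζ)

/-- Reality of `c_k` is what makes `c_k² ≥ 0` and excludes cancellation in the pressure determinant.
-/
theorem sineMean_eq_ofReal (a : ℝ) (k : ℕ+) :
    sineMean a k = ((∫ z in (0 : ℝ)..a, sineFun a k z : ℝ) : ℂ) := by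
  unfold sineMean sineCoeff
  rw [← intervalIntegral.integral_ofReal]
  simp

/-- The symbols with `lam ∈ 𝕊` lie in a half plane, with room to spare. -/
theorem exists_sector_bound {ν a δ₁ δ₂ : ℝ} (hν : 0 < ν) (ha : 0 < a) (hδ₁ : 0 < δ₁)
    (hδ₂ : δ₂ < ν / 2) : ∃ c : ℝ, 0 < c ∧ ∀ lam ∈ setS δ₁ δ₂, ∀ ζ : ℤ × ℤ, ζ ≠ 0 →
      ∃ κ : ℂ, ‖κ‖ ≤ 2 + δ₁ ∧ ∀ k : ℕ+, c * ((k : ℝ) ^ 2 + japOmegaSq lam ζ)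
        ≤ (κ * conj (symb ν a lam ζ k)).re := by
  have hpa : 0 < ν * Real.pi ^ 2 / a ^ 2 := by have := Real.pi_pos; positivity
  set c₁ : ℝ := 1 / (1 + δ₁) with hc₁
  set c₂ : ℝ := min (ν / 2) (ν * Real.pi ^ 2 / a ^ 2) / (3 + |δ₂|) with hc₂
  have hc₁0 : 0 < c₁ := by positivity
  have hc₂0 : 0 < c₂ := div_pos (lt_min (by linarith) hpa) (by positivity)
  refine ⟨min c₁ c₂, lt_min hc₁0 hc₂0, ?_⟩
  rintro lam ⟨μ₁, μ₂, hμ, rfl⟩ ζ hζ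
  have hμ' : μ₁ ≤ δ₁ * |μ₂| := by
    rwa [one_div, inv_mul_le_iff₀ hδ₁] at hμ
  set s : ℝ := if 0 ≤ μ₂ then 1 else -1 with hs
  have hsμ : s * μ₂ = |μ₂| := by
    rw [hs]; split_ifs with h
    · rw [one_mul, abs_of_nonneg h]
    · rw [abs_of_neg (not_le.1 h)]; ring
  have hs1 : |s| = 1 := by rw [hs]; split_ifs <;> simp
  -- `κ = 1 ± i(δ₁ + 1)`, with the sign of `Im λ`, is the normal of the half plane; it is the same
  -- for all `k`. The imaginary part of the symbol then contributes `(δ₁ + 1)|μ₂|`, which outweighs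
  -- `-μ₁ ≥ -δ₁|μ₂|` with `|μ₂|` to spare.
  refine ⟨⟨1, s * (δ₁ + 1)⟩, ?_, fun k => ?_⟩
  · refine (Complex.norm_le_abs_re_add_abs_im _).trans ?_
    rw [abs_mul, hs1, abs_one, one_mul, abs_of_pos (by linarith)]
    linarith
  have hk := one_le_pow₀ (one_le_pnat_cast k) (n := 2)
  have hz := one_le_zsq hζ
  have hre : ((⟨1, s * (δ₁ + 1)⟩ : ℂ) * conj (symb ν a (-(δ₂ : ℂ) - (μ₁ : ℂ) + Complex.I * (μ₂ : ℂ)) ζ k)).re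
      = (-δ₂ + ν * zsq ζ + ν * (k : ℝ) ^ 2 * Real.pi ^ 2 / a ^ 2) + (-μ₁ + (δ₁ + 1) * |μ₂|) := by
    rw [← hsμ, Complex.mul_re, Complex.conj_re, Complex.conj_im]
    have h1 : (symb ν a (-(δ₂ : ℂ) - (μ₁ : ℂ) + Complex.I * (μ₂ : ℂ)) ζ k).re
        = -δ₂ - μ₁ + ν * zsq ζ + ν * (k : ℝ) ^ 2 * Real.pi ^ 2 / a ^ 2 := by
      unfold symb
      rw [Complex.add_re, Complex.add_re, Complex.ofReal_re, Complex.ofReal_re]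
      simp
    have h2 : (symb ν a (-(δ₂ : ℂ) - (μ₁ : ℂ) + Complex.I * (μ₂ : ℂ)) ζ k).im = μ₂ := by
      unfold symb
      rw [Complex.add_im, Complex.add_im, Complex.ofReal_im, Complex.ofReal_im]
      simp
    rw [h1, h2]
    ring
  rw [hre]
  have hJ : (k : ℝ) ^ 2 + japOmegaSq (-(δ₂ : ℂ) - (μ₁ : ℂ) + Complex.I * (μ₂ : ℂ)) ζ
      ≤ (|μ₁| + |μ₂|) + (3 + |δ₂|) * ((k : ℝ) ^ 2 + zsq ζ) := by
    have h1 : ‖-(δ₂ : ℂ) - (μ₁ : ℂ) + Complex.I * (μ₂ : ℂ)‖ ≤ |δ₂| + |μ₁| + |μ₂| := by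
      refine (norm_add_le _ _).trans (add_le_add ((norm_sub_le _ _).trans (le_of_eq ?_)) (le_of_eq ?_))
      · simp
      · simp
    have h2 := japZ_sq_le ζ
    unfold japOmegaSq
    nlinarith [abs_nonneg δ₂, mul_nonneg (abs_nonneg δ₂) (zsq_nonneg ζ),
      mul_nonneg (abs_nonneg δ₂) (sub_nonneg.2 hk)]
  -- For `μ₁ ≥ 0` the spare `|μ₂|` controls `μ₁` as well, since `|μ₁| + |μ₂| ≤ (1 + δ₁)|μ₂|`; this
  -- fixes `c₁`.
  have hA : c₁ * (|μ₁| + |μ₂|) ≤ -μ₁ + (δ₁ + 1) * |μ₂| := by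
    rw [hc₁, one_div, inv_mul_le_iff₀ (by linarith)]
    have h2 := abs_nonneg μ₂
    rcases le_total 0 μ₁ with h | h
    · rw [abs_of_nonneg h]
      nlinarith [mul_nonneg hδ₁.le h2, mul_nonneg hδ₁.le (sub_nonneg.2 hμ')]
    · rw [abs_of_nonpos h]
      nlinarith [mul_nonneg hδ₁.le h2, mul_nonneg hδ₁.le (neg_nonneg.2 h),
        mul_nonneg (mul_nonneg hδ₁.le hδ₁.le) h2]
  -- Since `|ζ|² ≥ 1` and `δ₂ < ν/2`, half of `ν|ζ|²` absorbs `-δ₂`.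
  have hB : c₂ * ((3 + |δ₂|) * ((k : ℝ) ^ 2 + zsq ζ))
      ≤ -δ₂ + ν * zsq ζ + ν * (k : ℝ) ^ 2 * Real.pi ^ 2 / a ^ 2 := by
    have h3 : (0 : ℝ) < 3 + |δ₂| := by positivity
    rw [hc₂, ← mul_assoc, div_mul_cancel₀ _ h3.ne', mul_add]
    have h1 : min (ν / 2) (ν * Real.pi ^ 2 / a ^ 2) * (k : ℝ) ^ 2
        ≤ ν * Real.pi ^ 2 / a ^ 2 * (k : ℝ) ^ 2 :=
      mul_le_mul_of_nonneg_right (min_le_right _ _) (by positivity)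
    have h2 : min (ν / 2) (ν * Real.pi ^ 2 / a ^ 2) * zsq ζ ≤ ν / 2 * zsq ζ :=
      mul_le_mul_of_nonneg_right (min_le_left _ _) (zsq_nonneg ζ)
    have h4 : ν * Real.pi ^ 2 / a ^ 2 * (k : ℝ) ^ 2 = ν * (k : ℝ) ^ 2 * Real.pi ^ 2 / a ^ 2 := by ring
    nlinarith
  calc min c₁ c₂ * ((k : ℝ) ^ 2 + japOmegaSq (-(δ₂ : ℂ) - (μ₁ : ℂ) + Complex.I * (μ₂ : ℂ)) ζ)
      ≤ min c₁ c₂ * ((|μ₁| + |μ₂|) + (3 + |δ₂|) * ((k : ℝ) ^ 2 + zsq ζ)) :=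
        mul_le_mul_of_nonneg_left hJ (lt_min hc₁0 hc₂0).le
    _ = min c₁ c₂ * (|μ₁| + |μ₂|) + min c₁ c₂ * ((3 + |δ₂|) * ((k : ℝ) ^ 2 + zsq ζ)) := by ring
    _ ≤ c₁ * (|μ₁| + |μ₂|) + c₂ * ((3 + |δ₂|) * ((k : ℝ) ^ 2 + zsq ζ)) := by
        have := zsq_nonneg ζ
        exact add_le_add (mul_le_mul_of_nonneg_right (min_le_left _ _) (by positivity))
          (mul_le_mul_of_nonneg_right (min_le_right _ _) (by positivity))
    _ ≤ _ := by linarith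

theorem norm_symb_le_japOmegaSq {ν : ℝ} (hν : 0 < ν) (a : ℝ) (lam : ℂ) (ζ : ℤ × ℤ) (k : ℕ+) :
    ‖symb ν a lam ζ k‖ ≤ (1 + ν + ν * Real.pi ^ 2 / a ^ 2) * ((k : ℝ) ^ 2 + japOmegaSq lam ζ) := by
  have hz := mul_nonneg hν.le (zsq_nonneg ζ)
  have h1 : ‖((ν * zsq ζ : ℝ) : ℂ)‖ = ν * zsq ζ := by
    rw [Complex.norm_real, Real.norm_of_nonneg hz]
  have h2 : ‖((ν * (k : ℝ) ^ 2 * Real.pi ^ 2 / a ^ 2 : ℝ) : ℂ)‖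
      = (ν * Real.pi ^ 2 / a ^ 2) * (k : ℝ) ^ 2 := by
    rw [Complex.norm_real, Real.norm_of_nonneg (by positivity)]; ring
  unfold symb
  refine (norm_add₃_le).trans ?_
  rw [h1, h2]
  have h3 := zsq_le_japZ_sq ζ
  have hp : 0 ≤ ν * Real.pi ^ 2 / a ^ 2 := by positivity
  have hJ : ‖lam‖ + japZ ζ ^ 2 = japOmegaSq lam ζ := rfl
  have hJ1 := one_le_japOmegaSq lam ζ
  have hl := norm_nonneg lam
  have e1 : ‖lam‖ ≤ japOmegaSq lam ζ := by nlinarith [sq_nonneg (japZ ζ)]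
  have e2 : zsq ζ ≤ japOmegaSq lam ζ := by linarith
  nlinarith [mul_le_mul_of_nonneg_left e2 hν.le, mul_nonneg hν.le (sq_nonneg (k : ℝ)),
    mul_nonneg hp (zero_le_one.trans hJ1), sq_nonneg (k : ℝ)]

/-- Uniform bounds from below for the symbol and for the determinant of the pressure problem. -/
theorem exists_symbol_bounds {ν a δ₁ δ₂ : ℝ} (hν : 0 < ν) (ha : 0 < a) (hδ₁ : 0 < δ₁)
    (hδ₂ : δ₂ < ν / 2) : ∃ c : ℝ, 0 < c ∧ ∀ lam ∈ setS δ₁ δ₂, ∀ ζ : ℤ × ℤ, ζ ≠ 0 →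
      (∀ k : ℕ+, c * ((k : ℝ) ^ 2 + japOmegaSq lam ζ) ≤ ‖symb ν a lam ζ k‖) ∧
      c ≤ japOmegaSq lam ζ *
        ‖∑' k, sineMean a k * ((symb ν a lam ζ k)⁻¹ * sineMean a k)‖ := by
  obtain ⟨c, hc, h⟩ := exists_sector_bound hν ha hδ₁ hδ₂
  set B : ℝ := 1 + ν + ν * Real.pi ^ 2 / a ^ 2 with hB
  have hB0 : 0 < B := by positivity
  set m₁ : ℝ := ∫ z in (0 : ℝ)..a, sineFun a 1 z with hm₁
  have hm₁0 : m₁ ≠ 0 := by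
    have := sineMean_one_ne_zero ha
    rw [sineMean_eq_ofReal] at this
    exact Complex.ofReal_ne_zero.1 this
  -- The term `k = 1` alone contributes at least `d/⟨ω⟩²`: there `Re(κ conj symb) ≥ c⟨ω⟩²` and
  -- `|symb| ≤ 2B⟨ω⟩²`.
  set d : ℝ := m₁ ^ 2 * c / (4 * B ^ 2) with hd
  have hd0 : 0 < d := by positivity
  refine ⟨min (c / (2 + δ₁)) (d / (2 + δ₁)), lt_min (by positivity) (by positivity), ?_⟩
  intro lam hlam ζ hζ
  obtain ⟨κ, hκ, hk⟩ := h lam hlam ζ hζ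
  have hJ := one_le_japOmegaSq lam ζ
  have hQ : ∀ k : ℕ+, 0 < (k : ℝ) ^ 2 + japOmegaSq lam ζ := fun k => by positivity
  have hlow : ∀ k : ℕ+, c / (2 + δ₁) * ((k : ℝ) ^ 2 + japOmegaSq lam ζ) ≤ ‖symb ν a lam ζ k‖ := by
    intro k
    rw [div_mul_eq_mul_div, div_le_iff₀ (by linarith)]
    calc _ ≤ (κ * conj (symb ν a lam ζ k)).re := hk k
      _ ≤ ‖κ * conj (symb ν a lam ζ k)‖ := Complex.re_le_norm _
      _ = ‖κ‖ * ‖symb ν a lam ζ k‖ := by rw [norm_mul, RCLike.norm_conj]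
      _ ≤ (2 + δ₁) * ‖symb ν a lam ζ k‖ := mul_le_mul_of_nonneg_right hκ (norm_nonneg _)
      _ = _ := mul_comm _ _
  have hpos : ∀ k : ℕ+, 0 < ‖symb ν a lam ζ k‖ := fun k =>
    (mul_pos (by positivity) (hQ k)).trans_le (hlow k)
  refine ⟨fun k => (mul_le_mul_of_nonneg_right (min_le_left _ _) (hQ k).le).trans (hlow k), ?_⟩
  set T : ℕ+ → ℂ := fun k => sineMean a k * ((symb ν a lam ζ k)⁻¹ * sineMean a k) with hT
  -- Since `1/symb = conj symb / |symb|²`, the half plane condition passes to the terms of the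
  -- determinant.
  have hTre : ∀ k, (κ * T k).re = (∫ z in (0 : ℝ)..a, sineFun a k z) ^ 2 *
      ((κ * conj (symb ν a lam ζ k)).re / ‖symb ν a lam ζ k‖ ^ 2) := by
    intro k
    have e : κ * T k = (((∫ z in (0 : ℝ)..a, sineFun a k z) ^ 2 / ‖symb ν a lam ζ k‖ ^ 2 : ℝ) : ℂ)
        * (κ * conj (symb ν a lam ζ k)) := by
      simp only [hT]
      rw [sineMean_eq_ofReal, Complex.inv_def, Complex.normSq_eq_norm_sq]
      push_cast
      ring
    rw [e, Complex.re_ofReal_mul]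
    ring
  have hTnn : ∀ k, 0 ≤ (κ * T k).re := fun k => by
    rw [hTre]
    have := (mul_nonneg hc.le (hQ k).le).trans (hk k)
    positivity
  have hTs : Summable T := by
    refine Summable.of_norm_bounded (g := fun k : ℕ+ => (decayConst a ^ 2 * (c / (2 + δ₁))⁻¹) *
      ((k : ℝ) ^ 2)⁻¹) (summable_inv_pnat_sq.mul_left _) fun k => ?_
    have h1 := norm_sineMean_le_decayConst ha k
    have h2 : ‖symb ν a lam ζ k‖⁻¹ ≤ (c / (2 + δ₁))⁻¹ := by
      refine inv_anti₀ (by positivity) (le_trans ?_ (hlow k))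
      refine le_mul_of_one_le_right (by positivity) ?_
      nlinarith [sq_nonneg (k : ℝ)]
    simp only [hT]
    rw [norm_mul, norm_mul, norm_inv]
    have h0 := decayConst_pos ha
    have hk0 := pnat_cast_pos k
    calc _ ≤ (decayConst a * (k : ℝ)⁻¹) * ((c / (2 + δ₁))⁻¹ * (decayConst a * (k : ℝ)⁻¹)) := by
          gcongr
      _ = _ := by ring
  have hT1 : d / japOmegaSq lam ζ ≤ (κ * T 1).re := by
    have hk1 := hk 1
    have hs1 := norm_symb_le_japOmegaSq hν a lam ζ 1
    simp only [PNat.one_coe, Nat.cast_one, one_pow] at hk1 hs1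
    have hs2 : ‖symb ν a lam ζ 1‖ ≤ B * (2 * japOmegaSq lam ζ) :=
      hs1.trans (mul_le_mul_of_nonneg_left (by linarith) hB0.le)
    have hs3 := pow_le_pow_left₀ (norm_nonneg _) hs2 2
    have hJ0 : 0 < japOmegaSq lam ζ := by linarith
    rw [hTre, ← hm₁, hd]
    have h5 : c * japOmegaSq lam ζ ≤ (κ * conj (symb ν a lam ζ 1)).re := by nlinarith
    calc m₁ ^ 2 * c / (4 * B ^ 2) / japOmegaSq lam ζ
        = m₁ ^ 2 * (c * japOmegaSq lam ζ / (B * (2 * japOmegaSq lam ζ)) ^ 2) := by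
          field_simp; ring
      _ ≤ _ := by
          refine mul_le_mul_of_nonneg_left ?_ (sq_nonneg _)
          have := hpos 1
          exact div_le_div₀ ((mul_pos hc hJ0).le.trans h5) h5 (by positivity) hs3
  -- All terms have nonnegative real part after multiplication by `κ`, so the sum dominates its
  -- first term.
  have hsum : (κ * T 1).re ≤ (κ * ∑' k, T k).re := by
    rw [← tsum_mul_left, Complex.re_tsum (hTs.mul_left κ)]
    exact (Complex.reCLM.summable (hTs.mul_left κ)).le_tsum 1 fun j _ => hTnn j
  have hfin : d / japOmegaSq lam ζ ≤ (2 + δ₁) * ‖∑' k, T k‖ := by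
    calc _ ≤ (κ * ∑' k, T k).re := hT1.trans hsum
      _ ≤ ‖κ * ∑' k, T k‖ := Complex.re_le_norm _
      _ = ‖κ‖ * ‖∑' k, T k‖ := norm_mul _ _
      _ ≤ _ := mul_le_mul_of_nonneg_right hκ (norm_nonneg _)
  refine (min_le_right _ _).trans ?_
  rw [div_le_iff₀ (by linarith)] at hfin ⊢
  linarith

/-! ### The sums `M_s` -/

/-- The terms of the sum `M_s²`. -/
def bigMTerm (s : ℝ) (lam : ℂ) (ζ : ℤ × ℤ) (k : ℕ+) : ℝ :=
  1 / ((k : ℝ) ^ 2 * ((k : ℝ) ^ 4 + japOmegaSq lam ζ ^ 2) * ((k : ℝ) ^ 2 + japZ ζ ^ 2) ^ s)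

theorem bigM_eq (s : ℝ) (lam : ℂ) (ζ : ℤ × ℤ) :
    bigM s lam ζ = Real.sqrt (∑' k, bigMTerm s lam ζ k) := rfl

theorem bigMTerm_pos (s : ℝ) (lam : ℂ) (ζ : ℤ × ℤ) (k : ℕ+) : 0 < bigMTerm s lam ζ k := by
  have hk := pnat_cast_pos k
  have hW := Real.rpow_pos_of_pos (japWeight_pos ζ k) s
  unfold japWeight at hW
  unfold bigMTerm
  positivity

theorem bigMTerm_eq (s : ℝ) (lam : ℂ) (ζ : ℤ × ℤ) (k : ℕ+) : bigMTerm s lam ζ k =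
    japWeight ζ k ^ (-s) * (((k : ℝ) ^ 2)⁻¹ * ((k : ℝ) ^ 4 + japOmegaSq lam ζ ^ 2)⁻¹) := by
  unfold bigMTerm
  rw [Real.rpow_neg (japWeight_pos ζ k).le, one_div, mul_inv, mul_inv, mul_comm]
  rfl

/-- `M_s` is defined with `k⁴ + ⟨ω⟩⁴`, while the symbol is compared with `k² + ⟨ω⟩²`; this bound and
the next exchange the former for the square of the latter. -/
theorem inv_quartic_le (lam : ℂ) (ζ : ℤ × ℤ) (k : ℕ+) :
    ((k : ℝ) ^ 4 + japOmegaSq lam ζ ^ 2)⁻¹ ≤ 2 * (((k : ℝ) ^ 2 + japOmegaSq lam ζ) ^ 2)⁻¹ := by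
  have hJ := one_le_japOmegaSq lam ζ
  have hk := pnat_cast_pos k
  have h1 : 0 < (k : ℝ) ^ 4 + japOmegaSq lam ζ ^ 2 := by positivity
  have h2 : 0 < ((k : ℝ) ^ 2 + japOmegaSq lam ζ) ^ 2 := by positivity
  rw [← div_eq_mul_inv, inv_eq_one_div, div_le_div_iff₀ h1 h2]
  nlinarith [sq_nonneg ((k : ℝ) ^ 2 - japOmegaSq lam ζ)]

theorem quartic_le (lam : ℂ) (ζ : ℤ × ℤ) (k : ℕ+) :
    (k : ℝ) ^ 4 + japOmegaSq lam ζ ^ 2 ≤ ((k : ℝ) ^ 2 + japOmegaSq lam ζ) ^ 2 := by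
  have hJ := one_le_japOmegaSq lam ζ
  nlinarith [mul_nonneg (sq_nonneg (k : ℝ)) (zero_le_one.trans hJ)]

theorem summable_bigMTerm {s : ℝ} (hs : -(5 / 2) < s) (lam : ℂ) (ζ : ℤ × ℤ) :
    Summable (bigMTerm s lam ζ) := by
  -- A negative `s` costs at most `k^{2q}`, by `k² + ⟨ζ⟩² ≤ 2k²⟨ζ⟩²`. What remains is `k^{2q-6}`,
  -- summable since `q < 5/2`.
  set q : ℝ := max (-s) 0 with hq
  have hq1 : q < 5 / 2 := max_lt (by linarith) (by norm_num)
  refine Summable.of_nonneg_of_le (fun k => (bigMTerm_pos s lam ζ k).le) (fun k => ?_)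
    ((summable_pnat_rpow_neg (p := 6 - 2 * q) (by linarith)).mul_left ((2 * japZ ζ ^ 2) ^ q))
  have hk := pnat_cast_pos k
  have hk1 := one_le_pow₀ (one_le_pnat_cast k) (n := 2)
  have hz1 := one_le_pow₀ (one_le_japZ ζ) (n := 2)
  have h1 : japWeight ζ k ^ (-s) ≤ (2 * japZ ζ ^ 2) ^ q * ((k : ℝ) ^ 2) ^ q := by
    rw [← Real.mul_rpow (by positivity) (by positivity)]
    refine (Real.rpow_le_rpow_of_exponent_le (one_le_japWeight ζ k) (le_max_left (-s) 0)).trans ?_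
    refine Real.rpow_le_rpow (japWeight_pos ζ k).le ?_ (le_max_right _ _)
    unfold japWeight
    nlinarith [mul_nonneg (sub_nonneg.2 hk1) (sub_nonneg.2 hz1)]
  have h2 : ((k : ℝ) ^ 4 + japOmegaSq lam ζ ^ 2)⁻¹ ≤ ((k : ℝ) ^ 4)⁻¹ :=
    inv_anti₀ (by positivity) (by nlinarith [sq_nonneg (japOmegaSq lam ζ)])
  have h3 : (k : ℝ) ^ (-(6 - 2 * q)) = ((k : ℝ) ^ 2) ^ q * (((k : ℝ) ^ 2)⁻¹ * ((k : ℝ) ^ 4)⁻¹) := by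
    rw [← mul_inv, ← pow_add, ← Real.rpow_natCast (k : ℝ) 2, ← Real.rpow_mul hk.le,
      ← Real.rpow_natCast (k : ℝ) (2 + 4), ← Real.rpow_neg hk.le, ← Real.rpow_add hk]
    congr 1
    push_cast; ring
  rw [bigMTerm_eq, h3, ← mul_assoc ((2 * japZ ζ ^ 2) ^ q)]
  gcongr

theorem bigM_pos {s : ℝ} (hs : -(5 / 2) < s) (lam : ℂ) (ζ : ℤ × ℤ) : 0 < bigM s lam ζ := by
  rw [bigM_eq]
  exact Real.sqrt_pos.2 ((summable_bigMTerm hs lam ζ).tsum_pos (fun k => (bigMTerm_pos s lam ζ k).le) 1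
    (bigMTerm_pos s lam ζ 1))

/-- The exponent of decay `min(1, σ + 2)`. -/
theorem japZ_rpow_mul_japWeight_le (σ : ℝ) (lam : ℂ) (ζ : ℤ × ℤ) (k : ℕ+) :
    (japZ ζ ^ (1 + σ)) ^ 2 * japWeight ζ k ^ (-σ)
      ≤ ((k : ℝ) ^ 2 + japOmegaSq lam ζ) ^ (2 - min 1 (σ + 2)) := by
  have hz := one_le_japZ ζ
  have hz0 : 0 < japZ ζ := by linarith
  have hW := one_le_japWeight ζ k
  have hW0 := japWeight_pos ζ k
  have hWQ : japWeight ζ k ≤ (k : ℝ) ^ 2 + japOmegaSq lam ζ := by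
    unfold japWeight; linarith [japZ_sq_le_japOmegaSq lam ζ]
  have hzs : (japZ ζ ^ (1 + σ)) ^ 2 = (japZ ζ ^ 2) ^ (1 + σ) := by
    rw [← Real.rpow_natCast, ← Real.rpow_natCast, ← Real.rpow_mul hz0.le, ← Real.rpow_mul hz0.le,
      mul_comm]
  rw [hzs]
  have hWs : 0 ≤ japWeight ζ k ^ (-σ) := Real.rpow_nonneg hW0.le _
  -- For `σ ≥ -1` the power of `⟨ζ⟩²` is absorbed by that of `k² + ⟨ζ⟩²`, with exponent `1` left
  -- over; for `σ ≤ -1` it is at most one and `-σ` is left.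
  rcases le_total (-1) σ with h | h
  · rw [min_eq_left (by linarith), show (2 : ℝ) - 1 = 1 by norm_num, Real.rpow_one]
    have h1 : (japZ ζ ^ 2) ^ (1 + σ) ≤ japWeight ζ k ^ (1 + σ) := by
      refine Real.rpow_le_rpow (by positivity) ?_ (by linarith)
      unfold japWeight; nlinarith [sq_nonneg (k : ℝ)]
    calc _ ≤ japWeight ζ k ^ (1 + σ) * japWeight ζ k ^ (-σ) := mul_le_mul_of_nonneg_right h1 hWs
      _ = japWeight ζ k := by rw [← Real.rpow_add hW0]; ring_nf; simp
      _ ≤ _ := hWQ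
  · rw [min_eq_right (by linarith), show 2 - (σ + 2) = -σ by ring]
    have h1 : (japZ ζ ^ 2) ^ (1 + σ) ≤ 1 :=
      Real.rpow_le_one_of_one_le_of_nonpos (one_le_pow₀ hz) (by linarith)
    calc _ ≤ 1 * japWeight ζ k ^ (-σ) := mul_le_mul_of_nonneg_right h1 hWs
      _ ≤ _ := by
        rw [one_mul]
        exact Real.rpow_le_rpow hW0.le hWQ (by linarith)

/-- `⟨ζ⟩^{1+σ} M_σ ≤ C ⟨ω⟩^{-1/2}`. -/
theorem exists_japZ_mul_bigM_le {σ : ℝ} (hσ : -(3 / 2) < σ) :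
    ∃ C : ℝ, 0 < C ∧ ∀ (lam : ℂ) (ζ : ℤ × ℤ),
      japZ ζ ^ (1 + σ) * bigM σ lam ζ ≤ C * japOmegaSq lam ζ ^ (-(1 / 4) : ℝ) := by
  have hS0 : 0 ≤ ∑' k : ℕ+, ((k : ℝ) ^ 2)⁻¹ := tsum_nonneg fun k => by positivity
  refine ⟨Real.sqrt (2 * ∑' k : ℕ+, ((k : ℝ) ^ 2)⁻¹) + 1, by positivity, fun lam ζ => ?_⟩
  have hJ := one_le_japOmegaSq lam ζ
  have hJ0 : 0 < japOmegaSq lam ζ := by linarith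
  have hz0 : 0 ≤ japZ ζ ^ (1 + σ) := Real.rpow_nonneg (by linarith [one_le_japZ ζ]) _
  have key : ∀ k, (japZ ζ ^ (1 + σ)) ^ 2 * bigMTerm σ lam ζ k
      ≤ 2 * japOmegaSq lam ζ ^ (-(1 / 2) : ℝ) * ((k : ℝ) ^ 2)⁻¹ := by
    intro k
    have hk := pnat_cast_pos k
    have hQ : 0 < (k : ℝ) ^ 2 + japOmegaSq lam ζ := by positivity
    have h1 := japZ_rpow_mul_japWeight_le σ lam ζ k
    -- This is where `σ > -3/2` enters: the net power of `k² + ⟨ω⟩²` is below `-1/2`.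
    have hτ : 1 / 2 < min 1 (σ + 2) := lt_min (by norm_num) (by linarith)
    have h2 : ((k : ℝ) ^ 2 + japOmegaSq lam ζ) ^ (2 - min 1 (σ + 2)) *
        (((k : ℝ) ^ 2 + japOmegaSq lam ζ) ^ 2)⁻¹ ≤ japOmegaSq lam ζ ^ (-(1 / 2) : ℝ) := by
      rw [← Real.rpow_natCast ((k : ℝ) ^ 2 + japOmegaSq lam ζ) 2, ← Real.rpow_neg hQ.le,
        ← Real.rpow_add hQ]
      calc _ ≤ ((k : ℝ) ^ 2 + japOmegaSq lam ζ) ^ (-(1 / 2) : ℝ) := by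
            refine Real.rpow_le_rpow_of_exponent_le (by nlinarith [sq_nonneg (k : ℝ)]) ?_
            push_cast; linarith
        _ ≤ _ := Real.rpow_le_rpow_of_nonpos hJ0 (by nlinarith [sq_nonneg (k : ℝ)]) (by norm_num)
    rw [bigMTerm_eq]
    calc _ = ((japZ ζ ^ (1 + σ)) ^ 2 * japWeight ζ k ^ (-σ)) *
          ((k : ℝ) ^ 4 + japOmegaSq lam ζ ^ 2)⁻¹ * ((k : ℝ) ^ 2)⁻¹ := by ring
      _ ≤ ((k : ℝ) ^ 2 + japOmegaSq lam ζ) ^ (2 - min 1 (σ + 2)) *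
          (2 * (((k : ℝ) ^ 2 + japOmegaSq lam ζ) ^ 2)⁻¹) * ((k : ℝ) ^ 2)⁻¹ := by
        gcongr
        exact inv_quartic_le lam ζ k
      _ = 2 * (((k : ℝ) ^ 2 + japOmegaSq lam ζ) ^ (2 - min 1 (σ + 2)) *
        (((k : ℝ) ^ 2 + japOmegaSq lam ζ) ^ 2)⁻¹) * ((k : ℝ) ^ 2)⁻¹ := by ring
      _ ≤ _ := by gcongr
  have hs := summable_bigMTerm (show -(5 / 2) < σ by linarith) lam ζ
  have h1 := Summable.tsum_le_tsum key (hs.mul_left _) (summable_inv_pnat_sq.mul_left _)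
  rw [tsum_mul_left, tsum_mul_left] at h1
  have hJ4 : 0 ≤ japOmegaSq lam ζ ^ (-(1 / 4) : ℝ) := Real.rpow_nonneg hJ0.le _
  have hJ2 : japOmegaSq lam ζ ^ (-(1 / 2) : ℝ) = (japOmegaSq lam ζ ^ (-(1 / 4) : ℝ)) ^ 2 := by
    rw [← Real.rpow_natCast, ← Real.rpow_mul hJ0.le]; norm_num
  calc _ = Real.sqrt ((japZ ζ ^ (1 + σ)) ^ 2 * ∑' k, bigMTerm σ lam ζ k) := by
        rw [Real.sqrt_mul (sq_nonneg _), Real.sqrt_sq hz0, bigM_eq]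
    _ ≤ Real.sqrt ((2 * ∑' k : ℕ+, ((k : ℝ) ^ 2)⁻¹) * (japOmegaSq lam ζ ^ (-(1 / 4) : ℝ)) ^ 2) := by
        refine Real.sqrt_le_sqrt (h1.trans (le_of_eq ?_))
        rw [hJ2]; ring
    _ = Real.sqrt (2 * ∑' k : ℕ+, ((k : ℝ) ^ 2)⁻¹) * japOmegaSq lam ζ ^ (-(1 / 4) : ℝ) := by
        rw [Real.sqrt_mul (by positivity), Real.sqrt_sq hJ4]
    _ ≤ _ := mul_le_mul_of_nonneg_right (by linarith) hJ4

/-- `⟨ω⟩² M_{-σ} ≤ C ⟨ζ⟩^σ` for `σ < 1/2`. -/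
theorem exists_japOmegaSq_mul_bigM_neg_le {σ : ℝ} (hσ : σ < 1 / 2) :
    ∃ C : ℝ, 0 < C ∧ ∀ (lam : ℂ) (ζ : ℤ × ℤ),
      japOmegaSq lam ζ * bigM (-σ) lam ζ ≤ C * japZ ζ ^ σ := by
  -- `M_s` does not involve `ν`, so the comparison weight may be taken with `ν = 1`.
  have : Fact ((0 : ℝ) < 1) := ⟨one_pos⟩
  obtain ⟨C₁, hC₁, h₁⟩ := exists_japWeight_rpow_le 1 σ
  obtain ⟨C₂, hC₂, h₂⟩ := exists_sum_weight_div_sq_le 1 hσ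
  refine ⟨Real.sqrt C₁ * C₂, by positivity, fun lam ζ => ?_⟩
  have hJ := one_le_japOmegaSq lam ζ
  have hJ0 : 0 < japOmegaSq lam ζ := by linarith
  obtain ⟨hs, hb⟩ := h₂ ζ
  have key : ∀ k, japOmegaSq lam ζ ^ 2 * bigMTerm (-σ) lam ζ k
      ≤ C₁ * (weight 1 ζ k ^ σ * ((k : ℝ)⁻¹) ^ 2) := by
    intro k
    have hk := pnat_cast_pos k
    have e1 : japOmegaSq lam ζ ^ 2 * ((k : ℝ) ^ 4 + japOmegaSq lam ζ ^ 2)⁻¹ ≤ 1 := by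
      rw [← div_eq_mul_inv, div_le_one (by positivity)]
      nlinarith [sq_nonneg ((k : ℝ) ^ 2)]
    rw [bigMTerm_eq, neg_neg, inv_pow]
    calc _ = japWeight ζ k ^ σ * ((k : ℝ) ^ 2)⁻¹ *
          (japOmegaSq lam ζ ^ 2 * ((k : ℝ) ^ 4 + japOmegaSq lam ζ ^ 2)⁻¹) := by ring
      _ ≤ japWeight ζ k ^ σ * ((k : ℝ) ^ 2)⁻¹ * 1 := by
          have := Real.rpow_nonneg (japWeight_pos ζ k).le σ
          gcongr
      _ ≤ (C₁ * weight 1 ζ k ^ σ) * ((k : ℝ) ^ 2)⁻¹ := by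
          rw [mul_one]
          exact mul_le_mul_of_nonneg_right (h₁ ζ k) (by positivity)
      _ = _ := by ring
  have h1 := Summable.tsum_le_tsum key ((summable_bigMTerm (by linarith) lam ζ).mul_left _)
    (hs.mul_left _)
  rw [tsum_mul_left, tsum_mul_left] at h1
  calc _ = Real.sqrt (japOmegaSq lam ζ ^ 2 * ∑' k, bigMTerm (-σ) lam ζ k) := by
        rw [Real.sqrt_mul (sq_nonneg _), Real.sqrt_sq hJ0.le, bigM_eq]
    _ ≤ Real.sqrt (C₁ * ∑' k : ℕ+, weight 1 ζ k ^ σ * ((k : ℝ)⁻¹) ^ 2) := Real.sqrt_le_sqrt h1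
    _ = Real.sqrt C₁ * Real.sqrt (∑' k : ℕ+, weight 1 ζ k ^ σ * ((k : ℝ)⁻¹) ^ 2) :=
        Real.sqrt_mul hC₁.le _
    _ ≤ Real.sqrt C₁ * (C₂ * japZ ζ ^ σ) := mul_le_mul_of_nonneg_left hb (Real.sqrt_nonneg _)
    _ = _ := by ring

end PrimEq

end

/-! ### Bounds for `f/symb` and `1/symb` in `H^s` and `ℓ¹`, uniform in `(λ,ζ)`. -/

noncomputable section

namespace PrimEq

open HSob

theorem norm_inv_symb_le {ν a c : ℝ} {lam : ℂ} {ζ : ℤ × ℤ} (hc : 0 < c)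
    (h : ∀ k : ℕ+, c * ((k : ℝ) ^ 2 + japOmegaSq lam ζ) ≤ ‖symb ν a lam ζ k‖) (k : ℕ+) :
    ‖(symb ν a lam ζ k)⁻¹‖ ≤ c⁻¹ * ((k : ℝ) ^ 2 + japOmegaSq lam ζ)⁻¹ := by
  have := one_le_japOmegaSq lam ζ
  rw [norm_inv, ← mul_inv]
  exact inv_anti₀ (by positivity) (h k)

variable {ν : ℝ} [hν : Fact (0 < ν)]

theorem weight_le_quadratic (lam : ℂ) (ζ : ℤ × ℤ) (k : ℕ+) :
    weight ν ζ k ≤ (1 + ν) * ((k : ℝ) ^ 2 + japOmegaSq lam ζ) := by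
  refine (weight_le_japWeight ζ k).trans (mul_le_mul_of_nonneg_left ?_ (by linarith [hν.out]))
  unfold japWeight; linarith [japZ_sq_le_japOmegaSq lam ζ]

/-- Supplies the ellipticity hypothesis of `solveCLM` with a constant independent of `(λ,ζ)`. -/
theorem weight_le_symb {a c : ℝ} {lam : ℂ} {ζ : ℤ × ℤ} (hc : 0 < c)
    (h : ∀ k : ℕ+, c * ((k : ℝ) ^ 2 + japOmegaSq lam ζ) ≤ ‖symb ν a lam ζ k‖) (k : ℕ+) :
    c / (1 + ν) * weight ν ζ k ≤ ‖symb ν a lam ζ k‖ := by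
  have h3 := hν.out
  refine le_trans ?_ (h k)
  calc _ ≤ c / (1 + ν) * ((1 + ν) * ((k : ℝ) ^ 2 + japOmegaSq lam ζ)) :=
        mul_le_mul_of_nonneg_left (weight_le_quadratic lam ζ k) (by positivity)
    _ = _ := by field_simp

/-- `⟨ω⟩² ‖f / symb‖_s ≤ C ‖f‖_s`. -/
theorem japOmegaSq_mul_sobNorm_le {a c s : ℝ} {lam : ℂ} {ζ : ℤ × ℤ} (hc : 0 < c)
    (h : ∀ k : ℕ+, c * ((k : ℝ) ^ 2 + japOmegaSq lam ζ) ≤ ‖symb ν a lam ζ k‖)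
    {f : ℕ+ → ℂ} (hf : f ∈ sobSubmodule ν s ζ) :
    japOmegaSq lam ζ * sobNorm ν s ζ (fun k => (symb ν a lam ζ k)⁻¹ * f k)
      ≤ c⁻¹ * sobNorm ν s ζ f := by
  have hJ := one_le_japOmegaSq lam ζ
  have hJ0 : 0 < japOmegaSq lam ζ := by linarith
  rw [← le_inv_mul_iff₀ hJ0, ← mul_assoc]
  refine sobNorm_le_mul_sobNorm (by positivity) hf fun k => ?_
  have h1 := norm_inv_symb_le hc h k
  have h2 : ((k : ℝ) ^ 2 + japOmegaSq lam ζ)⁻¹ ≤ (japOmegaSq lam ζ)⁻¹ :=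
    inv_anti₀ hJ0 (by nlinarith [sq_nonneg (k : ℝ)])
  have h3 : ‖(symb ν a lam ζ k)⁻¹‖ ≤ (japOmegaSq lam ζ)⁻¹ * c⁻¹ := by
    rw [mul_comm]
    exact h1.trans (mul_le_mul_of_nonneg_left h2 (by positivity))
  have h4 := pow_le_pow_left₀ (norm_nonneg _) h3 2
  rw [norm_mul, mul_pow]
  calc _ = ‖(symb ν a lam ζ k)⁻¹‖ ^ 2 * (weight ν ζ k ^ s * ‖f k‖ ^ 2) := by ring
    _ ≤ _ := mul_le_mul_of_nonneg_right h4 (weighted_nonneg s ζ f k)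

/-- `‖1 / symb‖_s ≤ C M_{-s}`. -/
theorem exists_sobNorm_mean_le (ν : ℝ) [Fact (0 < ν)] {a c : ℝ} (ha : 0 < a) (hc : 0 < c) {s : ℝ}
    (hs : s < 5 / 2) : ∃ C : ℝ, 0 < C ∧ ∀ (lam : ℂ) (ζ : ℤ × ℤ),
      (∀ k : ℕ+, c * ((k : ℝ) ^ 2 + japOmegaSq lam ζ) ≤ ‖symb ν a lam ζ k‖) →
      sobNorm ν s ζ (fun k => (symb ν a lam ζ k)⁻¹ * sineMean a k) ≤ C * bigM (-s) lam ζ := by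
  have h3 : 0 < ν := Fact.out
  obtain ⟨C, hC, hw⟩ := exists_weight_rpow_le ν s
  have hd := decayConst_pos ha
  refine ⟨Real.sqrt C * (c⁻¹ * decayConst a), by positivity, fun lam ζ h => ?_⟩
  rw [bigM_eq]
  -- From `c_k = O(1/k)` and `1/symb = O((k² + ⟨ω⟩²)⁻¹)`, the squared terms are dominated by those
  -- of `M_{-s}²`, a convergent sum for `s < 5/2`.
  refine sobNorm_le_of_le (by positivity) (summable_bigMTerm (by linarith) lam ζ) fun k => ?_
  have hk := pnat_cast_pos k
  have hJ := one_le_japOmegaSq lam ζ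
  have h1 : ‖(symb ν a lam ζ k)⁻¹ * sineMean a k‖
      ≤ (c⁻¹ * ((k : ℝ) ^ 2 + japOmegaSq lam ζ)⁻¹) * (decayConst a * (k : ℝ)⁻¹) := by
    rw [norm_mul]
    exact mul_le_mul (norm_inv_symb_le hc h k) (norm_sineMean_le_decayConst ha k) (norm_nonneg _)
      (by positivity)
  have h2 := pow_le_pow_left₀ (norm_nonneg _) h1 2
  have hW := Real.rpow_nonneg (japWeight_pos ζ k).le s
  rw [bigMTerm_eq, neg_neg, mul_pow (Real.sqrt C), Real.sq_sqrt hC.le]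
  calc _ ≤ (C * japWeight ζ k ^ s) *
        ((c⁻¹ * ((k : ℝ) ^ 2 + japOmegaSq lam ζ)⁻¹) * (decayConst a * (k : ℝ)⁻¹)) ^ 2 :=
        mul_le_mul (hw ζ k) h2 (sq_nonneg _) (by positivity)
    _ = C * (c⁻¹ * decayConst a) ^ 2 * (japWeight ζ k ^ s * (((k : ℝ) ^ 2)⁻¹ *
        (((k : ℝ) ^ 2 + japOmegaSq lam ζ) ^ 2)⁻¹)) := by
        simp only [mul_pow, inv_pow]; ring
    _ ≤ _ := by
        gcongr
        exact quartic_le lam ζ k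

/-- Cauchy-Schwarz with weights. -/
theorem summable_and_tsum_mul_le {s : ℝ} {ζ : ℤ × ℤ} {f : ℕ+ → ℂ} (hf : f ∈ sobSubmodule ν s ζ)
    {q b : ℕ+ → ℝ} (hq : ∀ k, 0 ≤ q k) (hb : Summable b)
    (hqb : ∀ k, weight ν ζ k ^ (-s) * q k ^ 2 ≤ b k) :
    (Summable fun k => q k * ‖f k‖) ∧
      ∑' k, q k * ‖f k‖ ≤ Real.sqrt (∑' k, b k) * sobNorm ν s ζ f := by
  have hw := weight_pos hν.out ζ
  have hs : Summable fun k => (weight ν ζ k ^ (-s / 2) * q k) ^ 2 :=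
    Summable.of_nonneg_of_le (fun k => sq_nonneg _)
      (fun k => by rw [← rpow_mul_sq_eq (hw k)]; exact hqb k) hb
  have hcs := tsum_mul_le_sqrt_mul_sqrt (f := fun k => weight ν ζ k ^ (-s / 2) * q k)
    (g := fun k => weight ν ζ k ^ (s / 2) * ‖f k‖)
    (fun k => mul_nonneg (Real.rpow_nonneg (hw k).le _) (hq k))
    (fun k => mul_nonneg (Real.rpow_nonneg (hw k).le _) (norm_nonneg _)) hs
    (by simpa only [← rpow_mul_sq_eq (hw _)] using mem_sob_iff.1 hf)
  have he : ∀ k, weight ν ζ k ^ (-s / 2) * q k * (weight ν ζ k ^ (s / 2) * ‖f k‖)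
      = q k * ‖f k‖ := fun k => by
    have : weight ν ζ k ^ (-s / 2) * weight ν ζ k ^ (s / 2) = 1 := by
      rw [← Real.rpow_add (hw k)]; ring_nf; simp
    linear_combination (q k * ‖f k‖) * this
  simp only [he] at hcs
  refine ⟨hcs.1, hcs.2.trans ?_⟩
  have e2 : Real.sqrt (∑' k, (weight ν ζ k ^ (s / 2) * ‖f k‖) ^ 2) = sobNorm ν s ζ f := by
    simp only [← rpow_mul_sq_eq (hw _)]; rfl
  rw [e2]
  refine mul_le_mul_of_nonneg_right (Real.sqrt_le_sqrt ?_) (sobNorm_nonneg s ζ f)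
  exact Summable.tsum_le_tsum (fun k => by rw [← rpow_mul_sq_eq (hw k)]; exact hqb k) hs hb

/-- `|∑ c_k f_k / symb_k| ≤ C M_s ‖f‖_s`. -/
theorem exists_mean_solve_le (ν : ℝ) [Fact (0 < ν)] {a c : ℝ} (ha : 0 < a) (hc : 0 < c) {s : ℝ}
    (hs : -(5 / 2) < s) : ∃ C : ℝ, 0 < C ∧ ∀ (lam : ℂ) (ζ : ℤ × ℤ) (f : ℕ+ → ℂ),
      (∀ k : ℕ+, c * ((k : ℝ) ^ 2 + japOmegaSq lam ζ) ≤ ‖symb ν a lam ζ k‖) →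
      f ∈ sobSubmodule ν s ζ →
      ‖∑' k, sineMean a k * ((symb ν a lam ζ k)⁻¹ * f k)‖
        ≤ C * (bigM s lam ζ * sobNorm ν s ζ f) := by
  have h3 : 0 < ν := Fact.out
  obtain ⟨C, hC, hw⟩ := exists_weight_rpow_le ν (-s)
  have hd := decayConst_pos ha
  refine ⟨c⁻¹ * decayConst a * Real.sqrt C, by positivity, fun lam ζ f h hf => ?_⟩
  have hJ := one_le_japOmegaSq lam ζ
  -- Here `q` majorises `|c_k/symb|` up to a constant, and `w^{-s}q²` is dominated by the terms of
  -- `M_s²`.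
  have hcs := summable_and_tsum_mul_le hf
    (q := fun k => (k : ℝ)⁻¹ * ((k : ℝ) ^ 2 + japOmegaSq lam ζ)⁻¹)
    (b := fun k => C * bigMTerm s lam ζ k)
    (fun k => by positivity) ((summable_bigMTerm hs lam ζ).mul_left _) (fun k => by
      have hk := pnat_cast_pos k
      have hW := Real.rpow_nonneg (japWeight_pos ζ k).le (-s)
      rw [bigMTerm_eq]
      calc _ ≤ (C * japWeight ζ k ^ (-s)) *
            ((k : ℝ)⁻¹ * ((k : ℝ) ^ 2 + japOmegaSq lam ζ)⁻¹) ^ 2 :=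
            mul_le_mul_of_nonneg_right (hw ζ k) (sq_nonneg _)
        _ = C * (japWeight ζ k ^ (-s) * (((k : ℝ) ^ 2)⁻¹ *
            (((k : ℝ) ^ 2 + japOmegaSq lam ζ) ^ 2)⁻¹)) := by
            simp only [mul_pow, inv_pow]; ring
        _ ≤ _ := by
            gcongr
            exact quartic_le lam ζ k)
  have hb : ∀ k, ‖sineMean a k * ((symb ν a lam ζ k)⁻¹ * f k)‖ ≤ (c⁻¹ * decayConst a) *
      ((k : ℝ)⁻¹ * ((k : ℝ) ^ 2 + japOmegaSq lam ζ)⁻¹ * ‖f k‖) := fun k => by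
    have hk := pnat_cast_pos k
    rw [norm_mul, norm_mul]
    calc _ ≤ (decayConst a * (k : ℝ)⁻¹) * ((c⁻¹ * ((k : ℝ) ^ 2 + japOmegaSq lam ζ)⁻¹) * ‖f k‖) := by
          gcongr
          · exact norm_sineMean_le_decayConst ha k
          · exact norm_inv_symb_le hc h k
      _ = _ := by ring
  refine (tsum_of_norm_bounded (hcs.1.mul_left _).hasSum hb).trans ?_
  rw [tsum_mul_left, mul_assoc]
  refine (mul_le_mul_of_nonneg_left (mul_le_mul_of_nonneg_left hcs.2 hd.le)
    (by positivity : 0 ≤ c⁻¹)).trans (le_of_eq ?_)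
  rw [tsum_mul_left, Real.sqrt_mul hC.le, ← bigM_eq]
  ring

/-- `⟨ω⟩² ‖1 / symb‖_{ℓ¹} ≤ C ⟨ω⟩^{1/4}`. -/
theorem exists_l1_mean_le (ν : ℝ) [Fact (0 < ν)] {a c : ℝ} (ha : 0 < a) (hc : 0 < c) :
    ∃ C : ℝ, 0 < C ∧ ∀ (lam : ℂ) (ζ : ℤ × ℤ),
      (∀ k : ℕ+, c * ((k : ℝ) ^ 2 + japOmegaSq lam ζ) ≤ ‖symb ν a lam ζ k‖) →
      (Summable fun k => ‖(symb ν a lam ζ k)⁻¹ * sineMean a k‖) ∧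
      japOmegaSq lam ζ * ∑' k, ‖(symb ν a lam ζ k)⁻¹ * sineMean a k‖
        ≤ C * japOmegaSq lam ζ ^ (1 / 8 : ℝ) := by
  have hd := decayConst_pos ha
  have hS := summable_pnat_rpow_neg (p := 5 / 4) (by norm_num)
  have hS0 : 0 ≤ ∑' k : ℕ+, (k : ℝ) ^ (-(5 / 4) : ℝ) :=
    tsum_nonneg fun k => Real.rpow_nonneg (pnat_cast_pos k).le _
  refine ⟨c⁻¹ * decayConst a * (∑' k : ℕ+, (k : ℝ) ^ (-(5 / 4) : ℝ) + 1), by positivity,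
    fun lam ζ h => ?_⟩
  have hJ := one_le_japOmegaSq lam ζ
  have hJ0 : 0 < japOmegaSq lam ζ := by linarith
  have key : ∀ k : ℕ+, ‖(symb ν a lam ζ k)⁻¹ * sineMean a k‖ ≤
      (c⁻¹ * decayConst a * japOmegaSq lam ζ ^ (-(7 / 8) : ℝ)) * (k : ℝ) ^ (-(5 / 4) : ℝ) := by
    intro k
    have hk := pnat_cast_pos k
    have hQ : 0 < (k : ℝ) ^ 2 + japOmegaSq lam ζ := by positivity
    -- The exponent `1` is split as `1/8 + 7/8`: the first part gives `k^{-1/4}`, enough to make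
    -- `k^{-1}` summable, at the price of a loss `⟨ω⟩^{1/4}`.
    have e1 : ((k : ℝ) ^ 2 + japOmegaSq lam ζ)⁻¹
        ≤ (k : ℝ) ^ (-(1 / 4) : ℝ) * japOmegaSq lam ζ ^ (-(7 / 8) : ℝ) := by
      have e2 : ((k : ℝ) ^ 2 + japOmegaSq lam ζ)⁻¹ = ((k : ℝ) ^ 2 + japOmegaSq lam ζ) ^ (-(1 / 8) : ℝ)
          * ((k : ℝ) ^ 2 + japOmegaSq lam ζ) ^ (-(7 / 8) : ℝ) := by
        rw [← Real.rpow_add hQ, ← Real.rpow_neg_one]; norm_num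
      have e3 : (k : ℝ) ^ (-(1 / 4) : ℝ) = ((k : ℝ) ^ 2) ^ (-(1 / 8) : ℝ) := by
        rw [← Real.rpow_natCast, ← Real.rpow_mul hk.le]; norm_num
      rw [e2, e3]
      refine mul_le_mul ?_ ?_ (Real.rpow_nonneg hQ.le _) (Real.rpow_nonneg (sq_nonneg _) _)
      · exact Real.rpow_le_rpow_of_nonpos (by positivity) (by linarith) (by norm_num)
      · exact Real.rpow_le_rpow_of_nonpos hJ0 (by nlinarith [sq_nonneg (k : ℝ)]) (by norm_num)
    have e4 : (k : ℝ) ^ (-(5 / 4) : ℝ) = (k : ℝ) ^ (-(1 / 4) : ℝ) * (k : ℝ)⁻¹ := by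
      rw [← Real.rpow_neg_one, ← Real.rpow_add hk]; norm_num
    rw [norm_mul, e4]
    calc _ ≤ (c⁻¹ * ((k : ℝ) ^ (-(1 / 4) : ℝ) * japOmegaSq lam ζ ^ (-(7 / 8) : ℝ))) *
          (decayConst a * (k : ℝ)⁻¹) := by
          refine mul_le_mul ((norm_inv_symb_le hc h k).trans
            (mul_le_mul_of_nonneg_left e1 (by positivity))) (norm_sineMean_le_decayConst ha k)
            (norm_nonneg _) (by positivity)
      _ = _ := by ring
  have hs : Summable fun k => ‖(symb ν a lam ζ k)⁻¹ * sineMean a k‖ :=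
    Summable.of_nonneg_of_le (fun _ => norm_nonneg _) key (hS.mul_left _)
  refine ⟨hs, ?_⟩
  have h1 := Summable.tsum_le_tsum key hs (hS.mul_left _)
  rw [tsum_mul_left] at h1
  have h2 : japOmegaSq lam ζ * japOmegaSq lam ζ ^ (-(7 / 8) : ℝ) = japOmegaSq lam ζ ^ (1 / 8 : ℝ) := by
    nth_rewrite 1 [← Real.rpow_one (japOmegaSq lam ζ)]
    rw [← Real.rpow_add hJ0]; norm_num
  have h8 := Real.rpow_nonneg hJ0.le (1 / 8 : ℝ)
  calc _ ≤ japOmegaSq lam ζ * (c⁻¹ * decayConst a * japOmegaSq lam ζ ^ (-(7 / 8) : ℝ) *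
        ∑' k : ℕ+, (k : ℝ) ^ (-(5 / 4) : ℝ)) := mul_le_mul_of_nonneg_left h1 hJ0.le
    _ = c⁻¹ * decayConst a * (∑' k : ℕ+, (k : ℝ) ^ (-(5 / 4) : ℝ)) *
        japOmegaSq lam ζ ^ (1 / 8 : ℝ) := by rw [← h2]; ring
    _ ≤ _ := by gcongr; linarith

/-- `⟨ζ⟩^{1+σ} ‖f / symb‖_{ℓ¹} ≤ C ⟨ω⟩^{-2ε} ‖f‖_σ` with `ε > 0`. -/
theorem exists_l1_solve_le (ν : ℝ) [Fact (0 < ν)] {a c σ : ℝ} (hc : 0 < c) (hσ : -(3 / 2) < σ) :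
    ∃ C : ℝ, 0 < C ∧ ∀ (lam : ℂ) (ζ : ℤ × ℤ) (f : ℕ+ → ℂ),
      (∀ k : ℕ+, c * ((k : ℝ) ^ 2 + japOmegaSq lam ζ) ≤ ‖symb ν a lam ζ k‖) →
      f ∈ sobSubmodule ν σ ζ →
      (Summable fun k => ‖(symb ν a lam ζ k)⁻¹ * f k‖) ∧
      japZ ζ ^ (1 + σ) * ∑' k, ‖(symb ν a lam ζ k)⁻¹ * f k‖
        ≤ C * japOmegaSq lam ζ ^ (-((min 1 (σ + 2) - 1 / 2) / 4)) * sobNorm ν σ ζ f := by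
  have h3 : 0 < ν := Fact.out
  obtain ⟨C, hC, hw⟩ := exists_weight_rpow_le ν (-σ)
  set τ : ℝ := min 1 (σ + 2) with hτ
  have hτ1 : 1 / 2 < τ := lt_min (by norm_num) (by linarith)
  have hS := summable_pnat_rpow_neg (p := τ + 1 / 2) (by linarith)
  have hS0 : 0 ≤ ∑' k : ℕ+, (k : ℝ) ^ (-(τ + 1 / 2)) :=
    tsum_nonneg fun k => Real.rpow_nonneg (pnat_cast_pos k).le _
  refine ⟨c⁻¹ * (Real.sqrt (C * ∑' k : ℕ+, (k : ℝ) ^ (-(τ + 1 / 2))) + 1), by positivity,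
    fun lam ζ f h hf => ?_⟩
  have hJ := one_le_japOmegaSq lam ζ
  have hJ0 : 0 < japOmegaSq lam ζ := by linarith
  have hz0 : 0 < japZ ζ ^ (1 + σ) := Real.rpow_pos_of_pos (by linarith [one_le_japZ ζ]) _
  set ε : ℝ := (τ - 1 / 2) / 4 with hε
  have hcs := summable_and_tsum_mul_le hf
    (q := fun k => japZ ζ ^ (1 + σ) * ((k : ℝ) ^ 2 + japOmegaSq lam ζ)⁻¹)
    (b := fun k => (C * (japOmegaSq lam ζ ^ (-ε)) ^ 2) * (k : ℝ) ^ (-(τ + 1 / 2)))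
    (fun k => by positivity) (hS.mul_left _) (fun k => by
      have hk := pnat_cast_pos k
      have hQ : 0 < (k : ℝ) ^ 2 + japOmegaSq lam ζ := by positivity
      have h1 := japZ_rpow_mul_japWeight_le σ lam ζ k
      rw [← hτ] at h1
      have h2 : ((k : ℝ) ^ 2 + japOmegaSq lam ζ) ^ (2 - τ) *
          (((k : ℝ) ^ 2 + japOmegaSq lam ζ) ^ 2)⁻¹
          ≤ (k : ℝ) ^ (-(τ + 1 / 2)) * (japOmegaSq lam ζ ^ (-ε)) ^ 2 := by
        rw [← Real.rpow_natCast ((k : ℝ) ^ 2 + japOmegaSq lam ζ) 2, ← Real.rpow_neg hQ.le,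
          ← Real.rpow_add hQ]
        -- The net exponent `-τ` is split: `(τ + 1/2)/2` goes to `k²`, giving `k^{-(τ+1/2)}`,
        -- summable because `τ > 1/2`; the remaining `(τ - 1/2)/2 = 2ε` is decay in `⟨ω⟩²`.
        have e1 : 2 - τ + -((2 : ℕ) : ℝ) = -((τ + 1 / 2) / 2) + -(2 * ε) := by
          rw [hε]; push_cast; ring
        have e2 : (k : ℝ) ^ (-(τ + 1 / 2)) = ((k : ℝ) ^ 2) ^ (-((τ + 1 / 2) / 2)) := by
          rw [← Real.rpow_natCast (k : ℝ) 2, ← Real.rpow_mul hk.le]; congr 1; push_cast; ring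
        have e3 : (japOmegaSq lam ζ ^ (-ε)) ^ 2 = japOmegaSq lam ζ ^ (-(2 * ε)) := by
          rw [← Real.rpow_natCast, ← Real.rpow_mul hJ0.le]; congr 1; push_cast; ring
        rw [e1, Real.rpow_add hQ, e2, e3]
        refine mul_le_mul ?_ ?_ (Real.rpow_nonneg hQ.le _) (Real.rpow_nonneg (sq_nonneg _) _)
        · exact Real.rpow_le_rpow_of_nonpos (by positivity) (by linarith) (by linarith)
        · exact Real.rpow_le_rpow_of_nonpos hJ0 (by nlinarith [sq_nonneg (k : ℝ)]) (by linarith)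
      calc _ ≤ (C * japWeight ζ k ^ (-σ)) *
            (japZ ζ ^ (1 + σ) * ((k : ℝ) ^ 2 + japOmegaSq lam ζ)⁻¹) ^ 2 :=
            mul_le_mul_of_nonneg_right (hw ζ k) (sq_nonneg _)
        _ = C * (((japZ ζ ^ (1 + σ)) ^ 2 * japWeight ζ k ^ (-σ)) *
            (((k : ℝ) ^ 2 + japOmegaSq lam ζ) ^ 2)⁻¹) := by
            simp only [mul_pow, inv_pow]; ring
        _ ≤ C * (((k : ℝ) ^ 2 + japOmegaSq lam ζ) ^ (2 - τ) *
            (((k : ℝ) ^ 2 + japOmegaSq lam ζ) ^ 2)⁻¹) := by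
            gcongr
        _ ≤ C * ((k : ℝ) ^ (-(τ + 1 / 2)) * (japOmegaSq lam ζ ^ (-ε)) ^ 2) :=
            mul_le_mul_of_nonneg_left h2 hC.le
        _ = _ := by ring)
  have key : ∀ k, ‖(symb ν a lam ζ k)⁻¹ * f k‖ ≤ (c⁻¹ * (japZ ζ ^ (1 + σ))⁻¹) *
      (japZ ζ ^ (1 + σ) * ((k : ℝ) ^ 2 + japOmegaSq lam ζ)⁻¹ * ‖f k‖) := fun k => by
    rw [norm_mul]
    refine (mul_le_mul_of_nonneg_right (norm_inv_symb_le hc h k) (norm_nonneg _)).trans (le_of_eq ?_)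
    field_simp
  have hs : Summable fun k => ‖(symb ν a lam ζ k)⁻¹ * f k‖ :=
    Summable.of_nonneg_of_le (fun _ => norm_nonneg _) key (hcs.1.mul_left _)
  refine ⟨hs, ?_⟩
  have h1 := Summable.tsum_le_tsum key hs (hcs.1.mul_left _)
  rw [tsum_mul_left] at h1
  have hJε := Real.rpow_nonneg hJ0.le (-ε)
  calc _ ≤ japZ ζ ^ (1 + σ) * (c⁻¹ * (japZ ζ ^ (1 + σ))⁻¹ *
        ∑' k : ℕ+, japZ ζ ^ (1 + σ) * ((k : ℝ) ^ 2 + japOmegaSq lam ζ)⁻¹ * ‖f k‖) :=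
        mul_le_mul_of_nonneg_left h1 hz0.le
    _ = c⁻¹ * ∑' k : ℕ+, japZ ζ ^ (1 + σ) * ((k : ℝ) ^ 2 + japOmegaSq lam ζ)⁻¹ * ‖f k‖ := by
        field_simp
    _ ≤ c⁻¹ * (Real.sqrt (∑' k : ℕ+, (C * (japOmegaSq lam ζ ^ (-ε)) ^ 2) *
          (k : ℝ) ^ (-(τ + 1 / 2))) * sobNorm ν σ ζ f) :=
        mul_le_mul_of_nonneg_left hcs.2 (by positivity)
    _ = c⁻¹ * (Real.sqrt (C * ∑' k : ℕ+, (k : ℝ) ^ (-(τ + 1 / 2))) * japOmegaSq lam ζ ^ (-ε) *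
          sobNorm ν σ ζ f) := by
        rw [tsum_mul_left, show C * (japOmegaSq lam ζ ^ (-ε)) ^ 2 * ∑' k : ℕ+, (k : ℝ) ^ (-(τ + 1 / 2))
          = (C * ∑' k : ℕ+, (k : ℝ) ^ (-(τ + 1 / 2))) * (japOmegaSq lam ζ ^ (-ε)) ^ 2 by ring,
          Real.sqrt_mul (by positivity), Real.sqrt_sq hJε]
    _ ≤ _ := by
        have := sobNorm_nonneg (ν := ν) σ ζ f
        rw [mul_assoc, mul_assoc, mul_assoc]
        gcongr
        linarith

end PrimEq

end

/-! ### The pressure estimate, and smallness of the coupling for large `⟨ω⟩`. -/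

noncomputable section

namespace PrimEq

open HSob Filter Topology

section

variable {ν : ℝ} [hν : Fact (0 < ν)] {a σ c : ℝ} {ζ : ℤ × ℤ} {lam : ℂ}

theorem sqrt_zsq_sq (ζ : ℤ × ℤ) : Real.sqrt (zsq ζ) ^ 2 = zsq ζ := Real.sq_sqrt (zsq_nonneg ζ)

theorem norm_fst_le_sqrt_zsq (ζ : ℤ × ℤ) : ‖(ζ.1 : ℂ)‖ ≤ Real.sqrt (zsq ζ) := by
  rw [Complex.norm_intCast]
  exact Real.abs_le_sqrt (by unfold zsq; nlinarith [sq_nonneg (ζ.2 : ℝ)])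

theorem norm_snd_le_sqrt_zsq (ζ : ℤ × ℤ) : ‖(ζ.2 : ℂ)‖ ≤ Real.sqrt (zsq ζ) := by
  rw [Complex.norm_intCast]
  exact Real.abs_le_sqrt (by unfold zsq; nlinarith [sq_nonneg (ζ.1 : ℝ)])

theorem sqrt_zsq_le_japZ (ζ : ℤ × ℤ) : Real.sqrt (zsq ζ) ≤ japZ ζ := by
  unfold japZ; linarith

theorem norm_fst_ran_le (F : RanSpace ν σ ζ) : sobNorm ν σ ζ F.1.coeff ≤ ‖F‖ := by
  rw [← norm_eq]; exact norm_fst_le F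

theorem norm_snd_ran_le (F : RanSpace ν σ ζ) : sobNorm ν σ ζ F.2.1.coeff ≤ ‖F‖ := by
  rw [← norm_eq]; exact (norm_fst_le F.2).trans (norm_snd_le F)

theorem norm_trd_ran_le (F : RanSpace ν σ ζ) : sobNorm ν σ ζ F.2.2.coeff ≤ ‖F‖ := by
  rw [← norm_eq]; exact (norm_snd_le F.2).trans (norm_snd_le F)

section decomposition

variable (ha : 0 < a) (hσ : σ < 1 / 2) (hc : 0 < c)
  (h : ∀ k, c * weight ν ζ k ≤ ‖symb ν a lam ζ k‖) (x : DomSpace ν σ ζ)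

/-- The velocity rows of `𝓛₀x` solved for the velocity. The first summand, due to the pressure, will
be `Y₁`; the second will be `Y₂`. -/
theorem decomp_fst : x.1 = -((x.2.2.1 * (Complex.I * (ζ.1 : ℂ))) • solveCLM hc h (oneElt ζ ha hσ))
    + solveCLM hc h (L0 lam ζ ha hσ x).1 := by
  obtain ⟨u, v, p, θ⟩ := x
  rw [L0_apply]
  dsimp only
  rw [map_add, solveCLM_helmCLM, map_smul, map_smul, smul_smul]
  abel

theorem decomp_snd :
    x.2.1 = -((x.2.2.1 * (Complex.I * (ζ.2 : ℂ))) • solveCLM hc h (oneElt ζ ha hσ))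
    + solveCLM hc h (L0 lam ζ ha hσ x).2.1 := by
  obtain ⟨u, v, p, θ⟩ := x
  rw [L0_apply]
  dsimp only
  rw [map_add, solveCLM_helmCLM, map_smul, map_smul, smul_smul]
  abel

theorem decomp_trd : x.2.2.2 = solveCLM hc h (L0 lam ζ ha hσ x).2.2 := by
  obtain ⟨u, v, p, θ⟩ := x
  rw [L0_apply]
  dsimp only
  rw [solveCLM_helmCLM]

end decomposition

/-- The pressure is controlled by the uncoupled operator. -/
theorem exists_pressure_le (ν : ℝ) [Fact (0 < ν)] {a σ c : ℝ} (ha : 0 < a) (hσ : σ < 1 / 2)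
    (hσ₁ : -(3 / 2) < σ) (hc : 0 < c) : ∃ C : ℝ, 0 < C ∧ ∀ (lam : ℂ) (ζ : ℤ × ℤ), ζ ≠ 0 →
      (∀ k : ℕ+, c * ((k : ℝ) ^ 2 + japOmegaSq lam ζ) ≤ ‖symb ν a lam ζ k‖) →
      c ≤ japOmegaSq lam ζ * ‖∑' k, sineMean a k * ((symb ν a lam ζ k)⁻¹ * sineMean a k)‖ →
      ∀ x ∈ Dom ν a (σ + 2) ζ, Real.sqrt (zsq ζ) * ‖x.2.2.1‖
        ≤ C * (japOmegaSq lam ζ * bigM σ lam ζ * ‖(L0 lam ζ ha hσ x : RanSpace ν σ ζ)‖) := by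
  have h3 : 0 < ν := Fact.out
  obtain ⟨C, hC, hm⟩ := exists_mean_solve_le ν ha hc (s := σ) (by linarith)
  refine ⟨2 * C / c, by positivity, fun lam ζ hζ h hD x hx => ?_⟩
  have hσ' : 1 / 2 < σ + 2 := by linarith
  have hc' : 0 < c / (1 + ν) := by positivity
  have h' := weight_le_symb hc h
  have hJ := one_le_japOmegaSq lam ζ
  have hJ0 : 0 < japOmegaSq lam ζ := by linarith
  set r := Real.sqrt (zsq ζ) with hr
  have hr1 : 1 ≤ r := Real.one_le_sqrt.2 (one_le_zsq hζ)
  set F := (L0 lam ζ ha hσ x : RanSpace ν σ ζ) with hF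
  have hM := (bigM_pos (show -(5 / 2) < σ by linarith) lam ζ).le
  -- The pressure equation carries `|ζ|²` on one side and a single `|ζ|` on the other; one power
  -- cancels, and the lower bound for `|D|` costs `⟨ω⟩²`.
  have e := mean_div_L0 ha hσ hσ' hc' h' x hx
  rw [presDet_eq, ← hF] at e
  set D := ∑' k, sineMean a k * ((symb ν a lam ζ k)⁻¹ * sineMean a k) with hDdef
  have b1 : ‖meanCLM ζ ha hσ' (solveCLM hc' h' F.1)‖ ≤ C * (bigM σ lam ζ * ‖F‖) := by
    rw [meanCLM_apply, coeff_solveCLM]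
    refine (hm lam ζ F.1.coeff h F.1.coeff_mem).trans ?_
    have := norm_fst_ran_le F
    gcongr
  have b2 : ‖meanCLM ζ ha hσ' (solveCLM hc' h' F.2.1)‖ ≤ C * (bigM σ lam ζ * ‖F‖) := by
    rw [meanCLM_apply, coeff_solveCLM]
    refine (hm lam ζ F.2.1.coeff h F.2.1.coeff_mem).trans ?_
    have := norm_snd_ran_le F
    gcongr
  have hn : r ^ 2 * ‖D‖ * ‖x.2.2.1‖ ≤ r * (2 * C * (bigM σ lam ζ * ‖F‖)) := by
    have e1 : r ^ 2 * ‖D‖ * ‖x.2.2.1‖ = ‖Complex.I * (zsq ζ : ℂ) * D * x.2.2.1‖ := by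
      rw [norm_mul, norm_mul, norm_mul, Complex.norm_I, one_mul, Complex.norm_real,
        Real.norm_of_nonneg (zsq_nonneg ζ), hr, sqrt_zsq_sq]
    rw [e1, ← e]
    refine (norm_add_le _ _).trans ?_
    rw [norm_mul, norm_mul]
    calc _ ≤ r * (C * (bigM σ lam ζ * ‖F‖)) + r * (C * (bigM σ lam ζ * ‖F‖)) := by
          gcongr
          · exact norm_fst_le_sqrt_zsq ζ
          · exact norm_snd_le_sqrt_zsq ζ
      _ = _ := by ring
  have hn2 : r * ‖D‖ * ‖x.2.2.1‖ ≤ 2 * C * (bigM σ lam ζ * ‖F‖) := by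
    refine le_of_mul_le_mul_left ?_ (by linarith : 0 < r)
    calc _ = r ^ 2 * ‖D‖ * ‖x.2.2.1‖ := by ring
      _ ≤ _ := hn
  rw [div_mul_eq_mul_div, le_div_iff₀ hc]
  calc r * ‖x.2.2.1‖ * c ≤ r * ‖x.2.2.1‖ * (japOmegaSq lam ζ * ‖D‖) := by gcongr
    _ = japOmegaSq lam ζ * (r * ‖D‖ * ‖x.2.2.1‖) := by ring
    _ ≤ japOmegaSq lam ζ * (2 * C * (bigM σ lam ζ * ‖F‖)) := mul_le_mul_of_nonneg_left hn2 hJ0.le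
    _ = _ := by ring

/-- The horizontal velocity `y` and its decomposition: `y = -p ζ_i n + f / symb`, with
`n = 1 / symb`. -/
theorem exists_component_le (ν : ℝ) [Fact (0 < ν)] {a σ c : ℝ} (ha : 0 < a) (hσ : σ < 1 / 2)
    (hσ₁ : -(3 / 2) < σ) (hc : 0 < c) {A : ℝ} (hA : 0 < A) :
    ∃ C : ℝ, 0 < C ∧ ∀ (lam : ℂ) (ζ : ℤ × ℤ),
      (∀ k : ℕ+, c * ((k : ℝ) ^ 2 + japOmegaSq lam ζ) ≤ ‖symb ν a lam ζ k‖) →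
      ∀ (hc' : 0 < c / (1 + ν)) (h' : ∀ k, c / (1 + ν) * weight ν ζ k ≤ ‖symb ν a lam ζ k‖)
        (q : ℂ) (f : HSob ν σ ζ) (y : HSob ν (σ + 2) ζ) (N : ℝ), ‖f‖ ≤ N →
        ‖q‖ ≤ A * (japOmegaSq lam ζ * bigM σ lam ζ * N) →
        y = -(q • solveCLM hc' h' (oneElt ζ ha hσ)) + solveCLM hc' h' f →
        japZ ζ ^ (1 + σ) * ∑' k, ‖y.coeff k‖
            ≤ C * (japOmegaSq lam ζ ^ (-((min 1 (σ + 2) - 1 / 2) / 4)) * N) ∧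
          sobNorm ν σ ζ y.coeff
            ≤ C * (japOmegaSq lam ζ ^ (-((min 1 (σ + 2) - 1 / 2) / 4)) * N) := by
  have h3 : 0 < ν := Fact.out
  obtain ⟨C₁, hC₁, h₁⟩ := exists_l1_solve_le ν (a := a) hc hσ₁
  obtain ⟨C₂, hC₂, h₂⟩ := exists_l1_mean_le ν ha hc
  obtain ⟨C₃, hC₃, h₃⟩ := exists_japZ_mul_bigM_le hσ₁
  obtain ⟨C₄, hC₄, h₄⟩ := exists_japOmegaSq_mul_bigM_neg_le hσ
  obtain ⟨C₅, hC₅, h₅⟩ := exists_sobNorm_mean_le ν ha hc (s := σ) (by linarith)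
  refine ⟨max (A * C₃ * C₂ + C₁) (A * C₃ * C₄ * C₅ + c⁻¹), lt_max_of_lt_left (by positivity),
    fun lam ζ h hc' h' q f y N hf hq hy => ?_⟩
  set ε : ℝ := (min 1 (σ + 2) - 1 / 2) / 4 with hε
  -- Guarantees that the pressure part decays at least as fast as `f/symb`: in powers of `⟨ω⟩²`, the
  -- gain `-1/4` from `M_σ` and the loss `1/8` in `ℓ¹` still leave `-1/8 ≤ -ε`.
  have hε8 : ε ≤ 1 / 8 := by
    have := min_le_left 1 (σ + 2)
    rw [hε]; linarith
  have hJ := one_le_japOmegaSq lam ζ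
  have hJ0 : 0 < japOmegaSq lam ζ := by linarith
  have hz := one_le_japZ ζ
  have hz0 : 0 < japZ ζ := by linarith
  have hzs : 0 < japZ ζ ^ (1 + σ) := Real.rpow_pos_of_pos hz0 _
  have hN : 0 ≤ N := (norm_nonneg _).trans hf
  have hJε := Real.rpow_nonneg hJ0.le (-ε)
  have hM := (bigM_pos (show -(5 / 2) < σ by linarith) lam ζ).le
  have hM' := (bigM_pos (show -(5 / 2) < -σ by linarith) lam ζ).le
  have hfs : sobNorm ν σ ζ f.coeff ≤ N := by rw [← norm_eq]; exact hf
  set n : ℕ+ → ℂ := fun k => (symb ν a lam ζ k)⁻¹ * sineMean a k with hn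
  set g : ℕ+ → ℂ := fun k => (symb ν a lam ζ k)⁻¹ * f.coeff k with hg
  obtain ⟨gs, gb⟩ := h₁ lam ζ f.coeff h f.coeff_mem
  obtain ⟨ns, nb⟩ := h₂ lam ζ h
  have hyc : y.coeff = fun k => -(q * n k) + g k := by
    rw [hy, coeff_add, coeff_neg, coeff_smul, coeff_solveCLM, coeff_solveCLM, coeff_oneElt]
    rfl
  constructor
  · have t1 : ∑' k, ‖y.coeff k‖ ≤ ‖q‖ * ∑' k, ‖n k‖ + ∑' k, ‖g k‖ := by
      rw [hyc, ← tsum_mul_left, ← (ns.mul_left _).tsum_add gs]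
      have hle : ∀ k, ‖-(q * n k) + g k‖ ≤ ‖q‖ * ‖n k‖ + ‖g k‖ := fun k => by
        refine (norm_add_le _ _).trans (le_of_eq ?_)
        rw [norm_neg, norm_mul]
      have hs := (ns.mul_left ‖q‖).add gs
      exact Summable.tsum_le_tsum hle (Summable.of_nonneg_of_le (fun _ => norm_nonneg _) hle hs) hs
    have n0 : 0 ≤ ∑' k, ‖n k‖ := tsum_nonneg fun _ => norm_nonneg _
    have t2 : japZ ζ ^ (1 + σ) * (‖q‖ * ∑' k, ‖n k‖)
        ≤ A * C₃ * C₂ * (japOmegaSq lam ζ ^ (-ε) * N) := by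
      have e1 : japOmegaSq lam ζ ^ (-(1 / 4) : ℝ) * japOmegaSq lam ζ ^ (1 / 8 : ℝ)
          ≤ japOmegaSq lam ζ ^ (-ε) := by
        rw [← Real.rpow_add hJ0]
        exact Real.rpow_le_rpow_of_exponent_le hJ (by linarith)
      calc _ ≤ japZ ζ ^ (1 + σ) * ((A * (japOmegaSq lam ζ * bigM σ lam ζ * N)) * ∑' k, ‖n k‖) := by
            gcongr
        _ = A * N * ((japZ ζ ^ (1 + σ) * bigM σ lam ζ) * (japOmegaSq lam ζ * ∑' k, ‖n k‖)) := by ring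
        _ ≤ A * N * ((C₃ * japOmegaSq lam ζ ^ (-(1 / 4) : ℝ)) *
            (C₂ * japOmegaSq lam ζ ^ (1 / 8 : ℝ))) := by
            refine mul_le_mul_of_nonneg_left ?_ (by positivity)
            exact mul_le_mul (h₃ lam ζ) nb (by positivity) (by positivity)
        _ = A * C₃ * C₂ * ((japOmegaSq lam ζ ^ (-(1 / 4) : ℝ) * japOmegaSq lam ζ ^ (1 / 8 : ℝ)) * N) := by
            ring
        _ ≤ _ := by gcongr
    have t3 : japZ ζ ^ (1 + σ) * ∑' k, ‖g k‖ ≤ C₁ * (japOmegaSq lam ζ ^ (-ε) * N) := by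
      refine gb.trans ?_
      rw [mul_assoc]
      gcongr
    calc _ ≤ japZ ζ ^ (1 + σ) * (‖q‖ * ∑' k, ‖n k‖ + ∑' k, ‖g k‖) :=
          mul_le_mul_of_nonneg_left t1 hzs.le
      _ = japZ ζ ^ (1 + σ) * (‖q‖ * ∑' k, ‖n k‖) + japZ ζ ^ (1 + σ) * ∑' k, ‖g k‖ := by ring
      _ ≤ (A * C₃ * C₂ + C₁) * (japOmegaSq lam ζ ^ (-ε) * N) := by linarith
      _ ≤ _ := mul_le_mul_of_nonneg_right (le_max_left _ _) (by positivity)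
  · have hle : σ ≤ σ + 2 := by linarith
    have i1 : sobNorm ν σ ζ y.coeff ≤ ‖q‖ * sobNorm ν σ ζ n + sobNorm ν σ ζ g := by
      have e1 : sobNorm ν σ ζ y.coeff = ‖incl hle y‖ := by rw [norm_eq, coeff_incl]
      have e2 : sobNorm ν σ ζ n = ‖incl hle (solveCLM hc' h' (oneElt ζ ha hσ))‖ := by
        rw [norm_eq, coeff_incl, coeff_solveCLM, coeff_oneElt]
      have e3 : sobNorm ν σ ζ g = ‖incl hle (solveCLM hc' h' f)‖ := by
        rw [norm_eq, coeff_incl, coeff_solveCLM]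
      rw [e1, e2, e3, hy, map_add, map_neg, map_smul]
      refine (norm_add_le _ _).trans (le_of_eq ?_)
      rw [norm_neg, norm_smul]
    have i2 : ‖q‖ * sobNorm ν σ ζ n ≤ A * C₃ * C₄ * C₅ * (japOmegaSq lam ζ ^ (-ε) * N) := by
      have e1 : japOmegaSq lam ζ ^ (-(1 / 4) : ℝ) ≤ japOmegaSq lam ζ ^ (-ε) :=
        Real.rpow_le_rpow_of_exponent_le hJ (by linarith)
      -- No horizontal derivative occurs in this norm, so a power of `⟨ζ⟩` may be given away.
      have e2 : japZ ζ ^ σ ≤ japZ ζ ^ (1 + σ) :=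
        Real.rpow_le_rpow_of_exponent_le hz (by linarith)
      calc _ ≤ (A * (japOmegaSq lam ζ * bigM σ lam ζ * N)) * (C₅ * bigM (-σ) lam ζ) :=
            mul_le_mul hq (h₅ lam ζ h) (sobNorm_nonneg σ ζ n) (by positivity)
        _ = A * C₅ * N * bigM σ lam ζ * (japOmegaSq lam ζ * bigM (-σ) lam ζ) := by ring
        _ ≤ A * C₅ * N * bigM σ lam ζ * (C₄ * japZ ζ ^ (1 + σ)) := by
            refine mul_le_mul_of_nonneg_left ((h₄ lam ζ).trans ?_) (by positivity)
            gcongr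
        _ = A * C₅ * N * C₄ * (japZ ζ ^ (1 + σ) * bigM σ lam ζ) := by ring
        _ ≤ A * C₅ * N * C₄ * (C₃ * japOmegaSq lam ζ ^ (-(1 / 4) : ℝ)) := by
            refine mul_le_mul_of_nonneg_left (h₃ lam ζ) (by positivity)
        _ ≤ A * C₅ * N * C₄ * (C₃ * japOmegaSq lam ζ ^ (-ε)) := by gcongr
        _ = _ := by ring
    have i3 : sobNorm ν σ ζ g ≤ c⁻¹ * (japOmegaSq lam ζ ^ (-ε) * N) := by
      have e1 := japOmegaSq_mul_sobNorm_le hc h f.coeff_mem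
      have e2 : (japOmegaSq lam ζ)⁻¹ ≤ japOmegaSq lam ζ ^ (-ε) := by
        rw [← Real.rpow_neg_one]
        exact Real.rpow_le_rpow_of_exponent_le hJ (by linarith)
      calc _ = (japOmegaSq lam ζ)⁻¹ * (japOmegaSq lam ζ * sobNorm ν σ ζ g) := by field_simp
        _ ≤ japOmegaSq lam ζ ^ (-ε) * (c⁻¹ * N) := by
            refine mul_le_mul e2 (e1.trans ?_) (mul_nonneg hJ0.le (sobNorm_nonneg σ ζ g)) hJε
            gcongr
        _ = _ := by ring
    calc _ ≤ (A * C₃ * C₄ * C₅ + c⁻¹) * (japOmegaSq lam ζ ^ (-ε) * N) := by linarith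
      _ ≤ _ := mul_le_mul_of_nonneg_right (le_max_right _ _) (by positivity)

/-- The coupling is small compared with the uncoupled operator when `⟨ω⟩` is large. -/
theorem exists_coupling_le (ν : ℝ) [Fact (0 < ν)] {a σ c : ℝ} (α β γ : ℝ) (ha : 0 < a)
    (hσ : σ < 1 / 2) (hσ₁ : -(3 / 2) < σ) (hσ' : 1 / 2 < σ + 2) (hc : 0 < c) :
    ∃ C : ℝ, 0 < C ∧ ∀ (lam : ℂ) (ζ : ℤ × ℤ), ζ ≠ 0 →
      (∀ k : ℕ+, c * ((k : ℝ) ^ 2 + japOmegaSq lam ζ) ≤ ‖symb ν a lam ζ k‖) →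
      c ≤ japOmegaSq lam ζ * ‖∑' k, sineMean a k * ((symb ν a lam ζ k)⁻¹ * sineMean a k)‖ →
      ∀ x ∈ Dom ν a (σ + 2) ζ, ‖(L1 α β γ ζ ha hσ hσ' x : RanSpace ν σ ζ)‖
        ≤ C * (japOmegaSq lam ζ ^ (-((min 1 (σ + 2) - 1 / 2) / 4)) *
          ‖(L0 lam ζ ha hσ x : RanSpace ν σ ζ)‖) := by
  have h3 : 0 < ν := Fact.out
  obtain ⟨A, hA, hp⟩ := exists_pressure_le ν ha hσ hσ₁ hc
  obtain ⟨B, hB, hy⟩ := exists_component_le ν ha hσ hσ₁ hc hA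
  obtain ⟨P, hP, hprim⟩ := exists_sobNorm_primCoeff_le ν ha hσ
  refine ⟨(|α| + (|β| + 2 * |γ|) * P + 1) * B, by positivity, fun lam ζ hζ h hD x hx => ?_⟩
  have hc' : 0 < c / (1 + ν) := by positivity
  have h' := weight_le_symb hc h
  have hp' := hp lam ζ hζ h hD x hx
  have hJ0 : 0 < japOmegaSq lam ζ := by linarith [one_le_japOmegaSq lam ζ]
  have hz0 : 0 < japZ ζ := by linarith [one_le_japZ ζ]
  set F := (L0 lam ζ ha hσ x : RanSpace ν σ ζ) with hF
  set r := Real.sqrt (zsq ζ) with hr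
  have hM := (bigM_pos (show -(5 / 2) < σ by linarith) lam ζ).le
  set E := japOmegaSq lam ζ ^ (-((min 1 (σ + 2) - 1 / 2) / 4)) * ‖F‖ with hE
  have hE0 : 0 ≤ E := mul_nonneg (Real.rpow_nonneg hJ0.le _) (norm_nonneg _)
  have q1 : ‖x.2.2.1 * (Complex.I * (ζ.1 : ℂ))‖ ≤ A * (japOmegaSq lam ζ * bigM σ lam ζ * ‖F‖) := by
    refine le_trans ?_ hp'
    rw [norm_mul, norm_mul, Complex.norm_I, one_mul, mul_comm]
    exact mul_le_mul_of_nonneg_right (norm_fst_le_sqrt_zsq ζ) (norm_nonneg _)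
  have q2 : ‖x.2.2.1 * (Complex.I * (ζ.2 : ℂ))‖ ≤ A * (japOmegaSq lam ζ * bigM σ lam ζ * ‖F‖) := by
    refine le_trans ?_ hp'
    rw [norm_mul, norm_mul, Complex.norm_I, one_mul, mul_comm]
    exact mul_le_mul_of_nonneg_right (norm_snd_le_sqrt_zsq ζ) (norm_nonneg _)
  -- The temperature row has no pressure, so the component estimate applies to it with `q = 0`.
  have q3 : ‖(0 : ℂ)‖ ≤ A * (japOmegaSq lam ζ * bigM σ lam ζ * ‖F‖) := by
    rw [norm_zero]; positivity
  have d3 : x.2.2.2 = -((0 : ℂ) • solveCLM hc' h' (oneElt ζ ha hσ)) + solveCLM hc' h' F.2.2 := by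
    rw [zero_smul, neg_zero, zero_add]; exact decomp_trd ha hσ hc' h' x
  obtain ⟨u1, u2⟩ := hy lam ζ h hc' h' _ F.1 x.1 ‖F‖ (norm_fst_le F) q1 (decomp_fst ha hσ hc' h' x)
  obtain ⟨v1, v2⟩ := hy lam ζ h hc' h' _ F.2.1 x.2.1 ‖F‖ ((norm_fst_le F.2).trans (norm_snd_le F)) q2
    (decomp_snd ha hσ hc' h' x)
  obtain ⟨t1, -⟩ := hy lam ζ h hc' h' _ F.2.2 x.2.2.2 ‖F‖ ((norm_snd_le F.2).trans (norm_snd_le F)) q3 d3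
  rw [← hE] at u1 u2 v1 v2 t1
  -- Explains the weight `⟨ζ⟩^{1+σ}` of the `ℓ¹` bounds: `⟨ζ⟩^σ` comes from the `H^σ` norm of a
  -- primitive, one more power from the factor `ξ` or `η`.
  have prim : ∀ (d : ℂ) (f : HSob ν (σ + 2) ζ), ‖d‖ ≤ japZ ζ →
      japZ ζ ^ (1 + σ) * ∑' k, ‖f.coeff k‖ ≤ B * E →
      ‖d‖ * ‖(primCLM ζ ha hσ hσ' f : HSob ν σ ζ)‖ ≤ P * (B * E) := by
    intro d f hd hf
    have e1 := hprim ζ f.coeff (summable_norm_coeff hσ' f)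
    have s0 : 0 ≤ ∑' k, ‖f.coeff k‖ := tsum_nonneg fun _ => norm_nonneg _
    have hzσ := Real.rpow_nonneg hz0.le σ
    rw [norm_eq, coeff_primCLM]
    calc _ ≤ japZ ζ * (P * japZ ζ ^ σ * ∑' k, ‖f.coeff k‖) :=
          mul_le_mul hd e1 (sobNorm_nonneg σ ζ _) hz0.le
      _ = P * (japZ ζ ^ (1 + σ) * ∑' k, ‖f.coeff k‖) := by
          rw [Real.rpow_add hz0, Real.rpow_one]; ring
      _ ≤ _ := mul_le_mul_of_nonneg_left hf hP.le
  have n1 : ‖(ζ.1 : ℂ)‖ ≤ japZ ζ := (norm_fst_le_sqrt_zsq ζ).trans (sqrt_zsq_le_japZ ζ)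
  have n2 : ‖(ζ.2 : ℂ)‖ ≤ japZ ζ := (norm_snd_le_sqrt_zsq ζ).trans (sqrt_zsq_le_japZ ζ)
  have hle : σ ≤ σ + 2 := by linarith
  have nu : ‖(incl hle x.1 : HSob ν σ ζ)‖ ≤ B * E := by rw [norm_eq, coeff_incl]; exact u2
  have nv : ‖(incl hle x.2.1 : HSob ν σ ζ)‖ ≤ B * E := by rw [norm_eq, coeff_incl]; exact v2
  have hBE : 0 ≤ B * E := by positivity
  have hγP : 0 ≤ |γ| * P * (B * E) := by positivity
  have hβP : 0 ≤ |β| * P * (B * E) := by positivity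
  have hαB : 0 ≤ |α| * (B * E) := by positivity
  have c1 : ∀ (d : ℂ) (f : HSob ν (σ + 2) ζ) (s : ℂ), ‖s‖ = |α| → ‖d‖ ≤ japZ ζ →
      ‖(incl hle f : HSob ν σ ζ)‖ ≤ B * E →
      ‖s • (incl hle f : HSob ν σ ζ) + (Complex.I * d * (β : ℂ)) • primCLM ζ ha hσ hσ' x.2.2.2‖
        ≤ (|α| + (|β| + 2 * |γ|) * P + 1) * B * E := by
    intro d f s hs hd hf
    refine (norm_add_le _ _).trans ?_
    rw [norm_smul, norm_smul, norm_mul, norm_mul, Complex.norm_I, one_mul, hs, Complex.norm_real,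
      Real.norm_eq_abs]
    have e1 := mul_le_mul_of_nonneg_left hf (abs_nonneg α)
    have e2 := mul_le_mul_of_nonneg_left (prim d x.2.2.2 hd t1) (abs_nonneg β)
    linarith
  obtain ⟨u, v, p, θ⟩ := x
  rw [L1_apply]
  refine norm_prod_le_iff.2 ⟨?_, norm_prod_le_iff.2 ⟨?_, ?_⟩⟩
  · exact c1 _ v _ (by rw [norm_neg, Complex.norm_real, Real.norm_eq_abs]) n1 nv
  · exact c1 _ u _ (by rw [Complex.norm_real, Real.norm_eq_abs]) n2 nu
  · dsimp only
    refine (norm_sub_le _ _).trans ?_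
    rw [norm_smul, norm_smul, norm_neg, norm_mul, norm_mul, norm_mul, norm_mul, Complex.norm_I,
      mul_one, Complex.norm_real, Real.norm_eq_abs]
    have e1 := mul_le_mul_of_nonneg_left (prim _ u n1 u1) (abs_nonneg γ)
    have e2 := mul_le_mul_of_nonneg_left (prim _ v n2 v1) (abs_nonneg γ)
    linarith

/-- The a priori estimate for large `⟨ω⟩`. -/
theorem exists_apriori_of_large (ν : ℝ) [Fact (0 < ν)] {a σ c : ℝ} (α β γ : ℝ) (ha : 0 < a)
    (hσ : σ < 1 / 2) (hσ₁ : -(3 / 2) < σ) (hσ' : 1 / 2 < σ + 2) (hc : 0 < c) :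
    ∃ R : ℝ, ∀ (lam : ℂ) (ζ : ℤ × ℤ), ζ ≠ 0 → R ≤ japOmegaSq lam ζ →
      (∀ k : ℕ+, c * ((k : ℝ) ^ 2 + japOmegaSq lam ζ) ≤ ‖symb ν a lam ζ k‖) →
      c ≤ japOmegaSq lam ζ * ‖∑' k, sineMean a k * ((symb ν a lam ζ k)⁻¹ * sineMean a k)‖ →
      ∀ x ∈ Dom ν a (σ + 2) ζ, ‖(L0 lam ζ ha hσ x : RanSpace ν σ ζ)‖
        ≤ 2 * ‖(L0 lam ζ ha hσ x + L1 α β γ ζ ha hσ hσ' x : RanSpace ν σ ζ)‖ := by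
  obtain ⟨C, hC, hL⟩ := exists_coupling_le ν α β γ ha hσ hσ₁ hσ' hc
  set ε : ℝ := (min 1 (σ + 2) - 1 / 2) / 4 with hε
  have hε0 : 0 < ε := by
    have : 1 / 2 < min 1 (σ + 2) := lt_min (by norm_num) hσ'
    rw [hε]; linarith
  -- Chosen so that `C⟨ω⟩^{-2ε} ≤ 1/2` as soon as `⟨ω⟩² ≥ R`; the coupling is then absorbed.
  refine ⟨(2 * C) ^ (1 / ε), fun lam ζ hζ hR h hD x hx => ?_⟩
  have h1 := hL lam ζ hζ h hD x hx
  have hJ0 : 0 < japOmegaSq lam ζ := by linarith [one_le_japOmegaSq lam ζ]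
  have h2 : C * japOmegaSq lam ζ ^ (-ε) ≤ 1 / 2 := by
    have e1 : japOmegaSq lam ζ ^ (-ε) ≤ ((2 * C) ^ (1 / ε)) ^ (-ε) :=
      Real.rpow_le_rpow_of_nonpos (by positivity) hR (by linarith)
    have e2 : ((2 * C) ^ (1 / ε)) ^ (-ε) = (2 * C)⁻¹ := by
      rw [← Real.rpow_mul (by positivity), ← Real.rpow_neg_one]
      congr 1; field_simp
    calc _ ≤ C * (2 * C)⁻¹ := mul_le_mul_of_nonneg_left (e1.trans e2.le) hC.le
      _ = 1 / 2 := by field_simp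
  set F := (L0 lam ζ ha hσ x : RanSpace ν σ ζ) with hF
  set G := (L1 α β γ ζ ha hσ hσ' x : RanSpace ν σ ζ) with hG
  have h4 : ‖G‖ ≤ 1 / 2 * ‖F‖ := by
    refine h1.trans ?_
    rw [← mul_assoc]
    exact mul_le_mul_of_nonneg_right h2 (norm_nonneg _)
  have h5 : ‖F‖ ≤ ‖F + G‖ + ‖G‖ := by
    calc ‖F‖ = ‖(F + G) - G‖ := by rw [add_sub_cancel_right]
      _ ≤ _ := norm_sub_le _ _
  linarith

end

end PrimEq

end

/-! ### Bounded `⟨ω⟩` by compactness, the uniform a priori estimate, and the operator `𝓛`. -/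

noncomputable section

namespace PrimEq

open HSob Filter Topology

theorem sobNorm₂_le (ν s : ℝ) (ζ : ℤ × ℤ) (f g : ℕ+ → ℂ) :
    sobNorm₂ ν s ζ f g ≤ sobNorm ν s ζ f + sobNorm ν s ζ g := by
  have h1 := sobNorm_nonneg (ν := ν) s ζ f
  have h2 := sobNorm_nonneg (ν := ν) s ζ g
  refine Real.sqrt_le_iff.2 ⟨by positivity, ?_⟩
  nlinarith [mul_nonneg h1 h2]

theorem sobNorm_smul (ν s : ℝ) (ζ : ℤ × ℤ) (d : ℂ) (f : ℕ+ → ℂ) :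
    sobNorm ν s ζ (d • f) = ‖d‖ * sobNorm ν s ζ f := by
  have e : ∀ k : ℕ+, weight ν ζ k ^ s * ‖(d • f) k‖ ^ 2
      = ‖d‖ ^ 2 * (weight ν ζ k ^ s * ‖f k‖ ^ 2) := fun k => by
    rw [Pi.smul_apply, norm_smul]; ring
  unfold sobNorm
  rw [tsum_congr e, tsum_mul_left, Real.sqrt_mul (sq_nonneg _), Real.sqrt_sq (norm_nonneg _)]

variable {ν : ℝ} [hν : Fact (0 < ν)] {a σ : ℝ} {ζ : ℤ × ℤ}

theorem symb_sub (ν a : ℝ) (lam lam' : ℂ) (ζ : ℤ × ℤ) (k : ℕ+) :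
    symb ν a lam ζ k - symb ν a lam' ζ k = lam - lam' := by
  unfold symb; ring

/-- The inclusion `(u,v,p₀,θ) ↦ (u,v,θ)`. -/
def inclRan (ν σ : ℝ) [Fact (0 < ν)] (ζ : ℤ × ℤ) : DomSpace ν σ ζ →L[ℂ] RanSpace ν σ ζ :=
  ((incl (by linarith)).comp (projU ν σ ζ)).prod
    (((incl (by linarith)).comp (projV ν σ ζ)).prod ((incl (by linarith)).comp (projT ν σ ζ)))

theorem inclRan_apply (u v : HSob ν (σ + 2) ζ) (p : ℂ) (θ : HSob ν (σ + 2) ζ) :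
    inclRan ν σ ζ (u, v, p, θ) =
      (incl (by linarith) u, incl (by linarith) v, incl (by linarith) θ) := rfl

theorem helmCLM_sub (lam lam' : ℂ) (f : HSob ν (σ + 2) ζ) :
    helmCLM a σ lam ζ f = helmCLM a σ lam' ζ f + (lam - lam') • incl (by linarith) f := by
  apply ext_coeff
  rw [coeff_add, coeff_smul, coeff_helmCLM, coeff_helmCLM, coeff_incl]
  funext k
  rw [Pi.add_apply, Pi.smul_apply, smul_eq_mul, ← symb_sub ν a lam lam' ζ k]
  ring

/-- `λ` enters only through a term of order zero, and not at all in `𝓛₁`, so moving `λ` is a bounded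
perturbation of size `|λ - λ'|`. -/
theorem L0_sub (lam lam' : ℂ) (ha : 0 < a) (hσ : σ < 1 / 2) (x : DomSpace ν σ ζ) :
    L0 lam ζ ha hσ x = L0 lam' ζ ha hσ x + (lam - lam') • inclRan ν σ ζ x := by
  obtain ⟨u, v, p, θ⟩ := x
  rw [L0_apply, L0_apply, inclRan_apply, helmCLM_sub lam lam' u, helmCLM_sub lam lam' v,
    helmCLM_sub lam lam' θ, Prod.smul_mk, Prod.smul_mk, Prod.mk_add_mk, Prod.mk_add_mk]
  refine Prod.ext ?_ (Prod.ext ?_ rfl)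
  · dsimp only; abel
  · dsimp only; abel

theorem isClosed_setS {δ₁ δ₂ : ℝ} : IsClosed (setS δ₁ δ₂) := by
  have e : setS δ₁ δ₂ = {lam : ℂ | 1 / δ₁ * (-lam.re - δ₂) ≤ |lam.im|} := by
    ext lam
    constructor
    · rintro ⟨μ₁, μ₂, h, rfl⟩
      have h1 : -(-(δ₂ : ℂ) - (μ₁ : ℂ) + Complex.I * (μ₂ : ℂ)).re - δ₂ = μ₁ := by simp
      have h2 : (-(δ₂ : ℂ) - (μ₁ : ℂ) + Complex.I * (μ₂ : ℂ)).im = μ₂ := by simp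
      rw [Set.mem_ofPred_eq, h1, h2]
      exact h
    · intro h
      refine ⟨-lam.re - δ₂, lam.im, h, ?_⟩
      apply Complex.ext
      · simp only [Complex.add_re, Complex.sub_re, Complex.neg_re, Complex.ofReal_re, Complex.mul_re,
          Complex.I_re, Complex.I_im, Complex.ofReal_im]
        ring
      · simp
  rw [e]
  exact isClosed_le (by fun_prop) (by fun_prop)

/-- A bound of the uncoupled operator by the coupled one persists for nearby parameters. -/
theorem exists_apriori_nhds {c : ℝ} {lam₀ : ℂ} (α β γ : ℝ) (ha : 0 < a) (hσ : σ < 1 / 2)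
    (hσ' : 1 / 2 < σ + 2) (hc : 0 < c) (h : ∀ k, c * weight ν ζ k ≤ ‖symb ν a lam₀ ζ k‖)
    (hζ : ζ ≠ 0) (hD : presDet ha hσ hσ' hc h ≠ 0)
    (hinj : ∀ x ∈ Dom ν a (σ + 2) ζ,
      L0 lam₀ ζ ha hσ x + L1 α β γ ζ ha hσ hσ' x = (0 : RanSpace ν σ ζ) → x = 0) :
    ∃ C : ℝ, 0 < C ∧ ∀ᶠ lam in 𝓝 lam₀, ∀ x ∈ Dom ν a (σ + 2) ζ,
      ‖(L0 lam ζ ha hσ x : RanSpace ν σ ζ)‖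
        ≤ C * ‖(L0 lam ζ ha hσ x + L1 α β γ ζ ha hσ hσ' x : RanSpace ν σ ζ)‖ := by
  obtain ⟨-, C₀, hC₀, hb⟩ := surjective_and_bound_of_injective ha hσ hσ' hc h α β γ hζ hD hinj
  set G := solveL0 ha hσ hσ' hc h with hG
  set C₁ : ℝ := ‖(inclRan ν σ ζ).comp G‖ + 1 with hC₁
  have hC₁0 : 0 < C₁ := by positivity
  have hι : ∀ x ∈ Dom ν a (σ + 2) ζ, ‖(inclRan ν σ ζ x : RanSpace ν σ ζ)‖
      ≤ C₁ * ‖(L0 lam₀ ζ ha hσ x : RanSpace ν σ ζ)‖ := fun x hx => by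
    have e := ((inclRan ν σ ζ).comp G).le_opNorm (L0 lam₀ ζ ha hσ x)
    rw [ContinuousLinearMap.comp_apply, hG, solveL0_L0 ha hσ hσ' hc h hζ hD x hx] at e
    refine e.trans (mul_le_mul_of_nonneg_right ?_ (norm_nonneg _))
    rw [hC₁, hG]; linarith
  -- For `|λ - λ₀| < δ` the perturbation is at most `‖F₀‖/(1 + 2C₀)`. This is at most both `‖F₀‖`
  -- and `‖F₀ + K‖/2`, which gives the constant `4C₀ = 2·C₀·2`.
  set δ : ℝ := (C₁ * (1 + 2 * C₀))⁻¹ with hδ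
  have hδ0 : 0 < δ := by positivity
  refine ⟨4 * C₀, by positivity, ?_⟩
  filter_upwards [Metric.ball_mem_nhds lam₀ hδ0] with lam hlam x hx
  rw [Metric.mem_ball, dist_eq_norm] at hlam
  have hx0 := hb x hx
  have hxι := hι x hx
  have hsub := L0_sub (ν := ν) lam lam₀ ha hσ x
  set F₀ := (L0 lam₀ ζ ha hσ x : RanSpace ν σ ζ)
  set F := (L0 lam ζ ha hσ x : RanSpace ν σ ζ)
  set K := (L1 α β γ ζ ha hσ hσ' x : RanSpace ν σ ζ)
  set I := (inclRan ν σ ζ x : RanSpace ν σ ζ)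
  have hI : ‖(lam - lam₀) • I‖ ≤ (1 + 2 * C₀)⁻¹ * ‖F₀‖ := by
    rw [norm_smul]
    calc _ ≤ δ * (C₁ * ‖F₀‖) := mul_le_mul hlam.le hxι (norm_nonneg _) hδ0.le
      _ = _ := by rw [hδ]; field_simp
  have h1 : (1 + 2 * C₀)⁻¹ ≤ 1 := inv_le_one_of_one_le₀ (by linarith)
  have h2 : (1 + 2 * C₀)⁻¹ * C₀ ≤ 1 / 2 := by
    rw [inv_mul_le_iff₀ (by positivity)]; linarith
  have h3 : ‖F‖ ≤ 2 * ‖F₀‖ := by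
    rw [hsub]
    refine (norm_add_le _ _).trans ?_
    have := mul_le_mul_of_nonneg_right h1 (norm_nonneg F₀)
    linarith
  have h4 : ‖F₀ + K‖ ≤ ‖F + K‖ + ‖(lam - lam₀) • I‖ := by
    have e : F₀ + K = (F + K) - (lam - lam₀) • I := by rw [hsub]; abel
    rw [e]
    exact norm_sub_le _ _
  have h5 : (1 + 2 * C₀)⁻¹ * ‖F₀‖ ≤ 1 / 2 * ‖F₀ + K‖ := by
    calc _ ≤ (1 + 2 * C₀)⁻¹ * (C₀ * ‖F₀ + K‖) := mul_le_mul_of_nonneg_left hx0 (by positivity)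
      _ = (1 + 2 * C₀)⁻¹ * C₀ * ‖F₀ + K‖ := by ring
      _ ≤ _ := mul_le_mul_of_nonneg_right h2 (norm_nonneg _)
  have h6 : ‖F₀ + K‖ ≤ 2 * ‖F + K‖ := by linarith
  calc ‖F‖ ≤ 2 * (C₀ * ‖F₀ + K‖) := h3.trans (by linarith)
    _ ≤ 2 * (C₀ * (2 * ‖F + K‖)) := by gcongr
    _ = _ := by ring

theorem finite_japZ_sq_le (R : ℝ) : {ζ : ℤ × ℤ | japZ ζ ^ 2 ≤ R}.Finite := by
  refine ((Set.finite_Icc (-⌈R⌉) ⌈R⌉).prod (Set.finite_Icc (-⌈R⌉) ⌈R⌉)).subset fun ζ hζ => ?_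
  have hz := one_le_japZ ζ
  have hzR : japZ ζ ≤ R := by
    have : japZ ζ ^ 2 ≤ R := hζ
    nlinarith
  have hb : ∀ m : ℤ, |(m : ℝ)| ≤ japZ ζ → m ∈ Set.Icc (-⌈R⌉) ⌈R⌉ := fun m hm => by
    have h1 := abs_le.1 (hm.trans (hzR.trans (Int.le_ceil R)))
    constructor
    · exact_mod_cast h1.1
    · exact_mod_cast h1.2
  exact ⟨hb _ (abs_fst_le_japZ ζ), hb _ (abs_snd_le_japZ ζ)⟩

/-- The a priori estimate, uniformly in `lam ∈ 𝕊` and `ζ ≠ 0`. -/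
theorem exists_apriori {c : ℝ} (α β γ : ℝ) {δ₁ δ₂ : ℝ} (ha : 0 < a) (hσ : σ < 1 / 2)
    (hσ₁ : -(3 / 2) < σ) (hσ' : 1 / 2 < σ + 2) (hc : 0 < c) (hβγ : 0 < β * γ)
    (hS : Disjoint (setS δ₁ δ₂) (eigenvaluesP ν a α β γ))
    (hsymb : ∀ lam ∈ setS δ₁ δ₂, ∀ ζ : ℤ × ℤ, ζ ≠ 0 →
      (∀ k : ℕ+, c * ((k : ℝ) ^ 2 + japOmegaSq lam ζ) ≤ ‖symb ν a lam ζ k‖) ∧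
      c ≤ japOmegaSq lam ζ * ‖∑' k, sineMean a k * ((symb ν a lam ζ k)⁻¹ * sineMean a k)‖) :
    ∃ C : ℝ, 0 < C ∧ ∀ lam ∈ setS δ₁ δ₂, ∀ ζ : ℤ × ℤ, ζ ≠ 0 → ∀ x ∈ Dom ν a (σ + 2) ζ,
      ‖(L0 lam ζ ha hσ x : RanSpace ν σ ζ)‖
        ≤ C * ‖(L0 lam ζ ha hσ x + L1 α β γ ζ ha hσ hσ' x : RanSpace ν σ ζ)‖ := by
  have h3 : 0 < ν := Fact.out
  obtain ⟨R, hR⟩ := exists_apriori_of_large ν α β γ ha hσ hσ₁ hσ' hc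
  have hloc : ∀ ζ : ℤ × ℤ, ∃ C : ℝ, 0 < C ∧ (ζ ≠ 0 →
      ∀ lam ∈ setS δ₁ δ₂ ∩ Metric.closedBall 0 R, ∀ x ∈ Dom ν a (σ + 2) ζ,
      ‖(L0 lam ζ ha hσ x : RanSpace ν σ ζ)‖
        ≤ C * ‖(L0 lam ζ ha hσ x + L1 α β γ ζ ha hσ hσ' x : RanSpace ν σ ζ)‖) := by
    intro ζ
    -- A dummy constant for `ζ = 0`, so that the constants can be chosen as a function on all of
    -- `ℤ²`.
    by_cases hζ : ζ = 0
    · exact ⟨1, one_pos, fun h => absurd hζ h⟩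
    have hK : IsCompact (setS δ₁ δ₂ ∩ Metric.closedBall (0 : ℂ) R) :=
      (isCompact_closedBall 0 R).inter_left isClosed_setS
    -- Having a common bound passes to subsets and finite unions, and holds near each point of `𝕊`;
    -- hence it holds on the compact set.
    have := hK.induction_on (p := fun t => ∃ C : ℝ, 0 < C ∧ ∀ lam ∈ t, ∀ x ∈ Dom ν a (σ + 2) ζ,
      ‖(L0 lam ζ ha hσ x : RanSpace ν σ ζ)‖
        ≤ C * ‖(L0 lam ζ ha hσ x + L1 α β γ ζ ha hσ hσ' x : RanSpace ν σ ζ)‖)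
      ⟨1, one_pos, fun lam h => absurd h (Set.notMem_empty lam)⟩
      (fun s t hst ⟨C, hC, h⟩ => ⟨C, hC, fun lam hl => h lam (hst hl)⟩)
      (fun s t ⟨C, hC, h⟩ ⟨C', hC', h'⟩ => ⟨max C C', lt_max_of_lt_left hC, fun lam hl x hx => by
        rcases hl with hl | hl
        · exact (h lam hl x hx).trans (mul_le_mul_of_nonneg_right (le_max_left _ _) (norm_nonneg _))
        · exact (h' lam hl x hx).trans
            (mul_le_mul_of_nonneg_right (le_max_right _ _) (norm_nonneg _))⟩)
      (fun lam₀ hl => by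
        obtain ⟨hs, hd⟩ := hsymb lam₀ hl.1 ζ hζ
        have hc' : 0 < c / (1 + ν) := by positivity
        have h' := weight_le_symb hc hs
        have hD : presDet ha hσ hσ' hc' h' ≠ 0 := fun h0 => by
          rw [presDet_eq] at h0
          rw [h0, norm_zero, mul_zero] at hd
          linarith
        obtain ⟨C, hC, hev⟩ := exists_apriori_nhds α β γ ha hσ hσ' hc' h' hζ hD fun x hx h0 =>
          eq_zero_of_kernel ha hσ hσ' hc' h' hβγ hζ (Set.disjoint_left.1 hS hl.1) x hx h0
        exact ⟨_, mem_nhdsWithin_of_mem_nhds hev, C, hC, fun lam hl => hl⟩)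
    obtain ⟨C, hC, h⟩ := this
    exact ⟨C, hC, fun _ => h⟩
  choose D hD0 hD using hloc
  set A := (finite_japZ_sq_le R).toFinset with hA
  have hsum0 : 0 ≤ ∑ ζ ∈ A, D ζ := Finset.sum_nonneg fun ζ _ => (hD0 ζ).le
  -- `2` serves the range `⟨ω⟩² ≥ R`. Otherwise `⟨ζ⟩² ≤ R` and `|λ| ≤ R`, so `ζ` lies in the finite
  -- set `A` and the sum dominates `D ζ`.
  refine ⟨2 + ∑ ζ ∈ A, D ζ, by positivity, fun lam hlam ζ hζ x hx => ?_⟩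
  obtain ⟨hs, hd⟩ := hsymb lam hlam ζ hζ
  rcases le_total R (japOmegaSq lam ζ) with h | h
  · refine (hR lam ζ hζ h hs hd x hx).trans (mul_le_mul_of_nonneg_right ?_ (norm_nonneg _))
    linarith
  · have hζA : ζ ∈ A := by
      rw [hA, Set.Finite.mem_toFinset]
      exact (japZ_sq_le_japOmegaSq lam ζ).trans h
    have hball : lam ∈ Metric.closedBall (0 : ℂ) R := by
      rw [mem_closedBall_zero_iff]
      unfold japOmegaSq at h
      nlinarith [sq_nonneg (japZ ζ)]
    refine (hD ζ hζ lam ⟨hlam, hball⟩ x hx).trans (mul_le_mul_of_nonneg_right ?_ (norm_nonneg _))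
    have := Finset.single_le_sum (f := D) (fun ζ _ => (hD0 ζ).le) hζA
    linarith

/-- The product type carries the maximum norm, the theorem the Euclidean one. -/
theorem norm_ran_le_sobNorm₃ (F : RanSpace ν σ ζ) :
    ‖F‖ ≤ sobNorm₃ ν σ ζ F.1.coeff F.2.1.coeff F.2.2.coeff := by
  have h1 := sq_nonneg (sobNorm ν σ ζ F.1.coeff)
  have h2 := sq_nonneg (sobNorm ν σ ζ F.2.1.coeff)
  have h3 := sq_nonneg (sobNorm ν σ ζ F.2.2.coeff)
  unfold sobNorm₃
  refine norm_prod_le_iff.2 ⟨?_, norm_prod_le_iff.2 ⟨?_, ?_⟩⟩ <;> rw [norm_eq] <;>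
    refine Real.le_sqrt_of_sq_le ?_ <;> linarith

/-- The operator `𝓛` on its domain. -/
def coupled (α β γ : ℝ) (lam : ℂ) (ζ : ℤ × ℤ) (ha : 0 < a) (hσ : σ < 1 / 2) (hσ' : 1 / 2 < σ + 2)
    (x : Dom ν a (σ + 2) ζ) : RanSpace ν σ ζ :=
  L0 lam ζ ha hσ x.1 + L1 α β γ ζ ha hσ hσ' x.1

theorem isCoupledOperator_coupled (α β γ : ℝ) (lam : ℂ) (ha : 0 < a) (hσ : σ < 1 / 2)
    (hσ' : 1 / 2 < σ + 2) : IsCoupledOperator ν a α β γ σ lam ζ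
      (coupled α β γ lam ζ ha hσ hσ') := by
  intro u v p θ h
  have lu := summable_norm_coeff hσ' u
  have lv := summable_norm_coeff hσ' v
  have hP : ∀ d : ℂ, sineCoeff a (fun z => d * primitive a θ.coeff z) = d • primCoeff a θ.coeff :=
    fun d => funext fun k => sineCoeff_const_mul a d _ k
  refine Prod.ext (funext fun k => ?_) (Prod.ext (funext fun k => ?_) (funext fun k => ?_))
  · refine (coeff_L_fst lam α β γ ha hσ hσ' u v p θ k).trans ?_
    simp only [opL0, opL1, Prod.fst_add, Pi.add_apply, helmholtz_eq, sineCoeff_const, hP,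
      Pi.smul_apply, smul_eq_mul]
    ring
  · refine (coeff_L_snd lam α β γ ha hσ hσ' u v p θ k).trans ?_
    simp only [opL0, opL1, Prod.fst_add, Prod.snd_add, Pi.add_apply, helmholtz_eq, sineCoeff_const,
      hP, Pi.smul_apply, smul_eq_mul]
    ring
  · refine (coeff_L_trd lam α β γ ha hσ hσ' u v p θ k).trans ?_
    simp only [opL0, opL1, Prod.snd_add, Pi.add_apply, helmholtz_eq, sineCoeff_vertVel a _ ζ lu lv,
      Pi.sub_apply, Pi.smul_apply, smul_eq_mul]
    ring

theorem continuous_coupled (α β γ : ℝ) (lam : ℂ) (ha : 0 < a) (hσ : σ < 1 / 2)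
    (hσ' : 1 / 2 < σ + 2) :
    Continuous (coupled α β γ lam ζ ha hσ hσ' : Dom ν a (σ + 2) ζ → RanSpace ν σ ζ) :=
  ((L0 lam ζ ha hσ).continuous.comp continuous_subtype_val).add
    ((L1 α β γ ζ ha hσ hσ').continuous.comp continuous_subtype_val)

/-- The constraint is linear, so the difference of two elements of the domain is again in it and a
trivial kernel gives injectivity; surjectivity is the Fredholm reduction. -/
theorem bijective_coupled {c : ℝ} {lam : ℂ} (α β γ : ℝ) (ha : 0 < a) (hσ : σ < 1 / 2)
    (hσ' : 1 / 2 < σ + 2) (hc : 0 < c) (h : ∀ k, c * weight ν ζ k ≤ ‖symb ν a lam ζ k‖)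
    (hζ : ζ ≠ 0) (hD : presDet ha hσ hσ' hc h ≠ 0)
    (hinj : ∀ x ∈ Dom ν a (σ + 2) ζ,
      L0 lam ζ ha hσ x + L1 α β γ ζ ha hσ hσ' x = (0 : RanSpace ν σ ζ) → x = 0) :
    Function.Bijective
      (coupled α β γ lam ζ ha hσ hσ' : Dom ν a (σ + 2) ζ → RanSpace ν σ ζ) := by
  constructor
  · rintro ⟨x, hx⟩ ⟨y, hy⟩ hxy
    have hxy' : (L0 lam ζ ha hσ x + L1 α β γ ζ ha hσ hσ' x : RanSpace ν σ ζ)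
      = L0 lam ζ ha hσ y + L1 α β γ ζ ha hσ hσ' y := hxy
    have hmem : x - y ∈ Dom ν a (σ + 2) ζ := by
      rw [mem_Dom_iff ha hσ'] at hx hy ⊢
      rw [Prod.fst_sub, Prod.snd_sub, Prod.fst_sub, map_sub, map_sub]
      linear_combination hx - hy
    have h0 := hinj (x - y) hmem (by
      rw [map_sub, map_sub, sub_add_sub_comm, hxy', sub_self])
    exact Subtype.ext (sub_eq_zero.1 h0)
  · intro F
    obtain ⟨x, hx, hF⟩ := (surjective_and_bound_of_injective ha hσ hσ' hc h α β γ hζ hD hinj).1 F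
    exact ⟨⟨x, hx⟩, hF⟩

/-- The resolvent estimate for a single sine series. -/
theorem solveCLM_bound {c : ℝ} {lam : ℂ} (hc : 0 < c)
    (h : ∀ k : ℕ+, c * ((k : ℝ) ^ 2 + japOmegaSq lam ζ) ≤ ‖symb ν a lam ζ k‖)
    (hc' : 0 < c / (1 + ν)) (h' : ∀ k, c / (1 + ν) * weight ν ζ k ≤ ‖symb ν a lam ζ k‖)
    (f : HSob ν σ ζ) :
    japOmegaSq lam ζ * sobNorm ν σ ζ (solveCLM hc' h' f).coeff
        + sobNorm ν (σ + 2) ζ (solveCLM hc' h' f).coeff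
      ≤ (c⁻¹ + (c / (1 + ν))⁻¹) * sobNorm ν σ ζ f.coeff := by
  rw [add_mul]
  refine add_le_add ?_ ?_
  · rw [coeff_solveCLM]
    exact japOmegaSq_mul_sobNorm_le hc h f.2
  · rw [← norm_eq, ← norm_eq]
    exact norm_solveFun_le hc' h' f

end PrimEq

end

theorem theorem3 (ν a α β γ σ δ₁ δ₂ : ℝ) [Fact (0 < ν)] (ha : 0 < a) (hβγ : 0 < β * γ)
    (hσ₁ : -(3 / 2) < σ) (hσ₂ : σ < 1 / 2) (hσ₃ : σ ≠ -(1 / 2))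
    (hδ₁ : 0 < δ₁) (hδ₂ : δ₂ < min (ν * Real.pi ^ 2 / (2 * a ^ 2)) (ν / 2))
    (hS : Disjoint (setS δ₁ δ₂) (eigenvaluesP ν a α β γ)) :
    ∃ C : ℝ, 0 < C ∧ ∀ lam ∈ setS δ₁ δ₂, ∀ ζ : ℤ × ℤ, ζ ≠ 0 →
      ∃ T : Dom ν a (σ + 2) ζ → HSob ν σ ζ × HSob ν σ ζ × HSob ν σ ζ,
        IsCoupledOperator ν a α β γ σ lam ζ T ∧ Continuous T ∧ Function.Bijective T ∧
        ∀ (u v : HSob ν (σ + 2) ζ) (p₀ : ℂ) (θ : HSob ν (σ + 2) ζ)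
          (h : (u, v, p₀, θ) ∈ Dom ν a (σ + 2) ζ) (f₁ f₂ f₃ : HSob ν σ ζ),
          T ⟨(u, v, p₀, θ), h⟩ = (f₁, f₂, f₃) →
          -- (a)
          Real.sqrt (zsq ζ) * ‖p₀‖ ≤ C * (japOmegaSq lam ζ * bigM σ lam ζ
              * sobNorm₃ ν σ ζ f₁.coeff f₂.coeff f₃.coeff) ∧
          (∃ u₁ v₁ u₂ v₂ : HSob ν (σ + 2) ζ, u = u₁ + u₂ ∧ v = v₁ + v₂ ∧
            -- (b)
            bigM (-σ - 2) lam ζ * (bigM (-σ) lam ζ)⁻¹ * sobNorm₂ ν σ ζ u₁.coeff v₁.coeff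
                + sobNorm₂ ν (σ + 2) ζ u₁.coeff v₁.coeff
              ≤ C * (japOmegaSq lam ζ * bigM σ lam ζ * bigM (-σ - 2) lam ζ
                * sobNorm₃ ν σ ζ f₁.coeff f₂.coeff f₃.coeff) ∧
            -- (c)
            japOmegaSq lam ζ * sobNorm₂ ν σ ζ u₂.coeff v₂.coeff
                + sobNorm₂ ν (σ + 2) ζ u₂.coeff v₂.coeff
              ≤ C * sobNorm₃ ν σ ζ f₁.coeff f₂.coeff f₃.coeff) ∧
          -- (d)
          japOmegaSq lam ζ * sobNorm ν σ ζ θ.coeff + sobNorm ν (σ + 2) ζ θ.coeff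
            ≤ C * sobNorm₃ ν σ ζ f₁.coeff f₂.coeff f₃.coeff := by
  have hν : 0 < ν := Fact.out
  have hσ' : 1 / 2 < σ + 2 := by linarith
  obtain ⟨c, hc, hsymb⟩ :=
    exists_symbol_bounds hν ha hδ₁ (hδ₂.trans_le (min_le_right _ _))
  obtain ⟨Ca, hCa, hapr⟩ := exists_apriori (ν := ν) α β γ ha hσ₂ hσ₁ hσ' hc hβγ hS hsymb
  obtain ⟨Cp, hCp, hpres⟩ := exists_pressure_le ν ha hσ₂ hσ₁ hc
  obtain ⟨C₁, hC₁, hmean₁⟩ := exists_sobNorm_mean_le ν ha hc (s := σ) (by linarith)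
  obtain ⟨C₂, hC₂, hmean₂⟩ := exists_sobNorm_mean_le ν ha hc (s := σ + 2) (by linarith)
  have hc' : 0 < c / (1 + ν) := by positivity
  set K : ℝ := c⁻¹ + (c / (1 + ν))⁻¹ with hK
  have hK0 : 0 < K := by positivity
  -- The three summands serve (a), (b) and (c); the last also covers (d). The factors `2` come from
  -- the two velocity components.
  refine ⟨Cp * Ca + 2 * (C₁ + C₂) * (Cp * Ca) + 2 * (K * Ca), by positivity,
    fun lam hlam ζ hζ => ?_⟩
  obtain ⟨hs, hd⟩ := hsymb lam hlam ζ hζ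
  have h' := weight_le_symb hc hs
  have hD : presDet ha hσ₂ hσ' hc' h' ≠ 0 := fun h0 => by
    rw [presDet_eq] at h0
    rw [h0, norm_zero, mul_zero] at hd
    linarith
  have hinj := eq_zero_of_kernel ha hσ₂ hσ' hc' h' hβγ hζ (Set.disjoint_left.1 hS hlam)
  refine ⟨coupled α β γ lam ζ ha hσ₂ hσ', isCoupledOperator_coupled α β γ lam ha hσ₂ hσ',
    continuous_coupled α β γ lam ha hσ₂ hσ',
    bijective_coupled α β γ ha hσ₂ hσ' hc' h' hζ hD hinj, ?_⟩
  intro u v p₀ θ h f₁ f₂ f₃ hT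
  set x : DomSpace ν σ ζ := (u, v, p₀, θ)
  set F : RanSpace ν σ ζ := L0 lam ζ ha hσ₂ x with hF
  set N := sobNorm₃ ν σ ζ f₁.coeff f₂.coeff f₃.coeff
  -- The a priori estimate replaces the uncoupled datum `F = 𝓛₀x` by the given right-hand side; from
  -- here on only the uncoupled formulas are used.
  have hFN : ‖F‖ ≤ Ca * N := by
    have h1 := hapr lam hlam ζ hζ x h
    have h2 : L0 lam ζ ha hσ₂ x + L1 α β γ ζ ha hσ₂ hσ' x = ((f₁, f₂, f₃) : RanSpace ν σ ζ) := hT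
    rw [h2] at h1
    exact h1.trans (mul_le_mul_of_nonneg_left (norm_ran_le_sobNorm₃ (f₁, f₂, f₃)) hCa.le)
  have hN : 0 ≤ N := Real.sqrt_nonneg _
  have hJ : 0 < japOmegaSq lam ζ := one_pos.trans_le (one_le_japOmegaSq lam ζ)
  have hM := bigM_pos (s := σ) (by linarith) lam ζ
  have hM₁ := bigM_pos (s := -σ) (by linarith) lam ζ
  have hM₂ := bigM_pos (s := -σ - 2) (by linarith) lam ζ
  have hm₁ := hmean₁ lam ζ hs
  have hm₂ := hmean₂ lam ζ hs
  rw [show -(σ + 2) = -σ - 2 by ring] at hm₂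
  have hp : Real.sqrt (zsq ζ) * ‖p₀‖ ≤ Cp * Ca * (japOmegaSq lam ζ * bigM σ lam ζ * N) := by
    refine (hpres lam ζ hζ hs hd x h).trans ?_
    calc Cp * (japOmegaSq lam ζ * bigM σ lam ζ * ‖F‖)
        ≤ Cp * (japOmegaSq lam ζ * bigM σ lam ζ * (Ca * N)) := by gcongr
      _ = _ := by ring
  have hQ : 0 ≤ japOmegaSq lam ζ * bigM σ lam ζ * N := by positivity
  set Q := japOmegaSq lam ζ * bigM σ lam ζ * N
  have hsolve : ∀ f : HSob ν σ ζ, sobNorm ν σ ζ f.coeff ≤ ‖F‖ →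
      japOmegaSq lam ζ * sobNorm ν σ ζ (HSob.solveCLM hc' h' f).coeff
        + sobNorm ν (σ + 2) ζ (HSob.solveCLM hc' h' f).coeff ≤ K * Ca * N := fun f hf =>
    calc _ ≤ K * sobNorm ν σ ζ f.coeff := solveCLM_bound hc hs hc' h' f
      _ ≤ K * (Ca * N) := mul_le_mul_of_nonneg_left (hf.trans hFN) hK0.le
      _ = _ := by ring
  have hone : ∀ m : ℤ, ‖(m : ℂ)‖ ≤ Real.sqrt (zsq ζ) →
      sobNorm ν σ ζ (-((p₀ * (Complex.I * (m : ℂ))) • HSob.solveCLM hc' h' (HSob.oneElt ζ ha hσ₂))).coeff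
        ≤ Cp * Ca * Q * (C₁ * bigM (-σ) lam ζ) ∧
      sobNorm ν (σ + 2) ζ
        (-((p₀ * (Complex.I * (m : ℂ))) • HSob.solveCLM hc' h' (HSob.oneElt ζ ha hσ₂))).coeff
        ≤ Cp * Ca * Q * (C₂ * bigM (-σ - 2) lam ζ) := fun m hm => by
    have hn : ‖-(p₀ * (Complex.I * (m : ℂ)))‖ ≤ Cp * Ca * Q := by
      rw [norm_neg, norm_mul, norm_mul, Complex.norm_I, one_mul, mul_comm]
      exact (mul_le_mul_of_nonneg_right hm (norm_nonneg _)).trans hp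
    rw [← neg_smul, HSob.coeff_smul, sobNorm_smul, sobNorm_smul, HSob.coeff_solveCLM, HSob.coeff_oneElt]
    exact ⟨mul_le_mul hn hm₁ (sobNorm_nonneg _ _ _) (by positivity),
      mul_le_mul hn hm₂ (sobNorm_nonneg _ _ _) (by positivity)⟩
  -- `Y₁` is the response of `(ω² - ν∂_zz)⁻¹` to the pressure gradient, and `Y₂` its response to the
  -- velocity rows of `𝓛₀x`.
  refine ⟨hp.trans ?_, ⟨_, _, _, _, decomp_fst ha hσ₂ hc' h' x, decomp_snd ha hσ₂ hc' h' x,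
    ?_, ?_⟩, ?_⟩
  · refine mul_le_mul_of_nonneg_right ?_ hQ
    have : 0 ≤ 2 * (C₁ + C₂) * (Cp * Ca) := by positivity
    have : 0 ≤ 2 * (K * Ca) := by positivity
    linarith
  · obtain ⟨a₁, a₂⟩ := hone ζ.1 (norm_fst_le_sqrt_zsq ζ)
    obtain ⟨b₁, b₂⟩ := hone ζ.2 (norm_snd_le_sqrt_zsq ζ)
    have e₁ := (sobNorm₂_le ν σ ζ _ _).trans (add_le_add a₁ b₁)
    have e₂ := (sobNorm₂_le ν (σ + 2) ζ _ _).trans (add_le_add a₂ b₂)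
    have e₃ := mul_le_mul_of_nonneg_left e₁
      (show 0 ≤ bigM (-σ - 2) lam ζ * (bigM (-σ) lam ζ)⁻¹ by positivity)
    refine (add_le_add e₃ e₂).trans ?_
    calc _ = 2 * (C₁ + C₂) * (Cp * Ca) * (Q * bigM (-σ - 2) lam ζ) := by
          -- The `H^σ` norm of `Y₁` carries `M_{-σ}`, its `H^{σ+2}` norm `M_{-σ-2}`; the prefactor
          -- in (b) exchanges one for the other.
          have e : (bigM (-σ) lam ζ)⁻¹ * bigM (-σ) lam ζ = 1 := inv_mul_cancel₀ hM₁.ne'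
          linear_combination (2 * C₁ * bigM (-σ - 2) lam ζ * (Cp * Ca * Q)) * e
      _ ≤ (Cp * Ca + 2 * (C₁ + C₂) * (Cp * Ca) + 2 * (K * Ca))
          * (Q * bigM (-σ - 2) lam ζ) := by
        refine mul_le_mul_of_nonneg_right ?_ (by positivity)
        have : 0 ≤ Cp * Ca := by positivity
        have : 0 ≤ 2 * (K * Ca) := by positivity
        linarith
      _ = _ := by ring
  · have a₁ := hsolve F.1 (norm_fst_ran_le F)
    have a₂ := hsolve F.2.1 (norm_snd_ran_le F)
    have e₁ := mul_le_mul_of_nonneg_left (sobNorm₂_le ν σ ζ (HSob.solveCLM hc' h' F.1).coeff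
      (HSob.solveCLM hc' h' F.2.1).coeff) hJ.le
    have e₂ := sobNorm₂_le ν (σ + 2) ζ (HSob.solveCLM hc' h' F.1).coeff
      (HSob.solveCLM hc' h' F.2.1).coeff
    calc _ ≤ 2 * (K * Ca) * N := by linarith
      _ ≤ _ := by
        refine mul_le_mul_of_nonneg_right ?_ hN
        have : 0 ≤ Cp * Ca + 2 * (C₁ + C₂) * (Cp * Ca) := by positivity
        linarith
  · have e : θ = HSob.solveCLM hc' h' F.2.2 := decomp_trd ha hσ₂ hc' h' x
    rw [e]
    refine (hsolve F.2.2 (norm_trd_ran_le F)).trans (mul_le_mul_of_nonneg_right ?_ hN)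
    have : 0 ≤ Cp * Ca + 2 * (C₁ + C₂) * (Cp * Ca) := by positivity
    have : 0 ≤ K * Ca := by positivity
    linarith
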